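/- Let $\mathbb{F}_q$ be a finite field, and for $n\ge 0$ let $C_n(q)$ be the complex space of functions on $\mathfrak{gl}_n(\mathbb{F}_q)$ invariant under the adjoint action of $\mathrm{GL}_n(\mathbb{F}_q)$, with the hermitian form $(f,g)=\frac{1}{|\mathrm{GL}_n(\mathbb{F}_q)|}\sum_{x}f(x)\overline{g(x)}$ (here $\mathfrak{gl}_0=\{0\}$, $C_0(q)=\mathbb{C}$). For a standard (block upper triangular) parabolic subgroup $P$ of $\mathrm{GL}_n$, with block diagonal Levi subgroup and unipotent radical $U_P$, with $\mathcal{P},\mathcal{L},\mathcal{U}$ the Lie algebras of $P$, of the Levi subgroup and of $U_P$, and with the projection $\pi\colon\mathcal{P}\to\mathcal{L}$, let $${}^*R_{\mathcal L}(f)(x)=\frac{1}{|U_P(\mathbb{F}_q)|}\sum_{u\in\mathcal{U}(\mathbb{F}_q)}f(x+u),\qquad R_{\mathcal L}(f)(x)=\frac{1}{|P(\mathbb{F}_q)|}\sum_{g\in \mathrm{GL}_n(\mathbb{F}_q),\ gxg^{-1}\in\mathcal{P}}f(\pi(gxg^{-1}))$$ be Harish-Chandra restriction and induction. Let $C(q)=\bigoplus_{n\ge0}C_n(q)$,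 with multiplication $m$ given by the inductions $C_k(q)\otimes C_l(q)\cong C(\mathfrak{gl}_k\times\mathfrak{gl}_l)\to C_{k+l}(q)$, comultiplication $m^*$ given on $C_n(q)$ by the sum over $k+l=n$ of the restrictions $C_n(q)\to C(\mathfrak{gl}_k\times\mathfrak{gl}_l)\cong C_k(q)\otimes C_l(q)$, and unit and counit given by the inclusion of and the projection to $C_0(q)=\mathbb{C}$. Let $\mathcal{D}_n=\sum_P(-1)^{r(P)}R_{\mathcal{L}_P}\circ{}^*R_{\mathcal{L}_P}$ on $C_n(q)$, where $P$ runs over the standard parabolic subgroups of $\mathrm{GL}_n$ and $r(P)$ is the semisimple rank ($n$ minus the number of diagonal blocks), let $S=\bigoplus_n(-1)^n\mathcal{D}_n$, and let $\mathrm{St}_n=\mathcal{D}_n(1)$ be the Steinberg function. An invariant character is an element of $C_n(q)$ that is the character of a finite-dimensional complex representation of the additive group $\mathfrak{gl}_n(\mathbb{F}_q)$; a nonzero one is irreducible if it is not a sum of two nonzero invariant characters. Let $\Omega(q)\subseteq C(q)$ be the set of all normalised irreducible invariant characters $\chi/\sqrt{(\chi,\chi)}$, for all $n$, and let $\mathfrak{C}(q)=\mathbb{R}[\Omega(q)]$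 be its real span, graded by the degrees of the elements of $\Omega(q)$. For $R=\mathbb{Z}$ or $R=\mathbb{R}$, a PSH algebra over $R$ is a pair $(\mathcal{H},\Omega)$, where $\mathcal{H}=\bigoplus_{n\ge0}\mathcal{H}_n$ is a connected graded Hopf algebra over $R$ and $\Omega$ is an $R$-basis of homogeneous elements, such that unit, counit, multiplication and comultiplication preserve linear combinations of $\Omega$ (resp. $\Omega\otimes\Omega$) with nonnegative coefficients, and unit/counit and multiplication/comultiplication are adjoint pairs for the bilinear forms making $\Omega$ and $\Omega\otimes\Omega$ orthonormal. A real PSH algebra ($R=\mathbb{R}$) is descending if there are a PSH algebra $(A,\Psi)$ over $\mathbb{Z}$ and an isomorphism of connected graded Hopf algebras $A\otimes_{\mathbb{Z}}\mathbb{R}\to\mathcal{H}$ taking $\Psi$ onto $\Omega$, and non-descending otherwise. Then $C(q)$ is a connected graded Hopf algebra over $\mathbb{C}$ with antipode $S$; one has $S(\Omega(q))\subseteq\mathfrak{C}(q)$, the structure maps of $C(q)$ restrict to $\mathfrak{C}(q)$, and with them $(\mathfrak{C}(q),S(\Omega(q)))$ is a non-descending real PSH algebra. It differs from $(\mathfrak{C}(q),\Omega(q))$,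 that is, $S(\Omega(q))\ne\Omega(q)$; moreover, for every $n\ge2$, no complex scalar multiple of $\mathrm{St}_n$ is an irreducible invariant character. -/

import Mathlib

open scoped TensorProduct DirectSum

set_option linter.unusedSectionVars false

/-! ## Graded Hopf algebras and PSH algebras over an ordered commutative ring -/

/-- The four structure maps of a (candidate) bialgebra on an `R`-module `A`. -/
structure BialgData (R : Type*) (A : Type*) [CommRing R] [AddCommGroup A] [Module R A] where
  mul : A ⊗[R] A →ₗ[R] A
  unit : R →ₗ[R] A
  comul : A →ₗ[R] A ⊗[R] A
  counit : A →ₗ[R] R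

namespace BialgData

section Laws

variable {R A : Type*} [CommRing R] [AddCommGroup A] [Module R A] (D : BialgData R A)

/-- The bialgebra axioms: associative unital algebra, coassociative counital coalgebra, and the
comultiplication and the counit are homomorphisms of unital algebras, where
`(x ⊗ y) (x' ⊗ y') = x x' ⊗ y y'` on `A ⊗ A`. -/
structure IsBialgebra : Prop where
  mul_assoc : D.mul ∘ₗ D.mul.rTensor A
    = D.mul ∘ₗ D.mul.lTensor A ∘ₗ (TensorProduct.assoc R A A A).toLinearMap
  one_mul : ∀ a, D.mul (D.unit 1 ⊗ₜ[R] a) = a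
  mul_one : ∀ a, D.mul (a ⊗ₜ[R] D.unit 1) = a
  coassoc : (TensorProduct.assoc R A A A).toLinearMap ∘ₗ D.comul.rTensor A ∘ₗ D.comul
    = D.comul.lTensor A ∘ₗ D.comul
  counit_comul : ∀ a, D.counit.rTensor A (D.comul a) = 1 ⊗ₜ[R] a
  comul_counit : ∀ a, D.counit.lTensor A (D.comul a) = a ⊗ₜ[R] 1
  comul_mul : D.comul ∘ₗ D.mul
    = TensorProduct.map D.mul D.mul ∘ₗ
        (TensorProduct.tensorTensorTensorComm R A A A A).toLinearMap ∘ₗ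
        TensorProduct.map D.comul D.comul
  comul_one : D.comul (D.unit 1) = D.unit 1 ⊗ₜ[R] D.unit 1
  counit_mul : ∀ a b, D.counit (D.mul (a ⊗ₜ[R] b)) = D.counit a * D.counit b
  counit_one : D.counit (D.unit 1) = 1

/-- `S` is an antipode: a two-sided inverse of the identity for the convolution product. -/
structure IsAntipode (S : A →ₗ[R] A) : Prop where
  left : D.mul ∘ₗ S.rTensor A ∘ₗ D.comul = D.unit ∘ₗ D.counit
  right : D.mul ∘ₗ S.lTensor A ∘ₗ D.comul = D.unit ∘ₗ D.counit

/-- The axioms of a connected graded Hopf algebra `A = ⨁ₙ 𝒜 n`. -/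
structure IsConnectedGradedHopf (𝒜 : ℕ → Submodule R A) : Prop extends D.IsBialgebra where
  exists_antipode : ∃ S : A →ₗ[R] A, D.IsAntipode S
  isInternal : DirectSum.IsInternal 𝒜
  mul_mem : ∀ k l, ∀ a ∈ 𝒜 k, ∀ b ∈ 𝒜 l, D.mul (a ⊗ₜ[R] b) ∈ 𝒜 (k + l)
  comul_mem : ∀ n, ∀ a ∈ 𝒜 n, D.comul a ∈
    ⨆ p ∈ Finset.HasAntidiagonal.antidiagonal n,
      LinearMap.range (TensorProduct.map (𝒜 p.1).subtype (𝒜 p.2).subtype)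
  counit_eq_zero : ∀ n, n ≠ 0 → ∀ a ∈ 𝒜 n, D.counit a = 0
  unit_injective : Function.Injective D.unit
  range_unit : LinearMap.range D.unit = 𝒜 0

/-- `Ω` is an `R`-basis of `A`. -/
def IsBasisSet (R : Type*) {A : Type*} [CommRing R] [AddCommGroup A] [Module R A]
    (Ω : Set A) : Prop :=
  LinearIndepOn R id Ω ∧ Submodule.span R Ω = ⊤

/-- The set `Ω ⊗ Ω` of pure tensors of elements of `Ω`. -/
def tensorSet (R : Type*) {A : Type*} [CommRing R] [AddCommGroup A] [Module R A]
    (Ω : Set A) : Set (A ⊗[R] A) :=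
  {t | ∃ x ∈ Ω, ∃ y ∈ Ω, t = x ⊗ₜ[R] y}

/-- The family `v` is orthonormal for the bilinear form `B`. -/
def IsOrthonormalFor {M ι : Type*} [AddCommGroup M] [Module R M]
    (B : LinearMap.BilinForm R M) (v : ι → M) : Prop :=
  (∀ i, B (v i) (v i) = 1) ∧ ∀ i j, i ≠ j → B (v i) (v j) = 0

/-- `(A, Ω)` is a PSH algebra over the ordered ring `R` (for `R = ℤ` this is Zelevinsky's notion,
for `R = ℝ` that of a real PSH algebra). Here `PointedCone.hull R Ω` is the set of
linear combinations of elements of `Ω` with nonnegative coefficients. The forms `B` and `B₂` are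
determined by orthonormality, as `Ω` and `Ω ⊗ Ω` are bases. -/
structure IsPSH [PartialOrder R] [IsOrderedRing R] (𝒜 : ℕ → Submodule R A) (Ω : Set A) :
    Prop extends D.IsConnectedGradedHopf 𝒜 where
  isBasis : IsBasisSet R Ω
  homogeneous : ∀ ω ∈ Ω, ∃ n, ω ∈ 𝒜 n
  unit_pos : ∀ r : R, 0 ≤ r → D.unit r ∈ PointedCone.hull R Ω
  counit_pos : ∀ a ∈ PointedCone.hull R Ω, 0 ≤ D.counit a
  mul_pos : ∀ t ∈ PointedCone.hull R (tensorSet R Ω), D.mul t ∈ PointedCone.hull R Ω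
  comul_pos : ∀ a ∈ PointedCone.hull R Ω, D.comul a ∈ PointedCone.hull R (tensorSet R Ω)
  self_adjoint : ∃ (B : LinearMap.BilinForm R A) (B₂ : LinearMap.BilinForm R (A ⊗[R] A)),
    IsOrthonormalFor B (fun ω : Ω => (ω : A)) ∧
    IsOrthonormalFor B₂ (fun p : Ω × Ω => (p.1 : A) ⊗ₜ[R] (p.2 : A)) ∧
    (∀ t a, B (D.mul t) a = B₂ t (D.comul a)) ∧
    (∀ r a, B (D.unit r) a = r * D.counit a)

/-- A linear map is compatible with all four structure maps. -/
structure IsHom {A' : Type*} [AddCommGroup A'] [Module R A'] (D : BialgData R A)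
    (D' : BialgData R A') (φ : A →ₗ[R] A') : Prop where
  map_mul : ∀ t, φ (D.mul t) = D'.mul (TensorProduct.map φ φ t)
  map_unit : ∀ r, φ (D.unit r) = D'.unit r
  map_comul : ∀ a, TensorProduct.map φ φ (D.comul a) = D'.comul (φ a)
  map_counit : ∀ a, D.counit a = D'.counit (φ a)

/-- Extension of scalars of the structure maps along `R → K`. -/
noncomputable def baseChange (K : Type*) [CommRing K] [Algebra R K] :
    BialgData K (K ⊗[R] A) where
  mul := D.mul.baseChange K ∘ₗ
    (TensorProduct.AlgebraTensorModule.distribBaseChange R K A A).symm.toLinearMap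
  unit := D.unit.baseChange K ∘ₗ (TensorProduct.AlgebraTensorModule.rid R K K).symm.toLinearMap
  comul := (TensorProduct.AlgebraTensorModule.distribBaseChange R K A A).toLinearMap ∘ₗ
    D.comul.baseChange K
  counit := (TensorProduct.AlgebraTensorModule.rid R K K).toLinearMap ∘ₗ D.counit.baseChange K

end Laws

/-- The real PSH algebra `(H, Ω)` is descending: it is isomorphic, as a connected graded Hopf
algebra with distinguished basis, to the scalar extension of a PSH algebra `(A, Ψ)` over `ℤ`. -/
def IsDescending.{u} {H : Type u} [AddCommGroup H] [Module ℝ H] (D : BialgData ℝ H)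
    (ℋ : ℕ → Submodule ℝ H) (Ω : Set H) : Prop :=
  ∃ (A : Type u) (_ : AddCommGroup A) (E : BialgData ℤ A) (𝒜 : ℕ → Submodule ℤ A) (Ψ : Set A),
    E.IsPSH 𝒜 Ψ ∧
    ∃ φ : (ℝ ⊗[ℤ] A) ≃ₗ[ℝ] H,
      IsHom (E.baseChange ℝ) D φ.toLinearMap ∧
      (∀ n, Submodule.map φ.toLinearMap ((𝒜 n).baseChange ℝ) = ℋ n) ∧
      (fun a : A => φ (1 ⊗ₜ[ℤ] a)) '' Ψ = Ω

/-- The canonical map `V ⊗_ℝ V → C ⊗_ℂ C` for a real subspace `V` of a complex space `C`. -/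
noncomputable def realTensorIncl {C : Type*} [AddCommGroup C] [Module ℂ C] [Module ℝ C]
    [IsScalarTower ℝ ℂ C] (V : Submodule ℝ C) : V ⊗[ℝ] V →ₗ[ℝ] C ⊗[ℂ] C :=
  TensorProduct.lift
    (LinearMap.mk₂ ℝ (fun x y : V => (x : C) ⊗ₜ[ℂ] (y : C))
      (fun _ _ _ => by simp [TensorProduct.add_tmul])
      (fun _ _ _ => by simp [TensorProduct.smul_tmul'])
      (fun _ _ _ => by simp [TensorProduct.tmul_add])
      (fun _ _ _ => by simp))

/-- The real structure maps `D₀` on the real subspace `V` are the restrictions of the complex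
structure maps `D` on `C`. -/
structure IsRestriction {C : Type*} [AddCommGroup C] [Module ℂ C] [Module ℝ C]
    [IsScalarTower ℝ ℂ C] (V : Submodule ℝ C) (D₀ : BialgData ℝ V) (D : BialgData ℂ C) :
    Prop where
  mul : ∀ x y : V, (D₀.mul (x ⊗ₜ[ℝ] y) : C) = D.mul ((x : C) ⊗ₜ[ℂ] (y : C))
  unit : ∀ r : ℝ, (D₀.unit r : C) = D.unit (r : ℂ)
  comul : ∀ x : V, realTensorIncl V (D₀.comul x) = D.comul (x : C)
  counit : ∀ x : V, ((D₀.counit x : ℝ) : ℂ) = D.counit (x : C)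

end BialgData

/-! ## Invariant functions on `𝔤𝔩ₙ(F)` for a finite field `F` -/

namespace GLInv

variable (F : Type*) [Field F] [Fintype F] [DecidableEq F]

/-- `𝔤𝔩ₙ(F)`. -/
abbrev Mat (n : ℕ) : Type _ := Matrix (Fin n) (Fin n) F

variable {F}

/-- The adjoint action of `GLₙ(F)` on `𝔤𝔩ₙ(F)`. -/
def Ad {n : ℕ} (g : GL (Fin n) F) (x : Mat F n) : Mat F n :=
  (g : Mat F n) * x * ((g⁻¹ : GL (Fin n) F) : Mat F n)

theorem Ad_mul {n : ℕ} (g h : GL (Fin n) F) (x : Mat F n) : Ad (g * h) x = Ad g (Ad h x) := by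
  simp [Ad, Matrix.mul_assoc]

theorem Ad_one {n : ℕ} (x : Mat F n) : Ad (1 : GL (Fin n) F) x = x := by
  simp [Ad]

theorem Ad_add {n : ℕ} (g : GL (Fin n) F) (x y : Mat F n) : Ad g (x + y) = Ad g x + Ad g y := by
  simp [Ad, Matrix.mul_add, Matrix.add_mul]

theorem Ad_inv_Ad {n : ℕ} (g : GL (Fin n) F) (x : Mat F n) : Ad g⁻¹ (Ad g x) = x := by
  rw [← Ad_mul, inv_mul_cancel, Ad_one]

theorem Ad_Ad_inv {n : ℕ} (g : GL (Fin n) F) (x : Mat F n) : Ad g (Ad g⁻¹ x) = x := by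
  rw [← Ad_mul, mul_inv_cancel, Ad_one]

variable (F)

/-- `Cₙ(q)`: complex functions on `𝔤𝔩ₙ(F)` invariant under the adjoint action. -/
def InvFun (n : ℕ) : Submodule ℂ (Mat F n → ℂ) where
  carrier := {f | ∀ (g : GL (Fin n) F) (x : Mat F n), f (Ad g x) = f x}
  add_mem' hf hf' g x := by simp [hf g x, hf' g x]
  zero_mem' _ _ := rfl
  smul_mem' c f hf g x := by simp [hf g x]

/-- Complex functions on `𝔤𝔩ₖ(F) × 𝔤𝔩ₗ(F)` invariant under `GLₖ(F) × GLₗ(F)`. -/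
def InvFun₂ (k l : ℕ) : Submodule ℂ (Mat F k × Mat F l → ℂ) where
  carrier := {f | ∀ (g : GL (Fin k) F) (h : GL (Fin l) F) (x : Mat F k) (y : Mat F l),
    f (Ad g x, Ad h y) = f (x, y)}
  add_mem' hf hf' g h x y := by simp [hf g h x y, hf' g h x y]
  zero_mem' _ _ _ _ := rfl
  smul_mem' c f hf g h x y := by simp [hf g h x y]

/-- `C(q) = ⨁ₙ Cₙ(q)`. -/
def C : Type _ := ⨁ n, InvFun F n

noncomputable instance : AddCommGroup (C F) :=
  inferInstanceAs (AddCommGroup (⨁ n, InvFun F n))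

noncomputable instance : Module ℂ (C F) :=
  inferInstanceAs (Module ℂ (⨁ n, InvFun F n))

/-- The inclusion `Cₙ(q) → C(q)`. -/
noncomputable def incl (n : ℕ) : InvFun F n →ₗ[ℂ] C F :=
  DirectSum.lof ℂ ℕ (fun n => InvFun F n) n

/-- The projection `C(q) → Cₙ(q)`. -/
noncomputable def comp (n : ℕ) : C F →ₗ[ℂ] InvFun F n :=
  DirectSum.component ℂ ℕ (fun n => InvFun F n) n

variable {F} in
/-- The linear map on `C(q)` with given restrictions to the `Cₙ(q)`. -/
noncomputable def liftC {M : Type*} [AddCommGroup M] [Module ℂ M]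
    (φ : ∀ n, InvFun F n →ₗ[ℂ] M) : C F →ₗ[ℂ] M :=
  DirectSum.toModule ℂ ℕ M φ

@[simp]
theorem liftC_incl {M : Type*} [AddCommGroup M] [Module ℂ M]
    (φ : ∀ n, InvFun F n →ₗ[ℂ] M) (n : ℕ) (f : InvFun F n) : liftC φ (incl F n f) = φ n f :=
  DirectSum.toModule_lof ℂ (φ := φ) n f

@[simp]
theorem comp_incl (n : ℕ) (f : InvFun F n) : comp F n (incl F n f) = f :=
  DirectSum.component.lof_self ℂ (M := fun n => InvFun F n) n f

/-! ### The identification `Cₖ(q) ⊗ Cₗ(q) ≅ C(𝔤𝔩ₖ × 𝔤𝔩ₗ)` -/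

variable {F}

/-- The external product `(f ⊠ g)(x, y) = f(x) g(y)`. -/
def boxFun {k l : ℕ} (f : InvFun F k) (g : InvFun F l) : InvFun₂ F k l :=
  ⟨fun p => f.1 p.1 * g.1 p.2, fun a b x y => by
    have h1 := f.2 a x
    have h2 := g.2 b y
    simp only [h1, h2]⟩

variable (F)

/-- The external product as a linear map on the tensor product. -/
noncomputable def boxLin (k l : ℕ) : InvFun F k ⊗[ℂ] InvFun F l →ₗ[ℂ] InvFun₂ F k l :=
  TensorProduct.lift (LinearMap.mk₂ ℂ boxFun
    (fun _ _ _ => by ext; simp [boxFun, add_mul])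
    (fun _ _ _ => by ext; simp [boxFun, mul_assoc])
    (fun _ _ _ => by ext; simp [boxFun, mul_add])
    (fun _ _ _ => by ext; simp [boxFun, mul_left_comm]))

variable {F}

open Classical in
/-- The indicator function of the adjoint orbit of `x`. -/
noncomputable def orbInd {n : ℕ} (x : Mat F n) : InvFun F n :=
  ⟨fun y => if ∃ g : GL (Fin n) F, y = Ad g x then 1 else 0, fun h y => by
    have : (∃ g : GL (Fin n) F, Ad h y = Ad g x) ↔ ∃ g : GL (Fin n) F, y = Ad g x := by
      constructor
      · rintro ⟨g, hg⟩
        exact ⟨h⁻¹ * g, by rw [Ad_mul, ← hg, Ad_inv_Ad]⟩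
      · rintro ⟨g, hg⟩
        exact ⟨h * g, by rw [Ad_mul, ← hg]⟩
    simp only [this]⟩

open Classical in
/-- The cardinality of the adjoint orbit of `x`. -/
noncomputable def orbCard {n : ℕ} (x : Mat F n) : ℕ :=
  (Finset.univ.filter fun y : Mat F n => ∃ g : GL (Fin n) F, y = Ad g x).card

theorem sum_orbInd {n : ℕ} (f : Mat F n → ℂ) (hf : ∀ (g : GL (Fin n) F) x, f (Ad g x) = f x)
    (y : Mat F n) : ∑ x, f x * (orbCard x : ℂ)⁻¹ * (orbInd x).1 y = f y := by
  classical
  have hsymm : ∀ x : Mat F n, (∃ g : GL (Fin n) F, y = Ad g x) ↔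
      ∃ g : GL (Fin n) F, x = Ad g y := by
    intro x
    constructor
    · rintro ⟨g, rfl⟩
      exact ⟨g⁻¹, by rw [Ad_inv_Ad]⟩
    · rintro ⟨g, rfl⟩
      exact ⟨g⁻¹, by rw [Ad_inv_Ad]⟩
  have hcard : ∀ g : GL (Fin n) F, orbCard (Ad g y) = orbCard y := by
    intro g
    unfold orbCard
    congr 1
    ext z
    simp only [Finset.mem_filter, Finset.mem_univ, true_and]
    constructor
    · rintro ⟨h, rfl⟩
      exact ⟨h * g, by rw [Ad_mul]⟩
    · rintro ⟨h, rfl⟩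
      exact ⟨h * g⁻¹, by rw [Ad_mul, Ad_inv_Ad]⟩
  have key : ∀ x : Mat F n, f x * (orbCard x : ℂ)⁻¹ * (orbInd x).1 y
      = if ∃ g : GL (Fin n) F, x = Ad g y then f y * (orbCard y : ℂ)⁻¹ else 0 := by
    intro x
    simp only [orbInd, hsymm x]
    split_ifs with h
    · obtain ⟨g, rfl⟩ := h
      rw [hf, hcard, mul_one]
    · simp
  have hne : (orbCard y : ℂ) ≠ 0 := by
    rw [Nat.cast_ne_zero]
    unfold orbCard
    exact Finset.card_ne_zero.2 ⟨y, by simpa using ⟨1, (Ad_one y).symm⟩⟩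
  rw [Finset.sum_congr rfl fun x _ => key x, ← Finset.sum_filter, Finset.sum_const, nsmul_eq_mul]
  change (orbCard y : ℂ) * _ = _
  field_simp

variable (F)

/-- The inverse of the external product, expanding a function in products of orbit indicators. -/
noncomputable def unboxLin (k l : ℕ) : InvFun₂ F k l →ₗ[ℂ] InvFun F k ⊗[ℂ] InvFun F l where
  toFun h := ∑ x, ∑ y, (h.1 (x, y) * (orbCard x : ℂ)⁻¹ * (orbCard y : ℂ)⁻¹) •
    (orbInd x ⊗ₜ[ℂ] orbInd y)
  map_add' h h' := by
    simp [add_mul, add_smul, Finset.sum_add_distrib]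
  map_smul' c h := by
    simp [Finset.smul_sum, smul_smul, mul_assoc]

/-- `Cₖ(q) ⊗ Cₗ(q) ≅ C(𝔤𝔩ₖ × 𝔤𝔩ₗ)`, `f ⊗ g ↦ f ⊠ g`. -/
noncomputable def boxEquiv (k l : ℕ) : InvFun F k ⊗[ℂ] InvFun F l ≃ₗ[ℂ] InvFun₂ F k l :=
  LinearEquiv.ofLinearMap (boxLin F k l) (unboxLin F k l)
    (by
      ext h p
      obtain ⟨a, b⟩ := p
      have h1 : ∀ x : Mat F k, ∑ y, h.1 (x, y) * (orbCard y : ℂ)⁻¹ * (orbInd y).1 b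
          = h.1 (x, b) := fun x =>
        sum_orbInd (fun y => h.1 (x, y)) (fun g y => by
          have := h.2 1 g x y
          rwa [Ad_one] at this) b
      have h2 : ∑ x, h.1 (x, b) * (orbCard x : ℂ)⁻¹ * (orbInd x).1 a = h.1 (a, b) :=
        sum_orbInd (fun x => h.1 (x, b)) (fun g x => by
          have := h.2 g 1 x b
          rwa [Ad_one] at this) a
      simp only [boxLin, unboxLin, LinearMap.coe_comp, Function.comp_apply, LinearMap.coe_mk,
        AddHom.coe_mk, map_sum, map_smul, TensorProduct.lift.tmul, LinearMap.mk₂_apply,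
        LinearMap.id_apply]
      simp only [Submodule.coe_sum, Submodule.coe_smul, Finset.sum_apply, Pi.smul_apply,
        smul_eq_mul, boxFun]
      rw [← h2]
      refine Finset.sum_congr rfl fun x _ => ?_
      rw [← h1 x, Finset.sum_mul, Finset.sum_mul]
      refine Finset.sum_congr rfl fun y _ => ?_
      ring)
    (by
      ext f g : 3
      have hf : ∀ {n : ℕ} (f : InvFun F n),
          ∑ x, (f.1 x * (orbCard x : ℂ)⁻¹) • orbInd x = f := by
        intro n f
        ext y
        simpa using sum_orbInd f.1 f.2 y
      simp only [boxLin, unboxLin, TensorProduct.AlgebraTensorModule.curry_apply,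
        LinearMap.restrictScalars_self, TensorProduct.curry_apply, LinearMap.coe_comp,
        Function.comp_apply, LinearMap.coe_mk, AddHom.coe_mk, TensorProduct.lift.tmul,
        LinearMap.mk₂_apply, LinearMap.id_apply, boxFun]
      conv_rhs => rw [← hf f, ← hf g]
      rw [TensorProduct.sum_tmul]
      refine Finset.sum_congr rfl fun x _ => ?_
      rw [TensorProduct.tmul_sum]
      refine Finset.sum_congr rfl fun y _ => ?_
      rw [TensorProduct.smul_tmul_smul]
      congr 1
      ring)

/-! ### Harish-Chandra induction and restriction

A function `b : Fin n → α` to a linear order determines a parabolic subgroup `P` of `GLₙ`: its Lie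
algebra `𝒫` consists of the matrices `x` with `x i j = 0` whenever `b j < b i`
(`Matrix.BlockTriangular x b`), its Levi subalgebra `ℒ` of those with `x i j = 0` whenever
`b i ≠ b j`, and its nilradical `𝒰` of those with `x i j = 0` whenever `b j ≤ b i`. -/

section HC

variable {F} {n : ℕ} {α : Type*} [LinearOrder α] (b : Fin n → α)

variable (F) in
/-- The Levi subalgebra `ℒ`. -/
abbrev Levi : Type _ := {x : Mat F n // ∀ i j, b i ≠ b j → x i j = 0}

/-- The projection `π_ℒ`, written as a map defined on all matrices. -/
def leviProj (x : Mat F n) : Levi F b :=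
  ⟨fun i j => if b i = b j then x i j else 0, fun _ _ h => if_neg h⟩

variable (F) in
/-- The nilradical `𝒰`. -/
abbrev NilRad : Type _ := {x : Mat F n // ∀ i j, b j ≤ b i → x i j = 0}

variable (F) in
/-- `|P|`, the number of invertible block triangular matrices. -/
noncomputable def parCard : ℕ :=
  Nat.card {g : GL (Fin n) F // (g : Mat F n).BlockTriangular b}

variable (F) in
/-- `|U_P|`, the number of invertible block unitriangular matrices. -/
noncomputable def uniCard : ℕ :=
  Nat.card {g : GL (Fin n) F // ∀ i j, b j ≤ b i → (g : Mat F n) i j = (1 : Mat F n) i j}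

open Classical in
/-- Harish-Chandra restriction to the Levi subalgebra. -/
noncomputable def hcRes (f : Mat F n → ℂ) (x : Levi F b) : ℂ :=
  (uniCard F b : ℂ)⁻¹ * ∑ u : NilRad F b, f (x.1 + u.1)

open Classical in
/-- Harish-Chandra induction from the Levi subalgebra. -/
noncomputable def hcInd (f : Levi F b → ℂ) (x : Mat F n) : ℂ :=
  (parCard F b : ℂ)⁻¹ *
    ∑ g : GL (Fin n) F, if (Ad g x).BlockTriangular b then f (leviProj b (Ad g x)) else 0

theorem hcInd_invariant (f : Levi F b → ℂ) (h : GL (Fin n) F) (x : Mat F n) :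
    hcInd b f (Ad h x) = hcInd b f x := by
  unfold hcInd
  congr 1
  refine Fintype.sum_equiv (Equiv.mulRight h) _ _ fun g => ?_
  simp only [Equiv.coe_mulRight, Ad_mul]

/-- Harish-Chandra restriction as a linear map. -/
noncomputable def hcResLin : (Mat F n → ℂ) →ₗ[ℂ] (Levi F b → ℂ) where
  toFun f := hcRes b f
  map_add' f f' := by
    ext x
    simp [hcRes, Finset.sum_add_distrib, mul_add]
  map_smul' c f := by
    ext x
    simp [hcRes, ← Finset.mul_sum, mul_left_comm]

/-- Harish-Chandra induction as a linear map; its values are invariant. -/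
noncomputable def hcIndLin : (Levi F b → ℂ) →ₗ[ℂ] InvFun F n where
  toFun f := ⟨hcInd b f, hcInd_invariant b f⟩
  map_add' f f' := by
    ext x
    simp only [hcInd, Submodule.coe_add, Pi.add_apply, ← mul_add, ← Finset.sum_add_distrib]
    congr 1
    refine Finset.sum_congr rfl fun g _ => ?_
    split_ifs <;> simp
  map_smul' c f := by
    ext x
    simp only [hcInd, Submodule.coe_smul, Pi.smul_apply, smul_eq_mul, RingHom.id_apply,
      mul_left_comm c, Finset.mul_sum (a := c)]
    congr 1
    refine Finset.sum_congr rfl fun g _ => ?_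
    split_ifs <;> simp

end HC

/-! ### The structure maps of `C(q)` -/

section TwoBlocks

variable {F} {k l n : ℕ} (h : k + l = n)

/-- The first `k` and the last `l` indices. -/
def blockIx : Fin k ⊕ Fin l ≃ Fin n := finSumFinEquiv.trans (finCongr h)

/-- The block function of the parabolic subgroup with diagonal blocks of sizes `k` and `l`. -/
def twoBlock (i : Fin n) : Bool := ((blockIx h).symm i).isRight

/-- The block diagonal matrix with blocks `x`, `y`. -/
def blockDiag (x : Mat F k) (y : Mat F l) : Levi F (twoBlock h) :=
  ⟨Matrix.reindex (blockIx h) (blockIx h) (Matrix.fromBlocks x 0 0 y), fun i j hij => by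
    obtain ⟨i, rfl⟩ := (blockIx h).surjective i
    obtain ⟨j, rfl⟩ := (blockIx h).surjective j
    rcases i with i | i <;> rcases j with j | j <;> simp_all [twoBlock]⟩

/-- The two diagonal blocks of a matrix. -/
def blocks (z : Mat F n) : Mat F k × Mat F l :=
  (z.submatrix (blockIx h ∘ Sum.inl) (blockIx h ∘ Sum.inl),
    z.submatrix (blockIx h ∘ Sum.inr) (blockIx h ∘ Sum.inr))

theorem blocks_blockDiag (x : Mat F k) (y : Mat F l) :
    blocks h (blockDiag h x y).1 = (x, y) := by
  ext i j <;> simp [blocks, blockDiag]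

/-- The block diagonal invertible matrix with blocks `g`, `g'`. -/
def blockDiagGL (g : GL (Fin k) F) (g' : GL (Fin l) F) : GL (Fin n) F where
  val := (blockDiag h (g : Mat F k) (g' : Mat F l)).1
  inv := (blockDiag h ((g⁻¹ : GL (Fin k) F) : Mat F k) ((g'⁻¹ : GL (Fin l) F) : Mat F l)).1
  val_inv := by
    simp [blockDiag, Matrix.submatrix_mul_equiv, Matrix.fromBlocks_multiply]
  inv_val := by
    simp [blockDiag, Matrix.submatrix_mul_equiv, Matrix.fromBlocks_multiply]

theorem Ad_blockDiagGL (g : GL (Fin k) F) (g' : GL (Fin l) F) (x : Mat F k) (y : Mat F l) :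
    (blockDiag h (Ad g x) (Ad g' y)).1 = Ad (blockDiagGL h g g') (blockDiag h x y).1 := by
  have : ((blockDiagGL h g g')⁻¹ : GL (Fin n) F).1 =
    (blockDiag h ((g⁻¹ : GL (Fin k) F) : Mat F k) ((g'⁻¹ : GL (Fin l) F) : Mat F l)).1 := rfl
  unfold Ad
  rw [this]
  simp [blockDiagGL, blockDiag, Matrix.submatrix_mul_equiv, Matrix.fromBlocks_multiply]

theorem Ad_mem_nilRad (g : GL (Fin k) F) (g' : GL (Fin l) F) (u : Mat F n)
    (hu : ∀ i j, twoBlock h j ≤ twoBlock h i → u i j = 0) (i j : Fin n)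
    (hij : twoBlock h j ≤ twoBlock h i) : Ad (blockDiagGL h g g') u i j = 0 := by
  have e1 := (blockDiag h (g : Mat F k) (g' : Mat F l)).2
  have e2 := (blockDiag h ((g⁻¹ : GL (Fin k) F) : Mat F k) ((g'⁻¹ : GL (Fin l) F) : Mat F l)).2
  change ((blockDiag h (g : Mat F k) (g' : Mat F l)).1 * u *
    (blockDiag h ((g⁻¹ : GL (Fin k) F) : Mat F k) ((g'⁻¹ : GL (Fin l) F) : Mat F l)).1) i j = 0
  rw [Matrix.mul_apply]
  refine Finset.sum_eq_zero fun c _ => ?_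
  by_cases hc : twoBlock h c = twoBlock h j
  · rw [Matrix.mul_apply, Finset.sum_eq_zero, zero_mul]
    intro a _
    by_cases ha : twoBlock h i = twoBlock h a
    · rw [hu a c (by rw [hc, ← ha]; exact hij), mul_zero]
    · rw [e1 i a ha, zero_mul]
  · rw [e2 c j hc, mul_zero]

/-- The map `Cₖ(q) ⊗ Cₗ(q) → Cₖ₊ₗ(q)` given by Harish-Chandra induction, with
`𝔤𝔩ₖ × 𝔤𝔩ₗ` identified with the block diagonal matrices. -/
noncomputable def mulComp : InvFun F k ⊗[ℂ] InvFun F l →ₗ[ℂ] InvFun F n :=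
  hcIndLin (twoBlock h) ∘ₗ
    (LinearMap.funLeft ℂ ℂ fun z : Levi F (twoBlock h) => (blocks h z.1 : Mat F k × Mat F l)) ∘ₗ
    (InvFun₂ F k l).subtype ∘ₗ (boxEquiv F k l).toLinearMap

/-- Harish-Chandra restriction `Cₖ₊ₗ(q) → C(𝔤𝔩ₖ × 𝔤𝔩ₗ)`. -/
noncomputable def resTwo : InvFun F n →ₗ[ℂ] InvFun₂ F k l :=
  LinearMap.codRestrict (InvFun₂ F k l)
    ((LinearMap.funLeft ℂ ℂ fun p : Mat F k × Mat F l => blockDiag h p.1 p.2) ∘ₗ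
      hcResLin (twoBlock h) ∘ₗ (InvFun F n).subtype)
    (fun f g g' x y => by
      simp only [LinearMap.coe_comp, Function.comp_apply, LinearMap.funLeft_apply, hcResLin,
        LinearMap.coe_mk, AddHom.coe_mk, hcRes, Submodule.coe_subtype]
      congr 1
      symm
      classical
      refine Fintype.sum_equiv
        { toFun := fun u : NilRad F (twoBlock h) =>
            (⟨Ad (blockDiagGL h g g') u.1, Ad_mem_nilRad h g g' u.1 u.2⟩ : NilRad F (twoBlock h))
          invFun := fun u => ⟨Ad (blockDiagGL h g⁻¹ g'⁻¹) u.1, Ad_mem_nilRad h g⁻¹ g'⁻¹ u.1 u.2⟩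
          left_inv := fun u => Subtype.ext (Ad_inv_Ad (blockDiagGL h g g') u.1)
          right_inv := fun u => Subtype.ext (Ad_Ad_inv (blockDiagGL h g g') u.1) } _ _ fun u => ?_
      rw [Ad_blockDiagGL]
      simp only [Equiv.coe_fn_mk]
      rw [← Ad_add]
      exact (f.2 _ _).symm)

/-- The component `Cₖ₊ₗ(q) → Cₖ(q) ⊗ Cₗ(q)` of the comultiplication. -/
noncomputable def comulComp : InvFun F n →ₗ[ℂ] InvFun F k ⊗[ℂ] InvFun F l :=
  (boxEquiv F k l).symm.toLinearMap ∘ₗ resTwo h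

end TwoBlocks

/-- The constant function `1` on `𝔤𝔩ₙ(F)`. -/
def oneFun (n : ℕ) : InvFun F n := ⟨fun _ => 1, fun _ _ => rfl⟩

/-- The structure maps of `C(q)`. The degree zero part is identified with `ℂ` by evaluation at the
unique element of `𝔤𝔩₀(F)`. -/
noncomputable def bialgC : BialgData ℂ (C F) where
  mul := TensorProduct.lift <|
    liftC fun k => LinearMap.flip <| liftC fun l => LinearMap.flip <|
      TensorProduct.curry (incl F (k + l) ∘ₗ mulComp (rfl : k + l = k + l))
  unit := LinearMap.toSpanSingleton ℂ (C F) (incl F 0 (oneFun F 0))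
  comul := liftC fun n =>
    ∑ p ∈ (Finset.HasAntidiagonal.antidiagonal n).attach,
      TensorProduct.map (incl F p.1.1) (incl F p.1.2) ∘ₗ
        comulComp (Finset.HasAntidiagonal.mem_antidiagonal.1 p.2)
  counit := LinearMap.proj (0 : Mat F 0) ∘ₗ (InvFun F 0).subtype ∘ₗ comp F 0

/-- The grading of `C(q)`. -/
noncomputable def gradC (n : ℕ) : Submodule ℂ (C F) :=
  LinearMap.range (incl F n)

/-! ### Duality, the antipode and the Steinberg function -/

/-- The duality operation `𝒟ₙ = ∑_P (-1)^{r(P)} R_{ℒ_P} ∘ *R_{ℒ_P}`. The parabolic subgroups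
containing the upper triangular Borel subgroup are indexed by the compositions `c` of `n` (the
sizes of the diagonal blocks); the semisimple rank of the one for `c` is `n - c.length`. -/
noncomputable def dual (n : ℕ) : InvFun F n →ₗ[ℂ] InvFun F n :=
  ∑ c : Composition n, (-1 : ℂ) ^ (n - c.length) •
    (hcIndLin c.index ∘ₗ hcResLin c.index ∘ₗ (InvFun F n).subtype)

/-- `S = ⨁ₙ (-1)ⁿ 𝒟ₙ`. -/
noncomputable def antipodeC : C F →ₗ[ℂ] C F :=
  liftC fun n => (-1 : ℂ) ^ n • (incl F n ∘ₗ dual F n)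

/-- The Steinberg function `Stₙ = 𝒟ₙ(1)`. -/
noncomputable def steinberg (n : ℕ) : InvFun F n := dual F n (oneFun F n)

/-! ### Irreducible invariant characters and the real form `𝔠(q)` -/

variable {F}

/-- An invariant character: an invariant function which is the character of a finite-dimensional
complex representation of the additive group of `𝔤𝔩ₙ(F)`. -/
def IsInvChar {n : ℕ} (χ : InvFun F n) : Prop :=
  ∃ (d : ℕ) (ρ : Representation ℂ (Multiplicative (Mat F n)) (Fin d → ℂ)),
    ∀ x : Mat F n, χ.1 x = LinearMap.trace ℂ (Fin d → ℂ) (ρ (Multiplicative.ofAdd x))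

/-- A (nonzero) invariant character is irreducible if it is not a sum of two nonzero invariant
characters. -/
def IsIrrInvChar {n : ℕ} (χ : InvFun F n) : Prop :=
  IsInvChar χ ∧ χ ≠ 0 ∧
    ¬ ∃ χ₁ χ₂ : InvFun F n, IsInvChar χ₁ ∧ IsInvChar χ₂ ∧ χ₁ ≠ 0 ∧ χ₂ ≠ 0 ∧ χ = χ₁ + χ₂

/-- The hermitian form on `Cₙ(q)`. -/
noncomputable def herm {n : ℕ} (f g : InvFun F n) : ℂ :=
  (Fintype.card (GL (Fin n) F) : ℂ)⁻¹ * ∑ x, f.1 x * (starRingEnd ℂ) (g.1 x)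

variable (F)

/-- The degree `n` part of `Ω(q)`: the normalised irreducible invariant characters
`χ / √(χ, χ)`. -/
def omegaDeg (n : ℕ) : Set (InvFun F n) :=
  {φ | ∃ χ : InvFun F n, IsIrrInvChar χ ∧ φ = ((Real.sqrt (herm χ χ).re : ℝ) : ℂ)⁻¹ • χ}

/-- `Ω(q)`. -/
def omega : Set (C F) :=
  {x | ∃ n, ∃ φ ∈ omegaDeg F n, x = incl F n φ}

/-- `𝔠(q) = ℝ[Ω(q)]`. -/
noncomputable def realC : Submodule ℝ (C F) := Submodule.span ℝ (omega F)

/-- The grading of `𝔠(q)`: the degree `n` part is spanned by the degree `n` elements of `Ω(q)`. -/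
noncomputable def gradReal (n : ℕ) : Submodule ℝ (realC F) :=
  (Submodule.span ℝ (incl F n '' omegaDeg F n)).comap
    (realC F).subtype

end GLInv

/-! View an element of `C F` as a function on isomorphism classes of pairs (V, x), where V is a
finite-dimensional F-space and x an endomorphism of V. Then the product is a Hall product, the sum
of a(N) b(V/N) over the x-stable subspaces N of V (`ev_mul`). The comultiplication at (x, y) is the
average over all endomorphisms of V × W with diagonal parts x, y and arbitrary upper right corner
(`ev₂_comul`). The bialgebra laws become statements about flags and block triangular matrices.
Multiplicativity of the comultiplication is a form of Green's formula: every subspace of V × W is a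
shear of a product A × B, and conjugation by a shear only translates the corner (`ev₂_comul_mul`).

The normalised orbit indicators `orbBasis` are orthonormal for a bilinear form under which product
and coproduct are adjoint (`form_mul`), and their structure constants are nonnegative. Such a
self-dual connected bialgebra is commutative: by induction on the degree, the commutator of two
basis elements is a real vector orthogonal to itself (`orbBasis_mul_comm`). Induction in stages
turns the alternating sum over compositions into the recursion for the antipode
(`mul_lTensor_antipodeC`). Commutativity makes S multiplicative and involutive, and its
self-adjointness makes it comultiplicative.

The normalised Fourier transform for the trace form is self-adjoint and commutes with restriction,
hence is a bialgebra automorphism and commutes with S. An invariant character is the Fourier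
transform of its multiplicity function, so Ω(q) is the Fourier image of `orbBasis`
(`omega_eq_range`). Thus S ∘ Fourier carries the orbit basis onto S(Ω(q)), which inherits its
structure constants. Since S has a real matrix in the orbit basis, S(Ω(q)) and Ω(q) have the same
real span, and this span is a real PSH algebra with basis S(Ω(q)) (`isPSH_realData`). It does not
descend, because descent forces integral structure constants while one of them satisfies c² q = q +
1 (`structure_constant_sq`).

The Steinberg function is, up to a nonzero scalar, the Fourier transform of S applied to the
indicator of 0. If it were proportional to an irreducible character, S of that indicator would be
proportional to an orbit indicator. Gluing a line, with zero endomorphism, to a suitable y refutes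
this for n ≥ 2: the value at a corner injective on ker y equals the average over all corners, so all
corners would give the same orbit, although the ranks differ (`smul_antipodeC_zeroInd_ne`). The same
fact in degree 2 separates S(Ω(q)) from Ω(q). -/

namespace GLInv

open Module

variable {F : Type*} [Field F] [Fintype F] [DecidableEq F]

/-! ### Evaluation at a vector space with an endomorphism -/

section Ev

variable {V W : Type*} [AddCommGroup V] [Module F V] [Module.Finite F V]
  [AddCommGroup W] [Module F W] [Module.Finite F W]

/-- The value of an element of `C(q)` at a finite dimensional space with an endomorphism. -/
noncomputable def ev (x : End F V) : C F →ₗ[ℂ] ℂ :=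
  LinearMap.proj (LinearMap.toMatrix (finBasis F V) (finBasis F V) x) ∘ₗ
    (InvFun F (finrank F V)).subtype ∘ₗ comp F (finrank F V)

theorem comp_incl_of_ne {m n : ℕ} (h : m ≠ n) (f : InvFun F m) : comp F n (incl F m f) = 0 :=
  (DirectSum.component.of (R := ℂ) (M := fun n => InvFun F n) n m f).trans (dif_neg h)

theorem ev_incl_of_ne (x : End F V) {n : ℕ} (h : finrank F V ≠ n) (f : InvFun F n) :
    ev x (incl F n f) = 0 := by
  simp [ev, comp_incl_of_ne h.symm]

/-- A change of basis conjugates the matrix, which an invariant function does not see; hence the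
choice of basis in `ev` is immaterial. -/
theorem InvFun.apply_toMatrix_eq {n : ℕ} (f : InvFun F n) (b c : Basis (Fin n) F V)
    (x : End F V) : f.1 (LinearMap.toMatrix b b x) = f.1 (LinearMap.toMatrix c c x) := by
  let g : GL (Fin n) F := ⟨c.toMatrix b, b.toMatrix c, Basis.toMatrix_mul_toMatrix_flip _ _,
    Basis.toMatrix_mul_toMatrix_flip _ _⟩
  have hg : Ad g (LinearMap.toMatrix b b x) = LinearMap.toMatrix c c x :=
    basis_toMatrix_mul_linearMap_toMatrix_mul_basis_toMatrix c b c b x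
  rw [← hg, f.2]

theorem ev_incl {n : ℕ} (b : Basis (Fin n) F V) (x : End F V) (f : InvFun F n) :
    ev x (incl F n f) = f.1 (LinearMap.toMatrix b b x) := by
  have hn : finrank F V = n := by simpa using finrank_eq_card_basis b
  subst hn
  simp only [ev, LinearMap.coe_comp, Function.comp_apply, comp_incl, Submodule.coe_subtype,
    LinearMap.coe_proj, Function.eval]
  exact InvFun.apply_toMatrix_eq f _ _ x

theorem C.induction {p : C F → Prop} (a : C F) (zero : p 0)
    (incl : ∀ n f, p (incl F n f)) (add : ∀ a b, p a → p b → p (a + b)) : p a :=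
  DirectSum.induction_on a zero incl add

theorem C.hom_ext {M : Type*} [AddCommGroup M] [Module ℂ M] {φ ψ : C F →ₗ[ℂ] M}
    (h : ∀ n f, φ (incl F n f) = ψ (incl F n f)) : φ = ψ :=
  DirectSum.linearMap_ext ℂ fun n => LinearMap.ext fun f => h n f

/-- A basis transported along e gives the same matrix. All later identifications of subspaces,
quotients and products of pairs (V, x) pass through this. -/
theorem ev_congr (e : V ≃ₗ[F] W) {x : End F V} {y : End F W}
    (h : ∀ v, e (x v) = y (e v)) : ev x = ev y := by
  refine C.hom_ext fun n f => ?_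
  by_cases hn : finrank F V = n
  · subst hn
    rw [ev_incl (finBasis F V), ev_incl ((finBasis F V).map e)]
    refine congrArg f.1 (Matrix.ext fun i j => ?_)
    simp [LinearMap.toMatrix_apply, ← h]
  · rw [ev_incl_of_ne x hn, ev_incl_of_ne y (by rwa [← e.finrank_eq])]

theorem ev_toLin' {n : ℕ} (A : Mat F n) (a : C F) : ev (Matrix.toLin' A) a = (comp F n a).1 A := by
  induction a using C.induction with
  | zero => simp
  | add a b ha hb => simp [ha, hb]
  | incl m f =>
    by_cases h : n = m
    · subst h
      rw [ev_incl (Pi.basisFun F _), comp_incl]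
      refine congrArg f.1 ?_
      simp [LinearMap.toMatrix_eq_toMatrix']
    · rw [ev_incl_of_ne _ (by simpa using h), comp_incl_of_ne (Ne.symm h)]
      rfl

/-- Evaluations separate points, so identities in `C F` may be checked at each pair (V, x). -/
theorem C.ext_ev {a b : C F}
    (h : ∀ n (A : Mat F n), ev (Matrix.toLin' A) a = ev (Matrix.toLin' A) b) : a = b := by
  refine DFinsupp.ext fun n => Subtype.ext (funext fun A => ?_)
  have := h n A
  rwa [ev_toLin', ev_toLin'] at this

end Ev

/-! ### The orthonormal basis of normalised orbit indicators -/

section OrbitBasis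

variable (F) in
/-- The relation of being in the same adjoint orbit. -/
def orbSetoid (n : ℕ) : Setoid (Mat F n) where
  r x y := ∃ g : GL (Fin n) F, y = Ad g x
  iseqv :=
    { refl := fun x => ⟨1, (Ad_one x).symm⟩
      symm := by
        rintro x _ ⟨g, rfl⟩
        exact ⟨g⁻¹, (Ad_inv_Ad g x).symm⟩
      trans := by
        rintro x _ _ ⟨g, rfl⟩ ⟨h, rfl⟩
        exact ⟨h * g, (Ad_mul h g x).symm⟩ }

variable (F) in
/-- The adjoint orbits on `𝔤𝔩ₙ(F)`. -/
abbrev Orb (n : ℕ) : Type _ := Quotient (orbSetoid F n)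

theorem mk_Ad {n : ℕ} (g : GL (Fin n) F) (x : Mat F n) :
    (Quotient.mk (orbSetoid F n) (Ad g x)) = Quotient.mk (orbSetoid F n) x :=
  Quotient.sound' ((orbSetoid F n).symm ⟨g, rfl⟩)

theorem InvFun.apply_out {n : ℕ} (f : InvFun F n) (x : Mat F n) :
    f.1 (Quotient.mk (orbSetoid F n) x).out = f.1 x := by
  obtain ⟨g, hg⟩ : ∃ g : GL (Fin n) F, x = Ad g (Quotient.mk (orbSetoid F n) x).out :=
    Quotient.exact (Quotient.out_eq (Quotient.mk (orbSetoid F n) x))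
  conv_rhs => rw [hg, f.2]

open Classical in
theorem orbInd_out {n : ℕ} (o : Orb F n) (x : Mat F n) :
    (orbInd o.out).1 x = if Quotient.mk (orbSetoid F n) x = o then 1 else 0 := by
  change (if _ then (1 : ℂ) else 0) = _
  congr 1
  apply propext
  constructor
  · rintro ⟨g, rfl⟩
    rw [mk_Ad, Quotient.out_eq]
  · rintro rfl
    exact Quotient.exact (Quotient.out_eq (Quotient.mk (orbSetoid F n) x))

theorem orbCard_pos {n : ℕ} (x : Mat F n) : 0 < orbCard x := by
  classical
  exact Finset.card_pos.2 ⟨x, by simpa using ⟨1, (Ad_one x).symm⟩⟩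

/-- The inverse of the norm of the indicator function of an orbit. -/
noncomputable def orbScale {n : ℕ} (o : Orb F n) : ℝ :=
  Real.sqrt (Fintype.card (GL (Fin n) F) / orbCard o.out)

theorem orbScale_pos {n : ℕ} (o : Orb F n) : 0 < orbScale o := by
  have := orbCard_pos o.out
  have h2 : 0 < Fintype.card (GL (Fin n) F) := Fintype.card_pos
  unfold orbScale
  positivity

theorem orbScale_sq {n : ℕ} (o : Orb F n) :
    orbScale o * orbScale o = Fintype.card (GL (Fin n) F) / orbCard o.out :=
  Real.mul_self_sqrt (by positivity)

theorem orbScale_ne {n : ℕ} (o : Orb F n) : (orbScale o : ℂ) ≠ 0 :=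
  Complex.ofReal_ne_zero.2 (orbScale_pos o).ne'

/-- The coordinates of an invariant function in the basis of normalised orbit indicators. -/
noncomputable def orbEquiv (n : ℕ) : InvFun F n ≃ₗ[ℂ] (Orb F n → ℂ) where
  toFun f o := (orbScale o : ℂ)⁻¹ * f.1 o.out
  map_add' f g := by ext o; simp [mul_add]
  map_smul' c f := by ext o; simp [mul_left_comm]
  invFun c := ⟨fun x => orbScale (Quotient.mk (orbSetoid F n) x) *
    c (Quotient.mk (orbSetoid F n) x), fun g x => by simp only [mk_Ad]⟩
  left_inv f := by
    ext x
    simp [InvFun.apply_out, mul_inv_cancel_left₀ (orbScale_ne _)]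
  right_inv c := by
    ext o
    simp [inv_mul_cancel_left₀ (orbScale_ne _)]

variable (F) in
/-- The set of all adjoint orbits, for all `n`. -/
abbrev OrbIx : Type _ := Σ n, Orb F n

variable (F) in
/-- The normalised orbit indicators form a basis of `C(q)`. -/
noncomputable def orbBasis : Basis (OrbIx F) ℂ (C F) :=
  DFinsupp.basis fun n => Basis.ofEquivFun (orbEquiv (F := F) n)

/-- Coordinates are values at orbit representatives up to a positive factor, so positivity and
reality of coordinates can be read off values. -/
theorem orbBasis_repr (a : C F) (i : OrbIx F) :
    (orbBasis F).repr a i = (orbScale i.2 : ℂ)⁻¹ * ev (Matrix.toLin' i.2.out) a := by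
  rw [ev_toLin']
  rfl

open Classical in
theorem orbBasis_apply (i : OrbIx F) :
    orbBasis F i = incl F i.1 ((orbScale i.2 : ℂ) • orbInd i.2.out) := by
  refine (orbBasis F).repr.injective (Finsupp.ext fun j => ?_)
  rw [Basis.repr_self, orbBasis_repr, ev_toLin']
  obtain ⟨n, o⟩ := i
  obtain ⟨m, p⟩ := j
  by_cases h : n = m
  · subst h
    rw [comp_incl, Submodule.coe_smul, Pi.smul_apply, orbInd_out, Quotient.out_eq]
    by_cases hp : p = o
    · subst hp
      simp [inv_mul_cancel₀ (orbScale_ne p)]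
    · have : (⟨n, o⟩ : OrbIx F) ≠ ⟨n, p⟩ := fun e => hp (by simpa using e.symm)
      rw [Finsupp.single_apply, if_neg this, if_neg hp]
      simp
  · have : (⟨n, o⟩ : OrbIx F) ≠ ⟨m, p⟩ := fun e => h (congrArg Sigma.fst e)
    rw [comp_incl_of_ne h, Finsupp.single_apply, if_neg this]
    simp

/-- Evaluation of a tensor at two endomorphisms. -/
noncomputable def ev₂ {V W : Type*} [AddCommGroup V] [Module F V] [Module.Finite F V]
    [AddCommGroup W] [Module F W] [Module.Finite F W] (x : End F V) (y : End F W) :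
    C F ⊗[ℂ] C F →ₗ[ℂ] ℂ :=
  LinearMap.mul' ℂ ℂ ∘ₗ TensorProduct.map (ev x) (ev y)

@[simp]
theorem ev₂_tmul {V W : Type*} [AddCommGroup V] [Module F V] [Module.Finite F V]
    [AddCommGroup W] [Module F W] [Module.Finite F W] (x : End F V) (y : End F W) (a b : C F) :
    ev₂ x y (a ⊗ₜ[ℂ] b) = ev x a * ev y b := by
  simp [ev₂]

theorem orbBasis_tensor_repr (t : C F ⊗[ℂ] C F) (i j : OrbIx F) :
    ((orbBasis F).tensorProduct (orbBasis F)).repr t (i, j) =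
      ((orbScale i.2 : ℂ)⁻¹ * (orbScale j.2 : ℂ)⁻¹) *
        ev₂ (Matrix.toLin' i.2.out) (Matrix.toLin' j.2.out) t := by
  induction t using TensorProduct.induction_on with
  | zero => simp
  | add s t hs ht => simp [hs, ht, mul_add]
  | tmul a b => simp [orbBasis_repr]; ring

theorem C.ext_ev₂ {s t : C F ⊗[ℂ] C F}
    (h : ∀ m (A : Mat F m) n (B : Mat F n), ev₂ (Matrix.toLin' A) (Matrix.toLin' B) s =
      ev₂ (Matrix.toLin' A) (Matrix.toLin' B) t) : s = t :=
  ((orbBasis F).tensorProduct (orbBasis F)).ext_elem fun ⟨i, j⟩ => by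
    rw [orbBasis_tensor_repr, orbBasis_tensor_repr, h]

/-- Evaluation of a triple tensor. -/
noncomputable def ev₃ {U V W : Type*} [AddCommGroup U] [Module F U] [Module.Finite F U]
    [AddCommGroup V] [Module F V] [Module.Finite F V]
    [AddCommGroup W] [Module F W] [Module.Finite F W] (x : End F U) (y : End F V) (z : End F W) :
    C F ⊗[ℂ] (C F ⊗[ℂ] C F) →ₗ[ℂ] ℂ :=
  LinearMap.mul' ℂ ℂ ∘ₗ TensorProduct.map (ev x) (ev₂ y z)

theorem C.ext_ev₃ {s t : C F ⊗[ℂ] (C F ⊗[ℂ] C F)}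
    (h : ∀ m (A : Mat F m) n (B : Mat F n) p (D : Mat F p),
      ev₃ (Matrix.toLin' A) (Matrix.toLin' B) (Matrix.toLin' D) s =
        ev₃ (Matrix.toLin' A) (Matrix.toLin' B) (Matrix.toLin' D) t) : s = t := by
  have key : ∀ (t : C F ⊗[ℂ] (C F ⊗[ℂ] C F)) (i j k : OrbIx F),
      ((orbBasis F).tensorProduct ((orbBasis F).tensorProduct (orbBasis F))).repr t (i, (j, k)) =
        ((orbScale i.2 : ℂ)⁻¹ * ((orbScale j.2 : ℂ)⁻¹ * (orbScale k.2 : ℂ)⁻¹)) *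
          ev₃ (Matrix.toLin' i.2.out) (Matrix.toLin' j.2.out) (Matrix.toLin' k.2.out) t := by
    intro t i j k
    induction t using TensorProduct.induction_on with
    | zero => simp
    | add s t hs ht => simp only [map_add, Finsupp.add_apply, hs, ht, mul_add]
    | tmul a t =>
      rw [Basis.tensorProduct_repr_tmul_apply, orbBasis_repr, orbBasis_tensor_repr]
      simp only [ev₃, LinearMap.coe_comp, Function.comp_apply, TensorProduct.map_tmul,
        LinearMap.mul'_apply, smul_eq_mul]
      ring
  exact ((orbBasis F).tensorProduct ((orbBasis F).tensorProduct (orbBasis F))).ext_elem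
    fun ⟨i, j, k⟩ => by rw [key, key, h]

end OrbitBasis

end GLInv

namespace GLInv

open Module
open scoped BigOperators

variable {F : Type*} [Field F] [Fintype F] [DecidableEq F]

/-! ### The structure maps in terms of spaces with endomorphisms -/

section Structure

variable {V W : Type*} [AddCommGroup V] [Module F V] [Finite V]
  [AddCommGroup W] [Module F W] [Finite W]

noncomputable instance : Fintype (V →ₗ[F] W) :=
  @Fintype.ofFinite _ (DFunLike.finite _)

noncomputable instance : Fintype (Submodule F V) := Fintype.ofFinite _

instance (N : Submodule F V) : Finite (V ⧸ N) := Finite.of_surjective _ N.mkQ_surjective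

/-- The endomorphism of `V × W` with diagonal parts `x`, `y` and upper right part `u`. -/
def glue (x : End F V) (y : End F W) (u : W →ₗ[F] V) : End F (V × W) :=
  x.prodMap y + LinearMap.inl F V W ∘ₗ u ∘ₗ LinearMap.snd F V W

@[simp]
theorem glue_apply (x : End F V) (y : End F W) (u : W →ₗ[F] V) (p : V × W) :
    glue x y u p = (x p.1 + u p.2, y p.2) := by
  simp [glue]

/-! ### Restriction as an average over the nilradical -/

section Uni

variable {n : ℕ} {α : Type*} [LinearOrder α] (b : Fin n → α)

/-- The matrix is block triangular with identity diagonal blocks, so its determinant is 1. -/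
theorem isUnit_one_add_nilRad (u : NilRad F b) : IsUnit (1 + u.1) := by
  classical
  rw [Matrix.isUnit_iff_isUnit_det]
  have hu : (1 + u.1).BlockTriangular b := fun i j hij => by
    have hne : i ≠ j := fun e => by simp [e] at hij
    rw [Matrix.add_apply, u.2 i j hij.le, Matrix.one_apply_ne hne, add_zero]
  rw [hu.det, Finset.prod_eq_one]
  · exact isUnit_one
  · intro k _
    have h1 : (1 + u.1).toSquareBlock b k = 1 := by
      ext i j
      rw [Matrix.toSquareBlock_def, Matrix.of_apply, Matrix.add_apply,
        u.2 _ _ (by rw [i.2, j.2]), add_zero, Matrix.one_apply, Matrix.one_apply]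
      simp [Subtype.ext_iff]
    rw [h1, Matrix.det_one]

/-- U_P = 1 + 𝒰, so the normalising factor of Harish-Chandra restriction is the number of terms of
its sum. -/
theorem uniCard_eq : uniCard F b = Nat.card (NilRad F b) := by
  refine Nat.card_congr
    { toFun := fun g => ⟨g.1.1 - 1, fun i j hij => by
        rw [Matrix.sub_apply, g.2 i j hij, sub_self]⟩
      invFun := fun u => ⟨(isUnit_one_add_nilRad b u).unit, fun i j hij => by
        rw [IsUnit.unit_spec, Matrix.add_apply, u.2 i j hij, add_zero]⟩
      left_inv := fun g => Subtype.ext (Units.ext (by simp))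
      right_inv := fun u => Subtype.ext (by simp) }

open Classical in
theorem hcRes_eq_expect (f : Mat F n → ℂ) (x : Levi F b) :
    hcRes b f x = 𝔼 u : NilRad F b, f (x.1 + u.1) := by
  rw [Fintype.expect_eq_sum_div_card, hcRes, uniCard_eq, Nat.card_eq_fintype_card, div_eq_inv_mul]

end Uni

/-! ### The comultiplication as an average over gluings -/

section TwoBlocks

variable {k l n : ℕ} (h : k + l = n)

/-- The upper right block of the elements of the nilradical of a maximal parabolic. -/
def nilRadEquiv : NilRad F (twoBlock h) ≃ Matrix (Fin k) (Fin l) F where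
  toFun u := u.1.submatrix (blockIx h ∘ Sum.inl) (blockIx h ∘ Sum.inr)
  invFun m := ⟨Matrix.reindex (blockIx h) (blockIx h) (Matrix.fromBlocks 0 m 0 0), fun i j hij => by
    obtain ⟨i, rfl⟩ := (blockIx h).surjective i
    obtain ⟨j, rfl⟩ := (blockIx h).surjective j
    rcases i with i | i <;> rcases j with j | j
    · simp
    · exact absurd hij (by simp [twoBlock])
    · simp
    · simp⟩
  left_inv u := by
    ext i j
    have hu := u.2 i j
    obtain ⟨i, rfl⟩ := (blockIx h).surjective i
    obtain ⟨j, rfl⟩ := (blockIx h).surjective j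
    rcases i with i | i <;> rcases j with j | j <;> simp_all [twoBlock]
  right_inv m := by
    ext i j
    simp

theorem ev₂_map_incl (bV : Basis (Fin k) F V) (bW : Basis (Fin l) F W) (x : End F V)
    (y : End F W) (t : InvFun F k ⊗[ℂ] InvFun F l) :
    ev₂ x y (TensorProduct.map (incl F k) (incl F l) t) =
      (boxEquiv F k l t).1 (LinearMap.toMatrix bV bV x, LinearMap.toMatrix bW bW y) := by
  have h : ev₂ x y ∘ₗ TensorProduct.map (incl F k) (incl F l) =
      LinearMap.proj (LinearMap.toMatrix bV bV x, LinearMap.toMatrix bW bW y) ∘ₗ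
        (InvFun₂ F k l).subtype ∘ₗ (boxEquiv F k l).toLinearMap := by
    refine TensorProduct.ext' fun f g => ?_
    rw [LinearMap.comp_apply, TensorProduct.map_tmul, ev₂_tmul, ev_incl bV, ev_incl bW]
    rfl
  exact LinearMap.congr_fun h t

theorem ev₂_map_incl_of_ne (x : End F V) (y : End F W) (hkl : finrank F V ≠ k ∨ finrank F W ≠ l)
    (t : InvFun F k ⊗[ℂ] InvFun F l) :
    ev₂ x y (TensorProduct.map (incl F k) (incl F l) t) = 0 := by
  induction t using TensorProduct.induction_on with
  | zero => simp
  | add s t hs ht => simp [hs, ht]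
  | tmul f g =>
    rw [TensorProduct.map_tmul, ev₂_tmul]
    rcases hkl with hk | hl
    · rw [ev_incl_of_ne x hk, zero_mul]
    · rw [ev_incl_of_ne y hl, mul_zero]

/-- The basis of `V × W` obtained from bases of `V` and `W`. -/
noncomputable def prodBasis (bV : Basis (Fin k) F V) (bW : Basis (Fin l) F W) :
    Basis (Fin n) F (V × W) :=
  (bV.prod bW).reindex (blockIx h)

/-- The corner u is precisely the nilradical part of the matrix, which identifies 𝒰 with Hom(W, V).
-/
theorem toMatrix_glue (bV : Basis (Fin k) F V) (bW : Basis (Fin l) F W) (x : End F V)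
    (y : End F W) (u : W →ₗ[F] V) :
    LinearMap.toMatrix (prodBasis h bV bW) (prodBasis h bV bW) (glue x y u) =
      (blockDiag h (LinearMap.toMatrix bV bV x) (LinearMap.toMatrix bW bW y)).1 +
        ((nilRadEquiv h).symm (LinearMap.toMatrix bW bV u)).1 := by
  ext i j
  obtain ⟨i, rfl⟩ := (blockIx h).surjective i
  obtain ⟨j, rfl⟩ := (blockIx h).surjective j
  rcases i with i | i <;> rcases j with j | j <;>
    simp [LinearMap.toMatrix_apply, prodBasis, blockDiag, nilRadEquiv]

open Classical in
-- At (x, y) only the summand of bidegree (dim V, dim W) survives, and there restriction averages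
-- over 𝒰 = Hom(W, V).
theorem ev₂_comul (x : End F V) (y : End F W) (a : C F) :
    ev₂ x y ((bialgC F).comul a) = 𝔼 u : W →ₗ[F] V, ev (glue x y u) a := by
  induction a using C.induction with
  | zero => simp
  | add a b ha hb => simp only [map_add, ha, hb, Finset.expect_add_distrib]
  | incl n f =>
    have hc : (bialgC F).comul (incl F n f) =
        ∑ p ∈ (Finset.HasAntidiagonal.antidiagonal n).attach,
          TensorProduct.map (incl F p.1.1) (incl F p.1.2)
            (comulComp (Finset.HasAntidiagonal.mem_antidiagonal.1 p.2) f) := by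
      change liftC _ (incl F n f) = _
      rw [liftC_incl, LinearMap.sum_apply]
      rfl
    rw [hc, map_sum]
    by_cases h : finrank F V + finrank F W = n
    · rw [Finset.sum_eq_single ⟨(finrank F V, finrank F W),
        Finset.HasAntidiagonal.mem_antidiagonal.2 h⟩]
      · rw [ev₂_map_incl (finBasis F V) (finBasis F W), comulComp, LinearMap.comp_apply,
          LinearEquiv.coe_coe, LinearEquiv.apply_symm_apply]
        change hcRes _ _ _ = _
        rw [hcRes_eq_expect]
        refine Fintype.expect_equiv ((nilRadEquiv h).trans
          (LinearMap.toMatrix (finBasis F W) (finBasis F V)).symm.toEquiv) _ _ fun u => ?_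
        rw [ev_incl (prodBasis h (finBasis F V) (finBasis F W)), toMatrix_glue]
        simp
      · rintro ⟨⟨k, l⟩, hkl⟩ _ hne
        refine ev₂_map_incl_of_ne x y ?_ _
        by_contra hcon
        push Not at hcon
        exact hne (Subtype.ext (Prod.ext hcon.1.symm hcon.2.symm))
      · simp
    · rw [Finset.sum_eq_zero, Finset.expect_eq_zero]
      · intro u _
        exact ev_incl_of_ne _ (by rwa [finrank_prod]) f
      · rintro ⟨⟨k, l⟩, hkl⟩ _
        refine ev₂_map_incl_of_ne x y ?_ _
        by_contra hcon
        push Not at hcon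
        rw [hcon.1, hcon.2] at h
        exact h (Finset.HasAntidiagonal.mem_antidiagonal.1 hkl)

end TwoBlocks

/-! ### Multiplication -/

open Classical in
/-- The contribution of a submodule `N` to the value of a product at `(V, x)`. -/
noncomputable def hallTerm (a b : C F) (x : End F V) (N : Submodule F V) : ℂ :=
  if h : N ≤ N.comap x then ev (x.restrict h) a * ev (N.mapQ N x h) b else 0

theorem hallTerm_of_le (a b : C F) {x : End F V} {N : Submodule F V} (h : N ≤ N.comap x) :
    hallTerm a b x N = ev (x.restrict h) a * ev (N.mapQ N x h) b :=
  dif_pos h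

theorem hallTerm_of_not_le (a b : C F) {x : End F V} {N : Submodule F V} (h : ¬ N ≤ N.comap x) :
    hallTerm a b x N = 0 :=
  dif_neg h

/-- Transport of structure: e intertwines x and y, hence preserves stability and induces
isomorphisms of the subobject and of the quotient. -/
theorem hallTerm_comap (a b : C F) (e : V ≃ₗ[F] W) {x : End F V} {y : End F W}
    (h : ∀ v, e (x v) = y (e v)) (N : Submodule F W) :
    hallTerm a b x (N.comap e.toLinearMap) = hallTerm a b y N := by
  have key : N.comap e.toLinearMap ≤ (N.comap e.toLinearMap).comap x ↔ N ≤ N.comap y := by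
    constructor
    · intro hN w hw
      have := hN (x := e.symm w) (by simpa using hw)
      simpa [h] using this
    · intro hN v hv
      simpa [h] using hN hv
  by_cases hN : N ≤ N.comap y
  · rw [hallTerm_of_le a b hN, hallTerm_of_le a b (key.2 hN)]
    congr 2
    · refine ev_congr (e.ofSubmodule' N) fun v => Subtype.ext ?_
      simp [h]
    · refine ev_congr (Submodule.Quotient.equiv _ _ e ?_) fun v => ?_
      · rw [Submodule.map_comap_eq_of_surjective e.surjective]
      · obtain ⟨v, rfl⟩ := Submodule.mkQ_surjective _ v
        simp [h]
  · rw [hallTerm_of_not_le a b hN, hallTerm_of_not_le a b (fun hcon => hN (key.1 hcon))]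

theorem sum_hallTerm_congr (a b : C F) (e : V ≃ₗ[F] W) {x : End F V} {y : End F W}
    (h : ∀ v, e (x v) = y (e v)) : ∑ N, hallTerm a b x N = ∑ N, hallTerm a b y N :=
  (Fintype.sum_equiv (Submodule.orderIsoMapComap e).symm.toEquiv _ _ fun N =>
    (hallTerm_comap a b e h N).symm).symm

/-- The kernel of `snd` is V × 0. When the lower left corner of z vanishes, this is stable, with the
two diagonal parts of z as restriction and quotient. -/
theorem hallTerm_ker_snd (a b : C F) (z : End F (V × W))
    (h : LinearMap.snd F V W ∘ₗ z ∘ₗ LinearMap.inl F V W = 0) :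
    hallTerm a b z (LinearMap.ker (LinearMap.snd F V W)) =
      ev (LinearMap.fst F V W ∘ₗ z ∘ₗ LinearMap.inl F V W) a *
        ev (LinearMap.snd F V W ∘ₗ z ∘ₗ LinearMap.inr F V W) b := by
  have h0 : ∀ v, (z (v, 0)).2 = 0 := fun v => by simpa using LinearMap.congr_fun h v
  have hN : LinearMap.ker (LinearMap.snd F V W) ≤ (LinearMap.ker (LinearMap.snd F V W)).comap z := by
    rintro ⟨v, w⟩ hw
    obtain rfl : w = 0 := hw
    exact h0 v
  rw [hallTerm_of_le a b hN]
  congr 2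
  · symm
    refine ev_congr (LinearEquiv.ofBijective
      ((LinearMap.inl F V W).codRestrict (LinearMap.ker (LinearMap.snd F V W)) fun v => rfl)
      ⟨fun v v' hv => congrArg (fun p => p.1.1) hv, ?_⟩) fun v => ?_
    · rintro ⟨⟨v, w⟩, hw⟩
      obtain rfl : w = 0 := hw
      exact ⟨v, rfl⟩
    · exact Subtype.ext (Prod.ext rfl (h0 v).symm)
  · refine ev_congr ((LinearMap.snd F V W).quotKerEquivOfSurjective LinearMap.snd_surjective)
      fun v => ?_
    obtain ⟨⟨v, w⟩, rfl⟩ := Submodule.mkQ_surjective _ v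
    have : z (v, w) = z (v, 0) + z (0, w) := by rw [← map_add]; simp
    simp [this, h0]

theorem hallTerm_ker_snd_of_ne (a b : C F) (z : End F (V × W))
    (h : LinearMap.snd F V W ∘ₗ z ∘ₗ LinearMap.inl F V W ≠ 0) :
    hallTerm a b z (LinearMap.ker (LinearMap.snd F V W)) = 0 := by
  refine hallTerm_of_not_le a b fun hN => h (LinearMap.ext fun v => ?_)
  exact hN (x := (v, 0)) rfl

end Structure

end GLInv

namespace GLInv

open Module
open scoped BigOperators

variable {F : Type*} [Field F] [Fintype F] [DecidableEq F]

/-! ### The multiplication as a Hall product -/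

section MulFormula

noncomputable instance {V W : Type*} [AddCommGroup V] [Module F V] [Finite V]
    [AddCommGroup W] [Module F W] [Finite W] : Fintype (V ≃ₗ[F] W) :=
  @Fintype.ofFinite _ (DFunLike.finite _)

variable {V W : Type*} [AddCommGroup V] [Module F V] [Finite V]
  [AddCommGroup W] [Module F W] [Finite W] {k l n : ℕ} (h : k + l = n)

theorem blockTriangular_twoBlock_iff (z : Mat F n) : z.BlockTriangular (twoBlock h) ↔
    ∀ i j, z (blockIx h (Sum.inr i)) (blockIx h (Sum.inl j)) = 0 := by
  constructor
  · intro hz i j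
    exact hz (by simp [twoBlock])
  · intro hz i j hij
    obtain ⟨i, rfl⟩ := (blockIx h).surjective i
    obtain ⟨j, rfl⟩ := (blockIx h).surjective j
    rcases i with i | i <;> rcases j with j | j
    · exact absurd hij (by simp [twoBlock])
    · exact absurd hij (by simp [twoBlock])
    · exact hz i j
    · exact absurd hij (by simp [twoBlock])

theorem blocks_leviProj (z : Mat F n) : blocks h (leviProj (twoBlock h) z).1 = blocks h z := by
  ext i j <;> exact if_pos (by simp [twoBlock])

/-- Dictionary between matrices and subspaces: lying in the parabolic subalgebra means stabilising V
× 0. -/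
theorem blockTriangular_toMatrix_iff (bV : Basis (Fin k) F V) (bW : Basis (Fin l) F W)
    (z : End F (V × W)) :
    (LinearMap.toMatrix (prodBasis h bV bW) (prodBasis h bV bW) z).BlockTriangular (twoBlock h) ↔
      LinearMap.snd F V W ∘ₗ z ∘ₗ LinearMap.inl F V W = 0 := by
  rw [blockTriangular_twoBlock_iff]
  have hm : ∀ i j, LinearMap.toMatrix (prodBasis h bV bW) (prodBasis h bV bW) z
      (blockIx h (Sum.inr i)) (blockIx h (Sum.inl j)) =
      LinearMap.toMatrix bV bW (LinearMap.snd F V W ∘ₗ z ∘ₗ LinearMap.inl F V W) i j := by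
    intro i j
    simp [LinearMap.toMatrix_apply, prodBasis]
  simp only [hm]
  rw [← (LinearMap.toMatrix bV bW).map_eq_zero_iff]
  exact Matrix.ext_iff

theorem blocks_toMatrix (bV : Basis (Fin k) F V) (bW : Basis (Fin l) F W) (z : End F (V × W)) :
    blocks h (LinearMap.toMatrix (prodBasis h bV bW) (prodBasis h bV bW) z) =
      (LinearMap.toMatrix bV bV (LinearMap.fst F V W ∘ₗ z ∘ₗ LinearMap.inl F V W),
        LinearMap.toMatrix bW bW (LinearMap.snd F V W ∘ₗ z ∘ₗ LinearMap.inr F V W)) := by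
  ext i j <;> simp [LinearMap.toMatrix_apply, prodBasis, blocks]

open Classical in
theorem hallTerm_ker_snd_eq_ite (bV : Basis (Fin k) F V) (bW : Basis (Fin l) F W)
    (z : End F (V × W)) (Z : Mat F n)
    (hZ : Z = LinearMap.toMatrix (prodBasis h bV bW) (prodBasis h bV bW) z)
    (f : InvFun F k) (g : InvFun F l) :
    hallTerm (incl F k f) (incl F l g) z (LinearMap.ker (LinearMap.snd F V W)) =
      if Z.BlockTriangular (twoBlock h) then
        f.1 (blocks h (leviProj (twoBlock h) Z).1).1 *
          g.1 (blocks h (leviProj (twoBlock h) Z).1).2 else 0 := by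
  subst hZ
  rw [blocks_leviProj, blocks_toMatrix]
  split_ifs with hz
  · rw [hallTerm_ker_snd _ _ z ((blockTriangular_toMatrix_iff h bV bW z).1 hz), ev_incl bV,
      ev_incl bW]
  · exact hallTerm_ker_snd_of_ne _ _ z fun hz' =>
      hz ((blockTriangular_toMatrix_iff h bV bW z).2 hz')

/-- Invertible matrices as linear automorphisms, through a basis. -/
noncomputable def glEquiv (b : Basis (Fin n) F V) : GL (Fin n) F ≃* (V ≃ₗ[F] V) :=
  (Units.mapEquiv (LinearMap.toMatrixAlgEquiv b).symm.toMulEquiv).trans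
    (LinearMap.GeneralLinearGroup.generalLinearEquiv F V)

theorem toMatrix_glEquiv (b : Basis (Fin n) F V) (g : GL (Fin n) F) :
    LinearMap.toMatrix b b (glEquiv b g).toLinearMap = g.1 :=
  (LinearMap.toMatrixAlgEquiv b).apply_symm_apply g.1

theorem toMatrix_glEquiv_conj (b : Basis (Fin n) F V) (g : GL (Fin n) F) (x : End F V) :
    LinearMap.toMatrix b b ((glEquiv b g).conj x) = Ad g (LinearMap.toMatrix b b x) := by
  have h1 : (glEquiv b g).symm = glEquiv b g⁻¹ := by rw [map_inv]; rfl
  rw [LinearEquiv.conj_apply, LinearMap.toMatrix_comp b b b, LinearMap.toMatrix_comp b b b,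
    toMatrix_glEquiv, h1, toMatrix_glEquiv]
  rfl

/-- An automorphism mapping V × 0 into itself maps it onto itself, by dimension. So the parabolic
subgroup is the stabiliser of V × 0. -/
theorem comap_ker_snd_eq_iff (L : (V × W) ≃ₗ[F] (V × W)) :
    (LinearMap.ker (LinearMap.snd F V W)).comap L.toLinearMap = LinearMap.ker (LinearMap.snd F V W)
      ↔ LinearMap.snd F V W ∘ₗ L.toLinearMap ∘ₗ LinearMap.inl F V W = 0 := by
  constructor
  · intro hL
    ext v
    have : ((v, 0) : V × W) ∈ LinearMap.ker (LinearMap.snd F V W) := rfl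
    rw [← hL] at this
    exact this
  · intro hL
    symm
    apply Submodule.eq_of_le_of_finrank_eq
    · rintro ⟨v, w⟩ hw
      obtain rfl : w = 0 := hw
      exact LinearMap.congr_fun hL v
    · exact ((L.ofSubmodule' (LinearMap.ker (LinearMap.snd F V W))).finrank_eq).symm

open Classical in
theorem parCard_twoBlock (bV : Basis (Fin k) F V) (bW : Basis (Fin l) F W) :
    parCard F (twoBlock h) = Fintype.card {L : (V × W) ≃ₗ[F] (V × W) //
      (LinearMap.ker (LinearMap.snd F V W)).comap L.toLinearMap =
        LinearMap.ker (LinearMap.snd F V W)} := by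
  rw [parCard, ← Nat.card_eq_fintype_card]
  refine Nat.card_congr ((glEquiv (prodBasis h bV bW)).toEquiv.subtypeEquiv fun g => ?_)
  rw [comap_ker_snd_eq_iff, ← blockTriangular_toMatrix_iff h bV bW]
  erw [toMatrix_glEquiv]

/-- Transitivity of the linear group on subspaces of a given dimension: match N with V and a
complement of N with W. -/
theorem exists_comap_ker_snd_eq (N : Submodule F (V × W)) (hN : finrank F N = finrank F V) :
    ∃ L : (V × W) ≃ₗ[F] (V × W), (LinearMap.ker (LinearMap.snd F V W)).comap L.toLinearMap = N := by
  obtain ⟨N', hN'⟩ := N.exists_isCompl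
  have h2 : finrank F N' = finrank F W := by
    have := Submodule.finrank_add_eq_of_isCompl hN'
    rw [hN, finrank_prod] at this
    omega
  let e := (Submodule.prodEquivOfIsCompl N N' hN').symm.trans
    ((LinearEquiv.ofFinrankEq N V hN).prodCongr (LinearEquiv.ofFinrankEq N' W h2))
  refine ⟨e, ?_⟩
  ext v
  simp [e]

open Classical in
-- The automorphisms carrying N to V × 0 form a coset of the stabiliser of V × 0, so each such N is
-- reached |P| times.
theorem card_comap_ker_snd_eq (N : Submodule F (V × W)) (hN : finrank F N = finrank F V) :
    Fintype.card {L : (V × W) ≃ₗ[F] (V × W) //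
      (LinearMap.ker (LinearMap.snd F V W)).comap L.toLinearMap = N} =
    Fintype.card {L : (V × W) ≃ₗ[F] (V × W) //
      (LinearMap.ker (LinearMap.snd F V W)).comap L.toLinearMap =
        LinearMap.ker (LinearMap.snd F V W)} := by
  obtain ⟨L₀, rfl⟩ := exists_comap_ker_snd_eq N hN
  refine Fintype.card_congr ((Equiv.mulRight (L₀⁻¹ : (V × W) ≃ₗ[F] (V × W))).subtypeEquiv
    fun L => ?_)
  have h1 : (((Equiv.mulRight (L₀⁻¹ : (V × W) ≃ₗ[F] (V × W))) L)).toLinearMap =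
    L.toLinearMap ∘ₗ L₀.symm.toLinearMap := rfl
  rw [h1, Submodule.comap_comp]
  constructor
  · intro hL
    rw [hL, ← Submodule.comap_comp]
    simp
  · intro hL
    conv_rhs => rw [← hL, ← Submodule.comap_comp]
    simp

/-- The g-th term of the induction formula depends only on the subspace g⁻¹(V × 0). Grouping the sum
over g by this subspace cancels the factor 1/|P|. -/
theorem ev_mul_incl_prod (bV : Basis (Fin k) F V) (bW : Basis (Fin l) F W) (x : End F (V × W))
    (f : InvFun F k) (g : InvFun F l) :
    ev x ((bialgC F).mul (incl F k f ⊗ₜ[ℂ] incl F l g)) =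
      ∑ N, hallTerm (incl F k f) (incl F l g) x N := by
  classical
  have hV : finrank F V = k := by simpa using finrank_eq_card_basis bV
  have hm : (bialgC F).mul (incl F k f ⊗ₜ[ℂ] incl F l g) =
      incl F (k + l) (mulComp rfl (f ⊗ₜ[ℂ] g)) := by
    simp [bialgC]
  let B := prodBasis (rfl : k + l = k + l) bV bW
  let K := LinearMap.ker (LinearMap.snd F V W)
  rw [hm, ev_incl B]
  change (parCard F (twoBlock rfl) : ℂ)⁻¹ * ∑ a : GL (Fin (k + l)) F, _ = _
  have hpos : (parCard F (twoBlock (rfl : k + l = k + l)) : ℂ) ≠ 0 := by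
    rw [Nat.cast_ne_zero, parCard_twoBlock rfl bV bW]
    have : Nonempty {L : (V × W) ≃ₗ[F] (V × W) // K.comap L.toLinearMap = K} :=
      ⟨⟨LinearEquiv.refl F _, Submodule.comap_id K⟩⟩
    exact Fintype.card_ne_zero
  rw [inv_mul_eq_iff_eq_mul₀ hpos]
  have h1 : ∀ a : GL (Fin (k + l)) F, (if (Ad a (LinearMap.toMatrix B B x)).BlockTriangular
      (twoBlock rfl) then
        f.1 (blocks rfl (leviProj (twoBlock rfl) (Ad a (LinearMap.toMatrix B B x))).1).1 *
          g.1 (blocks rfl (leviProj (twoBlock rfl) (Ad a (LinearMap.toMatrix B B x))).1).2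
            else 0) = hallTerm (incl F k f) (incl F l g) x (K.comap (glEquiv B a).toLinearMap) := by
    intro a
    rw [hallTerm_comap (y := (glEquiv B a).conj x) _ _ _ (fun v => by simp),
      hallTerm_ker_snd_eq_ite rfl bV bW _ _ (toMatrix_glEquiv_conj B a x).symm]
  have hs : (∑ L : (V × W) ≃ₗ[F] (V × W),
      hallTerm (incl F k f) (incl F l g) x (K.comap L.toLinearMap)) =
      (parCard F (twoBlock (rfl : k + l = k + l)) : ℂ) *
        ∑ N, hallTerm (incl F k f) (incl F l g) x N := by
    rw [← Finset.sum_fiberwise (s := Finset.univ)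
      (g := fun L : (V × W) ≃ₗ[F] (V × W) => K.comap L.toLinearMap), Finset.mul_sum]
    refine Finset.sum_congr rfl fun N _ => ?_
    rw [Finset.sum_congr rfl (g := fun _ => hallTerm (incl F k f) (incl F l g) x N)
      (fun L hL => by rw [(Finset.mem_filter.1 hL).2]), Finset.sum_const, nsmul_eq_mul]
    by_cases hN : finrank F N = finrank F V
    · congr 2
      rw [parCard_twoBlock rfl bV bW, ← card_comap_ker_snd_eq N hN, Fintype.card_subtype]
    · have : hallTerm (incl F k f) (incl F l g) x N = 0 := by
        unfold hallTerm
        split_ifs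
        · rw [ev_incl_of_ne _ (by rwa [← hV]), zero_mul]
        · rfl
      rw [this, mul_zero, mul_zero]
  rw [← hs]
  refine Fintype.sum_equiv (glEquiv B).toEquiv _ _ fun a => ?_
  exact h1 a

end MulFormula

section MulFormula

variable {V : Type*} [AddCommGroup V] [Module F V] [Finite V]

theorem hallTerm_add_left (a a' b : C F) (x : End F V) (N : Submodule F V) :
    hallTerm (a + a') b x N = hallTerm a b x N + hallTerm a' b x N := by
  unfold hallTerm
  split_ifs <;> simp [add_mul]

theorem hallTerm_add_right (a b b' : C F) (x : End F V) (N : Submodule F V) :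
    hallTerm a (b + b') x N = hallTerm a b x N + hallTerm a b' x N := by
  unfold hallTerm
  split_ifs <;> simp [mul_add]

/-- The product on `C(q)` is a Hall product. -/
theorem ev_mul (x : End F V) (a b : C F) :
    ev x ((bialgC F).mul (a ⊗ₜ[ℂ] b)) = ∑ N, hallTerm a b x N := by
  induction a using C.induction with
  | zero => simp [hallTerm]
  | add a a' ha ha' =>
    simp only [TensorProduct.add_tmul, map_add, ha, ha', hallTerm_add_left, Finset.sum_add_distrib]
  | incl k f =>
    induction b using C.induction with
    | zero => simp [hallTerm]
    | add b b' hb hb' =>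
      simp only [TensorProduct.tmul_add, map_add, hb, hb', hallTerm_add_right,
        Finset.sum_add_distrib]
    | incl l g =>
      by_cases h : finrank F V = k + l
      -- Both sides are isomorphism invariants of (V, x), so V may be replaced by the model product.
      · let e : V ≃ₗ[F] (Fin k → F) × (Fin l → F) :=
          LinearEquiv.ofFinrankEq _ _ (by simpa using h)
        have he : ∀ v, e (x v) = e.conj x (e v) := fun v => by simp
        rw [ev_congr e he, sum_hallTerm_congr _ _ e he,
          ev_mul_incl_prod (Pi.basisFun F _) (Pi.basisFun F _)]
      · have hm : (bialgC F).mul (incl F k f ⊗ₜ[ℂ] incl F l g) =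
            incl F (k + l) (mulComp rfl (f ⊗ₜ[ℂ] g)) := by
          simp [bialgC]
        rw [hm, ev_incl_of_ne x h, Finset.sum_eq_zero]
        intro N _
        unfold hallTerm
        split_ifs
        · by_cases hN : finrank F N = k
          · rw [ev_incl_of_ne (n := l), mul_zero]
            have := N.finrank_quotient_add_finrank
            omega
          · rw [ev_incl_of_ne _ hN, zero_mul]
        · rfl

theorem ev_unit (x : End F V) (c : ℂ) :
    ev x ((bialgC F).unit c) = if finrank F V = 0 then c else 0 := by
  change ev x (c • incl F 0 (oneFun F 0)) = _
  rw [map_smul]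
  split_ifs with h
  · rw [ev_incl (finBasisOfFinrankEq F V h)]
    simp [oneFun]
  · rw [ev_incl_of_ne x h, smul_zero]

theorem counit_eq_ev (h : finrank F V = 0) (x : End F V) (a : C F) :
    (bialgC F).counit a = ev x a := by
  have h1 : (bialgC F).counit a = ev (Matrix.toLin' (0 : Mat F 0)) a := (ev_toLin' _ a).symm
  have : Subsingleton V := finrank_zero_iff.1 h
  rw [h1]
  refine LinearMap.congr_fun (ev_congr (LinearEquiv.ofFinrankEq _ _ (by simp [h])) fun v => ?_) a
  exact this.elim _ _

end MulFormula

end GLInv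

namespace GLInv

open Module
open scoped BigOperators

variable {F : Type*} [Field F] [Fintype F] [DecidableEq F]

/-! ### Associativity -/

section Assoc

variable {V : Type*} [AddCommGroup V] [Module F V] [Finite V]

open Classical in
theorem sum_submodule_subtype (N : Submodule F V) (g : Submodule F N → ℂ) :
    ∑ M, g M = ∑ M : Submodule F V, if M ≤ N then g (M.comap N.subtype) else 0 := by
  rw [← Finset.sum_filter]
  refine Finset.sum_bij' (fun M _ => M.map N.subtype) (fun M _ => M.comap N.subtype) ?_ ?_ ?_ ?_ ?_
  · intro M _
    simpa using Submodule.map_subtype_le N M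
  · simp
  · intro M _
    exact Submodule.comap_map_eq_of_injective N.injective_subtype M
  · intro M hM
    rw [Submodule.map_comap_subtype]
    exact inf_eq_right.2 (Finset.mem_filter.1 hM).2
  · intro M _
    rw [Submodule.comap_map_eq_of_injective N.injective_subtype]

open Classical in
theorem sum_submodule_quotient (M : Submodule F V) (g : Submodule F (V ⧸ M) → ℂ) :
    ∑ N, g N = ∑ N : Submodule F V, if M ≤ N then g (N.map M.mkQ) else 0 := by
  rw [← Finset.sum_filter]
  refine Finset.sum_bij' (fun N _ => N.comap M.mkQ) (fun N _ => N.map M.mkQ) ?_ ?_ ?_ ?_ ?_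
  · intro N _
    simpa using Submodule.le_comap_mkQ M N
  · simp
  · intro N _
    exact Submodule.map_comap_eq_of_surjective M.mkQ_surjective N
  · intro N hN
    rw [Submodule.comap_map_mkQ]
    exact sup_eq_right.2 (Finset.mem_filter.1 hN).2
  · intro N _
    rw [Submodule.map_comap_eq_of_surjective M.mkQ_surjective]

/-- Both sides sum a(M) b(N/M) c(V/N) over flags M ≤ N of x-stable subspaces. One side groups by N
and uses the subspaces of N, the other groups by M and uses those of V/M; the third isomorphism
theorem matches the last factor. -/
theorem ev_mul_assoc (x : End F V) (a b c : C F) :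
    ev x ((bialgC F).mul ((bialgC F).mul (a ⊗ₜ[ℂ] b) ⊗ₜ[ℂ] c)) =
      ev x ((bialgC F).mul (a ⊗ₜ[ℂ] (bialgC F).mul (b ⊗ₜ[ℂ] c))) := by
  classical
  rw [ev_mul, ev_mul]
  have hL : ∀ N : Submodule F V, hallTerm ((bialgC F).mul (a ⊗ₜ[ℂ] b)) c x N =
      ∑ M : Submodule F V, if h : M ≤ N ∧ N ≤ N.comap x then
        hallTerm a b (x.restrict h.2) (M.comap N.subtype) * ev (N.mapQ N x h.2) c else 0 := by
    intro N
    by_cases hN : N ≤ N.comap x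
    · rw [hallTerm_of_le _ _ hN, ev_mul, sum_submodule_subtype, Finset.sum_mul]
      refine Finset.sum_congr rfl fun M _ => ?_
      by_cases h : M ≤ N
      · rw [if_pos h, dif_pos ⟨h, hN⟩]
      · rw [if_neg h, dif_neg (fun h' => h h'.1), zero_mul]
    · rw [hallTerm_of_not_le _ _ hN, Finset.sum_eq_zero]
      intro M _
      rw [dif_neg fun h' => hN h'.2]
  have hR : ∀ M : Submodule F V, hallTerm a ((bialgC F).mul (b ⊗ₜ[ℂ] c)) x M =
      ∑ N : Submodule F V, if h : M ≤ N ∧ M ≤ M.comap x then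
        ev (x.restrict h.2) a * hallTerm b c (M.mapQ M x h.2) (N.map M.mkQ) else 0 := by
    intro M
    by_cases hM : M ≤ M.comap x
    · rw [hallTerm_of_le _ _ hM, ev_mul, sum_submodule_quotient, Finset.mul_sum]
      refine Finset.sum_congr rfl fun N _ => ?_
      by_cases h : M ≤ N
      · rw [if_pos h, dif_pos ⟨h, hM⟩]
      · rw [if_neg h, dif_neg (fun h' => h h'.1), mul_zero]
    · rw [hallTerm_of_not_le _ _ hM, Finset.sum_eq_zero]
      intro M _
      rw [dif_neg fun h' => hM h'.2]
  rw [Finset.sum_congr rfl fun N _ => hL N, Finset.sum_congr rfl fun M _ => hR M,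
    Finset.sum_comm]
  refine Finset.sum_congr rfl fun M _ => Finset.sum_congr rfl fun N _ => ?_
  by_cases hMN : M ≤ N
  swap
  · rw [dif_neg fun h => hMN h.1, dif_neg fun h => hMN h.1]
  by_cases hM : M ≤ M.comap x
  · rw [dif_pos (⟨hMN, hM⟩ : M ≤ N ∧ _)]
    by_cases hN : N ≤ N.comap x
    · rw [dif_pos (⟨hMN, hN⟩ : M ≤ N ∧ _)]
      have hM' : M.comap N.subtype ≤ (M.comap N.subtype).comap (x.restrict hN) :=
        fun v hv => hM hv
      have hN' : N.map M.mkQ ≤ (N.map M.mkQ).comap (M.mapQ M x hM) := by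
        rintro _ ⟨v, hv, rfl⟩
        exact ⟨x v, hN hv, rfl⟩
      rw [hallTerm_of_le _ _ hM', hallTerm_of_le _ _ hN', mul_assoc]
      have e1 : ev ((x.restrict hN).restrict hM') = ev (x.restrict hM) :=
        ev_congr (Submodule.comapSubtypeEquivOfLe hMN) fun v => rfl
      have e2 : ev ((M.comap N.subtype).mapQ _ (x.restrict hN) hM') =
          ev ((M.mapQ M x hM).restrict hN') := by
        let φ : N →ₗ[F] N.map M.mkQ :=
          (M.mkQ ∘ₗ N.subtype).codRestrict _ fun v => ⟨v, v.2, rfl⟩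
        have hφ : Function.Surjective φ := by
          rintro ⟨_, v, hv, rfl⟩
          exact ⟨⟨v, hv⟩, rfl⟩
        have hk : M.comap N.subtype = LinearMap.ker φ := by
          ext v
          rw [LinearMap.mem_ker, Subtype.ext_iff]
          exact (Submodule.Quotient.mk_eq_zero M).symm
        refine ev_congr ((Submodule.quotEquivOfEq _ _ hk).trans (φ.quotKerEquivOfSurjective hφ))
          fun v => ?_
        obtain ⟨v, rfl⟩ := Submodule.mkQ_surjective _ v
        rfl
      have e3 : ev (N.mapQ N x hN) = ev ((N.map M.mkQ).mapQ _ (M.mapQ M x hM) hN') := by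
        symm
        refine ev_congr (Submodule.quotientQuotientEquivQuotient M N hMN) fun v => ?_
        obtain ⟨v, rfl⟩ := Submodule.mkQ_surjective _ v
        obtain ⟨v, rfl⟩ := Submodule.mkQ_surjective _ v
        rfl
      rw [e1, e2, e3]
    -- Since M ≤ N, stability of N/M in V/M forces stability of N, so an unstable N contributes to
    -- neither side.
    · rw [dif_neg fun h => hN h.2, hallTerm_of_not_le, mul_zero]
      intro h
      refine hN fun v hv => ?_
      obtain ⟨w, hw, hwv⟩ := h (x := M.mkQ v) ⟨v, hv, rfl⟩
      have : w - x v ∈ M := (Submodule.Quotient.eq M).1 hwv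
      simpa using N.sub_mem hw (hMN this)
  · rw [dif_neg (fun h : M ≤ N ∧ M ≤ M.comap x => hM h.2)]
    split_ifs with h
    · rw [hallTerm_of_not_le, zero_mul]
      intro h'
      exact hM fun v hv => h' (x := ⟨v, hMN hv⟩) hv
    · rfl

theorem ev_one_mul (x : End F V) (a : C F) :
    ev x ((bialgC F).mul ((bialgC F).unit 1 ⊗ₜ[ℂ] a)) = ev x a := by
  rw [ev_mul, Finset.sum_eq_single ⊥]
  · rw [hallTerm_of_le _ _ bot_le, ev_unit, if_pos (finrank_bot F V), one_mul]
    refine LinearMap.congr_fun (ev_congr (Submodule.quotEquivOfEqBot ⊥ rfl) fun v => ?_) a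
    obtain ⟨v, rfl⟩ := Submodule.mkQ_surjective _ v
    rfl
  · intro N _ hN
    unfold hallTerm
    split_ifs
    · rw [ev_unit, if_neg (fun h => hN (Submodule.finrank_eq_zero.1 h)), zero_mul]
    · rfl
  · simp

theorem ev_mul_one (x : End F V) (a : C F) :
    ev x ((bialgC F).mul (a ⊗ₜ[ℂ] (bialgC F).unit 1)) = ev x a := by
  rw [ev_mul, Finset.sum_eq_single ⊤]
  · have h0 : finrank F (V ⧸ (⊤ : Submodule F V)) = 0 := finrank_zero_of_subsingleton
    rw [hallTerm_of_le _ _ (le_of_eq (Submodule.comap_top x).symm), ev_unit, if_pos h0, mul_one]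
    exact LinearMap.congr_fun (ev_congr Submodule.topEquiv fun v => rfl) a
  · intro N _ hN
    unfold hallTerm
    split_ifs
    · rw [ev_unit, if_neg, mul_zero]
      intro h
      have := Submodule.finrank_quotient_add_finrank N
      exact hN (Submodule.eq_top_of_finrank_eq (by omega))
    · rfl
  · simp

end Assoc

/-! ### Coassociativity -/

section Coassoc

variable {U V W : Type*} [AddCommGroup U] [Module F U] [Finite U]
  [AddCommGroup V] [Module F V] [Finite V] [AddCommGroup W] [Module F W] [Finite W]

theorem ev₃_assoc (x : End F U) (y : End F V) (z : End F W) (s : C F ⊗[ℂ] C F) (c : C F) :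
    ev₃ x y z (TensorProduct.assoc ℂ (C F) (C F) (C F) (s ⊗ₜ[ℂ] c)) = ev₂ x y s * ev z c := by
  induction s using TensorProduct.induction_on with
  | zero => simp
  | add s t hs ht => simp only [TensorProduct.add_tmul, map_add, hs, ht, add_mul]
  | tmul a b => simp [ev₃, mul_assoc]

theorem ev₃_comul_left (x : End F U) (y : End F V) (z : End F W) (t : C F ⊗[ℂ] C F) :
    ev₃ x y z (TensorProduct.assoc ℂ (C F) (C F) (C F) ((bialgC F).comul.rTensor (C F) t)) =
      𝔼 u : V →ₗ[F] U, ev₂ (glue x y u) z t := by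
  induction t using TensorProduct.induction_on with
  | zero => simp
  | add s t hs ht => simp only [map_add, hs, ht, Finset.expect_add_distrib]
  | tmul a b =>
    rw [LinearMap.rTensor_tmul, ev₃_assoc, ev₂_comul, Finset.expect_mul]
    simp only [ev₂_tmul]

theorem ev₃_comul_right (x : End F U) (y : End F V) (z : End F W) (t : C F ⊗[ℂ] C F) :
    ev₃ x y z ((bialgC F).comul.lTensor (C F) t) =
      𝔼 u : W →ₗ[F] V, ev₂ x (glue y z u) t := by
  induction t using TensorProduct.induction_on with
  | zero => simp
  | add s t hs ht => simp only [map_add, hs, ht, Finset.expect_add_distrib]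
  | tmul a b =>
    rw [LinearMap.lTensor_tmul]
    simp only [ev₃, LinearMap.comp_apply, TensorProduct.map_tmul, LinearMap.mul'_apply, ev₂_tmul]
    rw [ev₂_comul, Finset.mul_expect]

/-- Both sides average over the block upper triangular 3 × 3 endomorphisms with diagonal x, y, z.
The bijection only regroups the three corners. -/
theorem ev₃_coassoc (x : End F U) (y : End F V) (z : End F W) (a : C F) :
    ev₃ x y z (TensorProduct.assoc ℂ (C F) (C F) (C F)
      ((bialgC F).comul.rTensor (C F) ((bialgC F).comul a))) =
    ev₃ x y z ((bialgC F).comul.lTensor (C F) ((bialgC F).comul a)) := by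
  rw [ev₃_comul_left, ev₃_comul_right]
  simp only [ev₂_comul]
  rw [← Finset.expect_product', ← Finset.expect_product']
  refine Fintype.expect_equiv
    { toFun := fun p : (V →ₗ[F] U) × (W →ₗ[F] U × V) =>
        (LinearMap.snd F U V ∘ₗ p.2, p.1.coprod (LinearMap.fst F U V ∘ₗ p.2))
      invFun := fun p : (W →ₗ[F] V) × (V × W →ₗ[F] U) =>
        (p.2 ∘ₗ LinearMap.inl F V W, (p.2 ∘ₗ LinearMap.inr F V W).prod p.1)
      left_inv := fun p => by ext <;> simp
      right_inv := fun p => by ext <;> simp } _ _ fun p => ?_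
  refine LinearMap.congr_fun (ev_congr (LinearEquiv.prodAssoc F U V W) fun v => ?_) a
  ext <;> simp [add_assoc]

/-- The counit is evaluation at the zero space, so counitality reduces to gluing with the zero
space, which changes nothing. -/
theorem ev_lid_counit (y : End F V) (t : C F ⊗[ℂ] C F) :
    ev y (TensorProduct.lid ℂ (C F) ((bialgC F).counit.rTensor (C F) t)) =
      ev₂ (0 : End F (Fin 0 → F)) y t := by
  induction t using TensorProduct.induction_on with
  | zero => simp
  | add s t hs ht => simp only [map_add, hs, ht]
  | tmul a b => simp [counit_eq_ev (V := Fin 0 → F) (by simp) 0 a]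

theorem ev_rid_counit (y : End F V) (t : C F ⊗[ℂ] C F) :
    ev y (TensorProduct.rid ℂ (C F) ((bialgC F).counit.lTensor (C F) t)) =
      ev₂ y (0 : End F (Fin 0 → F)) t := by
  induction t using TensorProduct.induction_on with
  | zero => simp
  | add s t hs ht => simp only [map_add, hs, ht]
  | tmul a b => simp [counit_eq_ev (V := Fin 0 → F) (by simp) 0 b, mul_comm]

theorem ev₂_zero_comul (y : End F V) (a : C F) :
    ev₂ (0 : End F (Fin 0 → F)) y ((bialgC F).comul a) = ev y a := by
  rw [ev₂_comul, Finset.expect_congr rfl (g := fun _ => ev y a), Fintype.expect_const]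
  intro u _
  refine LinearMap.congr_fun (ev_congr (LinearEquiv.uniqueProd (M₂ := Fin 0 → F)) fun v => ?_) a
  simp [glue_apply]

theorem ev₂_comul_zero (y : End F V) (a : C F) :
    ev₂ y (0 : End F (Fin 0 → F)) ((bialgC F).comul a) = ev y a := by
  rw [ev₂_comul, Finset.expect_congr rfl (g := fun _ => ev y a), Fintype.expect_const]
  intro u _
  refine LinearMap.congr_fun (ev_congr (LinearEquiv.prodUnique (M₂ := Fin 0 → F)) fun v => ?_) a
  simp only [LinearEquiv.prodUnique_apply, glue_apply]
  rw [Subsingleton.elim v.2 0, map_zero, add_zero]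

end Coassoc

end GLInv

namespace GLInv

open Module
open scoped BigOperators

variable {F : Type*} [Field F] [Fintype F] [DecidableEq F]

/-! ### The comultiplication is multiplicative -/

section Green

variable {V W : Type*} [AddCommGroup V] [Module F V] [Finite V]
  [AddCommGroup W] [Module F W] [Finite W]

/-- The fibres of a surjective homomorphism are cosets of its kernel and hence of equal size. -/
theorem expect_comp_of_surjective {G G' : Type*} [AddCommGroup G] [AddCommGroup G'] [Fintype G]
    [Fintype G'] (f : G →+ G') (hf : Function.Surjective f) (φ : G' → ℂ) :
    𝔼 g, φ (f g) = 𝔼 g', φ g' := by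
  classical
  obtain ⟨c, hc⟩ : ∃ c : ℕ, ∀ g', (Finset.univ.filter fun g => f g = g').card = c := by
    refine ⟨(Finset.univ.filter fun g => f g = 0).card, fun g' => ?_⟩
    · obtain ⟨g₀, rfl⟩ := hf g'
      refine Finset.card_bij' (fun g _ => g - g₀) (fun g _ => g + g₀) ?_ ?_ ?_ ?_ <;>
        simp +contextual
  have hs : ∀ ψ : G' → ℂ, ∑ g, ψ (f g) = c * ∑ g', ψ g' := by
    intro ψ
    rw [← Finset.sum_fiberwise (s := Finset.univ) (g := f), Finset.mul_sum]
    refine Finset.sum_congr rfl fun g' _ => ?_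
    rw [Finset.sum_congr rfl (g := fun _ => ψ g')
      (fun g hg => by rw [(Finset.mem_filter.1 hg).2]), Finset.sum_const, nsmul_eq_mul, hc]
  have h1 := hs fun _ => 1
  simp only [Finset.sum_const, Finset.card_univ, nsmul_eq_mul, mul_one] at h1
  have hG : (Fintype.card G : ℂ) ≠ 0 := Nat.cast_ne_zero.2 Fintype.card_ne_zero
  rw [h1] at hG
  rw [Fintype.expect_eq_sum_div_card, Fintype.expect_eq_sum_div_card, hs, h1,
    mul_div_mul_left _ _ (left_ne_zero_of_mul hG)]

/-- The unipotent automorphism `(v, w) ↦ (v + θ w, w)`. -/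
def shear (θ : W →ₗ[F] V) : (V × W) ≃ₗ[F] (V × W) where
  toFun p := (p.1 + θ p.2, p.2)
  map_add' p q := by
    ext
    · simp only [Prod.fst_add, Prod.snd_add, map_add]
      abel
    · rfl
  map_smul' c p := by ext <;> simp
  invFun p := (p.1 - θ p.2, p.2)
  left_inv p := by ext <;> simp
  right_inv p := by ext <;> simp

theorem mem_comap_shear (A : Submodule F V) (B : Submodule F W) (θ : W →ₗ[F] V) (p : V × W) :
    p ∈ (A.prod B).comap (shear θ).toLinearMap ↔ p.1 + θ p.2 ∈ A ∧ p.2 ∈ B :=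
  Iff.rfl

/-- Choose a linear section σ of N → snd(N) and extend −fst ∘ σ to θ on W. Subtracting σ(w) shows
that (v, w) lies in N exactly when w lies in snd(N) and v + θ w lies in N ∩ V, so N is straightened
to a product. -/
theorem exists_comap_shear_eq (N : Submodule F (V × W)) :
    ∃ θ : W →ₗ[F] V, ((N.comap (LinearMap.inl F V W)).prod (N.map (LinearMap.snd F V W))).comap
      (shear θ).toLinearMap = N := by
  let φ : N →ₗ[F] N.map (LinearMap.snd F V W) :=
    (LinearMap.snd F V W ∘ₗ N.subtype).codRestrict _ fun v => ⟨v, v.2, rfl⟩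
  have hφ : LinearMap.range φ = ⊤ := by
    rw [LinearMap.range_eq_top]
    rintro ⟨_, v, hv, rfl⟩
    exact ⟨⟨v, hv⟩, rfl⟩
  obtain ⟨σ, hσ⟩ := φ.exists_rightInverse_of_surjective hφ
  obtain ⟨θ, hθ⟩ := (-(LinearMap.fst F V W ∘ₗ N.subtype ∘ₗ σ)).exists_extend
  refine ⟨θ, ?_⟩
  have key : ∀ v w, ∀ hw : w ∈ N.map (LinearMap.snd F V W),
      (v + θ w ∈ N.comap (LinearMap.inl F V W) ↔ (v, w) ∈ N) := by
    intro v w hw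
    have h1 : θ w = -(σ ⟨w, hw⟩).1.1 := LinearMap.congr_fun hθ ⟨w, hw⟩
    have h2 : (σ ⟨w, hw⟩).1.2 = w := congrArg Subtype.val (LinearMap.congr_fun hσ ⟨w, hw⟩)
    have h3 : (v, w) = (v + θ w, 0) + (σ ⟨w, hw⟩).1 := by
      ext
      · simp [h1]
      · simp [h2]
    rw [h3, Submodule.add_mem_iff_left _ (σ ⟨w, hw⟩).2]
    rfl
  ext ⟨v, w⟩
  rw [mem_comap_shear]
  constructor
  · rintro ⟨h1, h2⟩
    exact (key v w h2).1 h1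
  · intro h
    exact ⟨(key v w ⟨_, h, rfl⟩).2 h, ⟨_, h, rfl⟩⟩

/-- The shear producing a given subspace is unique up to maps taking B into A; this counts the
fibres in `sum_submodule_prod`. -/
theorem comap_shear_eq_iff (A : Submodule F V) (B : Submodule F W) (θ θ₀ : W →ₗ[F] V) :
    (A.prod B).comap (shear θ).toLinearMap = (A.prod B).comap (shear θ₀).toLinearMap ↔
      θ - θ₀ ∈ Submodule.compatibleMaps B A := by
  constructor
  · intro h w hw
    have h1 : (-θ₀ w, w) ∈ (A.prod B).comap (shear θ₀).toLinearMap := by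
      rw [mem_comap_shear]
      simpa using hw
    rw [← h, mem_comap_shear] at h1
    simpa [add_comm, sub_eq_add_neg] using h1.1
  · intro h
    ext ⟨v, w⟩
    rw [mem_comap_shear, mem_comap_shear]
    refine and_congr_left fun hw => ?_
    have h1 : θ w - θ₀ w ∈ A := h hw
    have h2 : v + θ w = v + θ₀ w + (θ w - θ₀ w) := by abel
    change v + θ w ∈ A ↔ v + θ₀ w ∈ A
    rw [h2, Submodule.add_mem_iff_left _ h1]

theorem comap_inl_comap_shear (A : Submodule F V) (B : Submodule F W) (θ : W →ₗ[F] V) :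
    ((A.prod B).comap (shear θ).toLinearMap).comap (LinearMap.inl F V W) = A := by
  ext v
  rw [Submodule.mem_comap, mem_comap_shear]
  simp

theorem map_snd_comap_shear (A : Submodule F V) (B : Submodule F W) (θ : W →ₗ[F] V) :
    ((A.prod B).comap (shear θ).toLinearMap).map (LinearMap.snd F V W) = B := by
  ext w
  constructor
  · rintro ⟨p, hp, rfl⟩
    exact ((mem_comap_shear A B θ p).1 hp).2
  · intro hw
    exact ⟨(-θ w, w), (mem_comap_shear A B θ _).2 (by simpa using hw), rfl⟩

noncomputable instance (A : Submodule F V) (B : Submodule F W) :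
    Fintype (Submodule.compatibleMaps B A) := Fintype.ofFinite _

/-- A subspace N determines A = N ∩ V and B = snd(N), and then arises from exactly one coset of the
maps taking B into A, which accounts for the weight. -/
theorem sum_submodule_prod (g : Submodule F (V × W) → ℂ) :
    ∑ N, g N = ∑ A : Submodule F V, ∑ B : Submodule F W,
      (Fintype.card (Submodule.compatibleMaps B A) : ℂ)⁻¹ *
        ∑ θ : W →ₗ[F] V, g ((A.prod B).comap (shear θ).toLinearMap) := by
  classical
  have h1 : ∀ (A : Submodule F V) (B : Submodule F W),
      (Fintype.card (Submodule.compatibleMaps B A) : ℂ)⁻¹ *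
        ∑ θ : W →ₗ[F] V, g ((A.prod B).comap (shear θ).toLinearMap) =
      ∑ N : Submodule F (V × W), if A = N.comap (LinearMap.inl F V W) then
        (if B = N.map (LinearMap.snd F V W) then g N else 0) else 0 := by
    intro A B
    rw [← Finset.sum_fiberwise (s := Finset.univ)
      (g := fun θ : W →ₗ[F] V => (A.prod B).comap (shear θ).toLinearMap), Finset.mul_sum]
    refine Finset.sum_congr rfl fun N _ => ?_
    rw [Finset.sum_congr rfl (g := fun _ => g N)
      (fun L hL => by rw [(Finset.mem_filter.1 hL).2]), Finset.sum_const, nsmul_eq_mul]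
    by_cases hN : A = N.comap (LinearMap.inl F V W) ∧ B = N.map (LinearMap.snd F V W)
    · rw [if_pos hN.1, if_pos hN.2, ← mul_assoc]
      obtain ⟨θ₀, hθ₀⟩ := exists_comap_shear_eq N
      rw [← hN.1, ← hN.2] at hθ₀
      have hc : (Finset.univ.filter fun θ : W →ₗ[F] V =>
          (A.prod B).comap (shear θ).toLinearMap = N).card =
          Fintype.card (Submodule.compatibleMaps B A) := by
        rw [← Fintype.card_subtype]
        refine Fintype.card_congr ((Equiv.subRight θ₀).subtypeEquiv fun θ => ?_)
        conv_lhs => rw [← hθ₀]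
        exact comap_shear_eq_iff A B θ θ₀
      rw [hc, inv_mul_cancel₀ (Nat.cast_ne_zero.2 Fintype.card_ne_zero), one_mul]
    · have hc : (Finset.univ.filter fun θ : W →ₗ[F] V =>
          (A.prod B).comap (shear θ).toLinearMap = N) = ∅ := by
        rw [Finset.filter_eq_empty_iff]
        rintro θ _ rfl
        exact hN ⟨(comap_inl_comap_shear A B θ).symm, (map_snd_comap_shear A B θ).symm⟩
      rw [hc, ← ite_and, if_neg hN]
      simp
  simp only [h1]
  rw [Finset.sum_congr rfl fun A _ => Finset.sum_comm, Finset.sum_comm]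
  refine Finset.sum_congr rfl fun N _ => ?_
  rw [Finset.sum_comm]
  simp

variable (x : End F V) (y : End F W) (A : Submodule F V) (B : Submodule F W)

theorem prod_le_comap_glue_iff (u : W →ₗ[F] V) :
    A.prod B ≤ (A.prod B).comap (glue x y u) ↔
      (A ≤ A.comap x ∧ B ≤ B.comap y) ∧ u ∈ Submodule.compatibleMaps B A := by
  constructor
  · intro h
    refine ⟨⟨fun v hv => ?_, fun w hw => ?_⟩, fun w hw => ?_⟩
    · simpa using h (x := (v, 0)) (by simpa using hv)
    · simpa using (h (x := (0, w)) (by simpa using hw)).2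
    · simpa using (h (x := (0, w)) (by simpa using hw)).1
  · rintro ⟨⟨hA, hB⟩, hu⟩ ⟨v, w⟩ ⟨hv, hw⟩
    simp only [Submodule.mem_comap, glue_apply, Submodule.mem_prod]
    exact ⟨A.add_mem (hA hv) (hu hw), hB hw⟩

/-- The maps `B → A` and `W / B → V / A` induced by a linear map `W → V`. -/
def inducedMaps : Submodule.compatibleMaps B A →+
    (B →ₗ[F] A) × ((W ⧸ B) →ₗ[F] (V ⧸ A)) where
  toFun u := (u.1.restrict u.2, B.mapQ A u.1 u.2)
  map_zero' := by
    refine Prod.ext (LinearMap.ext fun v => rfl) (LinearMap.ext fun v => ?_)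
    obtain ⟨v, rfl⟩ := Submodule.mkQ_surjective _ v
    rfl
  map_add' u u' := by
    refine Prod.ext (LinearMap.ext fun v => rfl) (LinearMap.ext fun v => ?_)
    obtain ⟨v, rfl⟩ := Submodule.mkQ_surjective _ v
    rfl

/-- With a retraction r of W onto B and a section s of V → V/A, the sum of v ∘ r and s ∘ w ∘ (W →
W/B) induces the given pair (v, w). -/
theorem inducedMaps_surjective : Function.Surjective (inducedMaps A B) := by
  rintro ⟨v, w⟩
  obtain ⟨r, hr⟩ := B.subtype.exists_leftInverse_of_injective B.ker_subtype
  obtain ⟨s, hs⟩ := A.mkQ.exists_rightInverse_of_surjective A.range_mkQ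
  let u : W →ₗ[F] V := A.subtype ∘ₗ v ∘ₗ r + s ∘ₗ w ∘ₗ B.mkQ
  have hu : ∀ b : B, u b = v b := by
    intro b
    have h1 : r b = b := LinearMap.congr_fun hr b
    have h2 : B.mkQ b = 0 := (Submodule.Quotient.mk_eq_zero B).2 b.2
    simp only [u, LinearMap.add_apply, LinearMap.comp_apply, h1, h2, map_zero, add_zero]
    rfl
  refine ⟨⟨u, fun b hb => ?_⟩, Prod.ext (LinearMap.ext fun b => Subtype.ext (hu b))
    (LinearMap.ext fun b => ?_)⟩
  · have := hu ⟨b, hb⟩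
    rw [Submodule.mem_comap, this]
    exact (v ⟨b, hb⟩).2
  · obtain ⟨b, rfl⟩ := Submodule.mkQ_surjective _ b
    change A.mkQ (u b) = w (B.mkQ b)
    have h1 : A.mkQ (v (r b)).1 = 0 := (Submodule.Quotient.mk_eq_zero A).2 (v (r b)).2
    have h2 : A.mkQ (s (w (B.mkQ b))) = w (B.mkQ b) := LinearMap.congr_fun hs _
    simp only [u, LinearMap.add_apply, LinearMap.comp_apply, map_add, h2]
    rw [Submodule.coe_subtype, h1, zero_add]

/-- At a stable product A × B, the restriction and the quotient of a gluing are again gluings, with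
the two maps induced by u as corners. -/
theorem hallTerm_glue_prod (a b : C F) (hA : A ≤ A.comap x) (hB : B ≤ B.comap y)
    (u : Submodule.compatibleMaps B A) :
    hallTerm a b (glue x y u.1) (A.prod B) =
      ev (glue (x.restrict hA) (y.restrict hB) (inducedMaps A B u).1) a *
        ev (glue (A.mapQ A x hA) (B.mapQ B y hB) (inducedMaps A B u).2) b := by
  have h := (prod_le_comap_glue_iff x y A B u.1).2 ⟨⟨hA, hB⟩, u.2⟩
  rw [hallTerm_of_le _ _ h]
  congr 2
  · let e : A.prod B ≃ₗ[F] A × B :=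
      { toFun := fun p => (⟨p.1.1, p.2.1⟩, ⟨p.1.2, p.2.2⟩)
        map_add' := fun _ _ => rfl
        map_smul' := fun _ _ => rfl
        invFun := fun p => ⟨(p.1, p.2), p.1.2, p.2.2⟩
        left_inv := fun _ => rfl
        right_inv := fun _ => rfl }
    refine ev_congr e fun p => ?_
    refine Prod.ext (Subtype.ext ?_) (Subtype.ext ?_)
    · rw [glue_apply]
      simp [e]
      rfl
    · simp [e]
  · let φ : V × W →ₗ[F] (V ⧸ A) × (W ⧸ B) := A.mkQ.prodMap B.mkQ
    have hφ : Function.Surjective φ := A.mkQ_surjective.prodMap B.mkQ_surjective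
    have hk : A.prod B = LinearMap.ker φ := by
      rw [LinearMap.ker_prodMap, Submodule.ker_mkQ, Submodule.ker_mkQ]
    refine ev_congr ((Submodule.quotEquivOfEq _ _ hk).trans (φ.quotKerEquivOfSurjective hφ))
      fun p => ?_
    obtain ⟨p, rfl⟩ := Submodule.mkQ_surjective _ p
    change φ (glue x y u.1 p) = _
    rw [glue_apply]
    change (A.mkQ (x p.1 + u.1 p.2), B.mkQ (y p.2)) = _
    rw [map_add, glue_apply]
    rfl

open Classical in
-- Corners not taking B into A make A × B unstable and drop out. For the remaining ones the induced
-- pair of corners is equidistributed, by surjectivity of `inducedMaps`, so the average factors.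
theorem sum_hallTerm_glue_prod (a b : C F) :
    (Fintype.card (Submodule.compatibleMaps B A) : ℂ)⁻¹ *
      ∑ u : W →ₗ[F] V, hallTerm a b (glue x y u) (A.prod B) =
    if h : A ≤ A.comap x ∧ B ≤ B.comap y then
      (𝔼 v, ev (glue (x.restrict h.1) (y.restrict h.2) v) a) *
        𝔼 w, ev (glue (A.mapQ A x h.1) (B.mapQ B y h.2) w) b else 0 := by
  split_ifs with h
  · have h1 : ∑ u : W →ₗ[F] V, hallTerm a b (glue x y u) (A.prod B) =
        ∑ u : Submodule.compatibleMaps B A, hallTerm a b (glue x y u.1) (A.prod B) := by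
      rw [← Finset.sum_filter_of_ne (p := fun u => u ∈ Submodule.compatibleMaps B A)]
      · exact Finset.sum_subtype _ (fun u => by simp) _
      · intro u _ hu
        by_contra h'
        exact hu (hallTerm_of_not_le _ _ fun h'' =>
          h' ((prod_le_comap_glue_iff x y A B u).1 h'').2)
    rw [h1, ← div_eq_inv_mul, ← Fintype.expect_eq_sum_div_card]
    simp only [hallTerm_glue_prod x y A B a b h.1 h.2]
    rw [expect_comp_of_surjective (inducedMaps A B) (inducedMaps_surjective A B)
      (fun p => ev (glue (x.restrict h.1) (y.restrict h.2) p.1) a *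
        ev (glue (A.mapQ A x h.1) (B.mapQ B y h.2) p.2) b), ← Finset.univ_product_univ,
      Finset.expect_product, Finset.expect_mul]
    simp only [Finset.mul_expect]
  · rw [Finset.sum_eq_zero, mul_zero]
    intro u _
    exact hallTerm_of_not_le _ _ fun h' => h ((prod_le_comap_glue_iff x y A B u).1 h').1

/-- Conjugation by the shear replaces the corner u by u + θ y − x θ and leaves the diagonal alone;
summed over all u, this translation is invisible. -/
theorem sum_hallTerm_comap_shear (a b : C F) (θ : W →ₗ[F] V) :
    ∑ u : W →ₗ[F] V, hallTerm a b (glue x y u) ((A.prod B).comap (shear θ).toLinearMap) =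
      ∑ u : W →ₗ[F] V, hallTerm a b (glue x y u) (A.prod B) := by
  refine Fintype.sum_equiv (Equiv.addRight (θ ∘ₗ y - x ∘ₗ θ)) _ _ fun u => ?_
  refine hallTerm_comap a b (shear θ) (fun p => ?_) _
  ext
  · simp only [shear, glue_apply, LinearEquiv.coe_mk, LinearMap.coe_mk, AddHom.coe_mk,
      Equiv.coe_addRight, LinearMap.add_apply, LinearMap.sub_apply, LinearMap.comp_apply, map_add]
    abel
  · simp [shear]

open Classical in
-- Green's formula: the subspaces N of V × W become triples (A, B, θ), the sum over corners does not
-- depend on θ, and so the sum over θ cancels the |Hom(W, V)| of the average.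
theorem ev₂_comul_mul (a b : C F) :
    ev₂ x y ((bialgC F).comul ((bialgC F).mul (a ⊗ₜ[ℂ] b))) =
      ∑ A : Submodule F V, ∑ B : Submodule F W, if h : A ≤ A.comap x ∧ B ≤ B.comap y then
        (𝔼 v, ev (glue (x.restrict h.1) (y.restrict h.2) v) a) *
          𝔼 w, ev (glue (A.mapQ A x h.1) (B.mapQ B y h.2) w) b else 0 := by
  rw [ev₂_comul, Fintype.expect_eq_sum_div_card]
  simp only [ev_mul]
  rw [Finset.sum_congr rfl fun u _ => sum_submodule_prod (hallTerm a b (glue x y u)),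
    Finset.sum_comm, Finset.sum_div]
  refine Finset.sum_congr rfl fun A _ => ?_
  rw [Finset.sum_comm, Finset.sum_div]
  refine Finset.sum_congr rfl fun B _ => ?_
  rw [← sum_hallTerm_glue_prod, ← Finset.mul_sum, Finset.sum_comm]
  simp only [sum_hallTerm_comap_shear]
  rw [Finset.sum_const, Finset.card_univ, nsmul_eq_mul, mul_div_assoc,
    mul_div_cancel_left₀ _ (Nat.cast_ne_zero.2 Fintype.card_ne_zero)]

open Classical in
theorem ev₂_map_mul (s t : C F ⊗[ℂ] C F) :
    ev₂ x y (TensorProduct.map (bialgC F).mul (bialgC F).mul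
      (TensorProduct.tensorTensorTensorComm ℂ (C F) (C F) (C F) (C F) (s ⊗ₜ[ℂ] t))) =
      ∑ A : Submodule F V, ∑ B : Submodule F W, if h : A ≤ A.comap x ∧ B ≤ B.comap y then
        ev₂ (x.restrict h.1) (y.restrict h.2) s *
          ev₂ (A.mapQ A x h.1) (B.mapQ B y h.2) t else 0 := by
  induction s using TensorProduct.induction_on with
  | zero => simp
  | add s s' hs hs' =>
    rw [TensorProduct.add_tmul, map_add, map_add, map_add, hs, hs', ← Finset.sum_add_distrib]
    refine Finset.sum_congr rfl fun A _ => ?_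
    rw [← Finset.sum_add_distrib]
    refine Finset.sum_congr rfl fun B _ => ?_
    split_ifs <;> simp [add_mul]
  | tmul a b =>
    induction t using TensorProduct.induction_on with
    | zero => simp
    | add s s' hs hs' =>
      rw [TensorProduct.tmul_add, map_add, map_add, map_add, hs, hs', ← Finset.sum_add_distrib]
      refine Finset.sum_congr rfl fun A _ => ?_
      rw [← Finset.sum_add_distrib]
      refine Finset.sum_congr rfl fun B _ => ?_
      split_ifs <;> simp [mul_add]
    | tmul c d =>
      rw [TensorProduct.tensorTensorTensorComm_tmul, TensorProduct.map_tmul, ev₂_tmul, ev_mul,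
        ev_mul, Finset.sum_mul]
      refine Finset.sum_congr rfl fun A _ => ?_
      rw [Finset.mul_sum]
      refine Finset.sum_congr rfl fun B _ => ?_
      by_cases hA : A ≤ A.comap x
      · by_cases hB : B ≤ B.comap y
        · rw [dif_pos ⟨hA, hB⟩, hallTerm_of_le _ _ hA, hallTerm_of_le _ _ hB, ev₂_tmul, ev₂_tmul]
          ring
        · rw [dif_neg fun h => hB h.2, hallTerm_of_not_le _ _ hB, mul_zero]
      · rw [dif_neg fun h => hA h.1, hallTerm_of_not_le _ _ hA, zero_mul]

end Green

/-- `C(q)` is a bialgebra. -/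
theorem isBialgebra : (bialgC F).IsBialgebra where
  mul_assoc := TensorProduct.ext_threefold fun a b c => C.ext_ev fun n A => ev_mul_assoc _ a b c
  one_mul a := C.ext_ev fun n A => ev_one_mul _ a
  mul_one a := C.ext_ev fun n A => ev_mul_one _ a
  coassoc := LinearMap.ext fun a => C.ext_ev₃ fun _ A _ B _ D => ev₃_coassoc _ _ _ a
  counit_comul a := (TensorProduct.lid ℂ (C F)).injective <| C.ext_ev fun n A => by
    rw [ev_lid_counit, ev₂_zero_comul, TensorProduct.lid_tmul, one_smul]
  comul_counit a := (TensorProduct.rid ℂ (C F)).injective <| C.ext_ev fun n A => by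
    rw [ev_rid_counit, ev₂_comul_zero, TensorProduct.rid_tmul, one_smul]
  comul_mul := TensorProduct.ext' fun a b => C.ext_ev₂ fun _ A _ B => by
    rw [LinearMap.comp_apply, ev₂_comul_mul, LinearMap.comp_apply, LinearMap.comp_apply,
      TensorProduct.map_tmul]
    erw [ev₂_map_mul]
    refine Finset.sum_congr rfl fun A _ => Finset.sum_congr rfl fun B _ => ?_
    split_ifs
    · rw [ev₂_comul, ev₂_comul]
    · rfl
  comul_one := C.ext_ev₂ fun m A n B => by
    rw [ev₂_comul, ev₂_tmul]
    simp only [ev_unit, finrank_prod]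
    rw [Fintype.expect_const]
    by_cases hm : m = 0 <;> by_cases hn : n = 0 <;> simp [hm, hn]
  counit_mul a b := by
    have h0 : finrank F (Fin 0 → F) = 0 := by simp
    rw [counit_eq_ev h0 0, counit_eq_ev h0 0, counit_eq_ev h0 0, ev_mul,
      Fintype.sum_eq_single (⊥ : Submodule F (Fin 0 → F)) fun N hN => absurd (Subsingleton.elim _ _) hN,
      hallTerm_of_le _ _ bot_le]
    have h1 : finrank F ((Fin 0 → F) ⧸ (⊥ : Submodule F (Fin 0 → F))) = 0 :=
      finrank_zero_of_subsingleton
    rw [← counit_eq_ev (finrank_bot F _), ← counit_eq_ev h1, ← counit_eq_ev h0,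
      ← counit_eq_ev h0]
  counit_one := by
    have h0 : finrank F (Fin 0 → F) = 0 := by simp
    rw [counit_eq_ev h0 0, ev_unit, if_pos h0]

end GLInv

namespace GLInv

open Module
open scoped BigOperators

variable {F : Type*} [Field F] [Fintype F] [DecidableEq F]

/-! ### Block triangular matrices -/

section Blocks

variable {k l n : ℕ} (h : k + l = n)

/-- A block upper triangular matrix with two diagonal blocks. -/
def blockUpper (p : Mat F k × Mat F l × Matrix (Fin k) (Fin l) F) : Mat F n :=
  Matrix.reindex (blockIx h) (blockIx h) (Matrix.fromBlocks p.1 p.2.2 0 p.2.1)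

theorem blockUpper_eq (X : Mat F k) (Y : Mat F l) (u : Matrix (Fin k) (Fin l) F) :
    blockUpper h (X, Y, u) = (blockDiag h X Y).1 + ((nilRadEquiv h).symm u).1 := by
  ext i j
  obtain ⟨i, rfl⟩ := (blockIx h).surjective i
  obtain ⟨j, rfl⟩ := (blockIx h).surjective j
  rcases i with i | i <;> rcases j with j | j <;>
    simp [blockUpper, blockDiag, nilRadEquiv]

theorem blocks_blockUpper (p : Mat F k × Mat F l × Matrix (Fin k) (Fin l) F) :
    blocks h (blockUpper h p) = (p.1, p.2.1) := by
  ext i j <;> simp [blocks, blockUpper]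

theorem blockTriangular_blockUpper (p : Mat F k × Mat F l × Matrix (Fin k) (Fin l) F) :
    (blockUpper h p).BlockTriangular (twoBlock h) := by
  rw [blockTriangular_twoBlock_iff]
  intro i j
  simp [blockUpper]

/-- Block upper triangular matrices with two diagonal blocks are given by their blocks. -/
def blockTriEquiv : {z : Mat F n // z.BlockTriangular (twoBlock h)} ≃
    Mat F k × Mat F l × Matrix (Fin k) (Fin l) F where
  toFun z := ((blocks h z.1).1, (blocks h z.1).2,
    z.1.submatrix (blockIx h ∘ Sum.inl) (blockIx h ∘ Sum.inr))
  invFun p := ⟨blockUpper h p, blockTriangular_blockUpper h p⟩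
  left_inv z := by
    ext i j
    have hz := (blockTriangular_twoBlock_iff h z.1).1 z.2
    obtain ⟨i, rfl⟩ := (blockIx h).surjective i
    obtain ⟨j, rfl⟩ := (blockIx h).surjective j
    rcases i with i | i <;> rcases j with j | j <;> simp [blockUpper, blocks, hz]
  right_inv p := by
    refine Prod.ext ?_ (Prod.ext ?_ ?_) <;> ext i j <;> simp [blockUpper, blocks]

theorem isUnit_blockUpper_iff (p : Mat F k × Mat F l × Matrix (Fin k) (Fin l) F) :
    IsUnit (blockUpper h p) ↔ IsUnit p.1 ∧ IsUnit p.2.1 := by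
  rw [← Matrix.isUnit_fromBlocks_zero₂₁ (B := p.2.2), blockUpper]
  rw [Matrix.isUnit_iff_isUnit_det, Matrix.isUnit_iff_isUnit_det, Matrix.det_reindex_self]

/-- A block upper triangular matrix is invertible exactly when its diagonal blocks are, and its
corner is free. The predicate Q lets the second block range over a smaller parabolic, as needed for
induction in stages. -/
theorem card_parabolic (Q : Mat F l → Prop) :
    Nat.card {g : GL (Fin n) F // (g : Mat F n).BlockTriangular (twoBlock h) ∧
        Q (blocks h (g : Mat F n)).2} =
      Nat.card (GL (Fin k) F) * (Nat.card {g : GL (Fin l) F // Q g} *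
        Nat.card (Matrix (Fin k) (Fin l) F)) := by
  rw [← Nat.card_prod, ← Nat.card_prod]
  refine Nat.card_congr (Equiv.ofBijective (β := _) (fun p =>
    ⟨((isUnit_blockUpper_iff h (p.1.1, p.2.1.1.1, p.2.2)).2 ⟨p.1.isUnit, p.2.1.1.isUnit⟩).unit,
      blockTriangular_blockUpper h _, by
        rw [IsUnit.unit_spec, blocks_blockUpper]
        exact p.2.1.2⟩) ⟨?_, ?_⟩).symm
  · rintro ⟨g, ⟨g', hg'⟩, u⟩ ⟨a, ⟨a', ha'⟩, v⟩ he
    have h1 : blockUpper h (g.1, g'.1, u) = blockUpper h (a.1, a'.1, v) :=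
      congrArg (fun z => z.1.1) he
    have h2 := (blockTriEquiv h).symm.injective (Subtype.ext h1 :
      (blockTriEquiv h).symm (g.1, g'.1, u) = (blockTriEquiv h).symm (a.1, a'.1, v))
    simp only [Prod.mk.injEq] at h2
    obtain ⟨e1, e2, e3⟩ := h2
    obtain rfl := Units.ext e1
    obtain rfl := Units.ext e2
    subst e3
    rfl
  · rintro ⟨z, hz, hQ⟩
    have h1 : blockUpper h (blockTriEquiv h ⟨z.1, hz⟩) = z.1 :=
      congrArg Subtype.val ((blockTriEquiv h).symm_apply_apply ⟨z.1, hz⟩)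
    have h2 := (isUnit_blockUpper_iff h (blockTriEquiv h ⟨z.1, hz⟩)).1 (by rw [h1]; exact z.isUnit)
    refine ⟨⟨h2.1.unit, ⟨h2.2.unit, hQ⟩, (blockTriEquiv h ⟨z.1, hz⟩).2.2⟩, ?_⟩
    exact Subtype.ext (Units.ext h1)

theorem parCard_twoBlock_eq : parCard F (twoBlock h) =
    Nat.card (GL (Fin k) F) * (Nat.card (GL (Fin l) F) * Nat.card (Matrix (Fin k) (Fin l) F)) := by
  have h1 := card_parabolic (F := F) h (fun _ => True)
  rw [Nat.card_congr (Equiv.subtypeUnivEquiv (α := GL (Fin l) F) fun _ => trivial)] at h1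
  rw [← h1, parCard]
  exact Nat.card_congr (Equiv.subtypeEquivRight fun g => by simp)

open Classical in
theorem sum_blockTriangular (φ : Mat F n → ℂ) :
    ∑ z, (if z.BlockTriangular (twoBlock h) then φ z else 0) =
      ∑ X, ∑ Y, ∑ u, φ (blockUpper h (X, Y, u)) := by
  rw [← Finset.sum_filter, Finset.sum_subtype (p := fun z => z.BlockTriangular (twoBlock h)) _
    (fun z => by simp)]
  rw [Fintype.sum_equiv (blockTriEquiv h) _ (fun p => φ (blockUpper h p)) fun z => ?_]
  · rw [Fintype.sum_prod_type]
    refine Finset.sum_congr rfl fun X _ => ?_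
    rw [Fintype.sum_prod_type]
  · congr 1
    exact congrArg Subtype.val ((blockTriEquiv h).symm_apply_apply z).symm

end Blocks

/-! ### The bilinear form -/

section Form

variable (F) in
/-- The symmetric bilinear form for which the normalised orbit indicators are orthonormal. -/
noncomputable def form : LinearMap.BilinForm ℂ (C F) :=
  (orbBasis F).constr ℂ fun i => (orbBasis F).coord i

theorem form_orbBasis (i : OrbIx F) (a : C F) : form F (orbBasis F i) a = (orbBasis F).repr a i := by
  rw [form, Basis.constr_basis]
  rfl

theorem form_comm (a b : C F) : form F a b = form F b a := by
  classical
  have h : form F = LinearMap.flip (form F) :=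
    (orbBasis F).ext fun i => (orbBasis F).ext fun j => by
      rw [LinearMap.flip_apply, form_orbBasis, form_orbBasis, Basis.repr_self, Basis.repr_self,
        Finsupp.single_apply, Finsupp.single_apply]
      simp only [eq_comm]
  exact LinearMap.congr_fun₂ h a b

theorem sum_orbInd_mul {n : ℕ} (o : Orb F n) (g : InvFun F n) :
    ∑ x, (orbInd o.out).1 x * g.1 x = orbCard o.out * g.1 o.out := by
  classical
  simp only [orbInd, ite_mul, one_mul, zero_mul]
  rw [← Finset.sum_filter, Finset.sum_congr rfl (g := fun _ => g.1 o.out), Finset.sum_const,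
    nsmul_eq_mul]
  · rfl
  · intro x hx
    obtain ⟨a, rfl⟩ := (Finset.mem_filter.1 hx).2
    exact g.2 a _

theorem orbEquiv_basis_apply {n : ℕ} (o : Orb F n) :
    Basis.ofEquivFun (orbEquiv (F := F) n) o = (orbScale o : ℂ) • orbInd o.out := by
  classical
  refine (orbEquiv (F := F) n).injective (funext fun p => ?_)
  have h2 : orbEquiv n ((orbScale o : ℂ) • orbInd o.out) p =
      (orbBasis F).repr (orbBasis F ⟨n, o⟩) ⟨n, p⟩ := by
    rw [orbBasis_repr, orbBasis_apply, ev_toLin', comp_incl]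
    rfl
  rw [h2, Basis.repr_self, Basis.coe_ofEquivFun, LinearEquiv.apply_symm_apply,
    Finsupp.single_apply, Pi.single_apply]
  simp only [Sigma.mk.injEq, heq_eq_eq, true_and, eq_comm]

theorem incl_orbEquiv_basis {n : ℕ} (o : Orb F n) :
    incl F n (Basis.ofEquivFun (orbEquiv (F := F) n) o) = orbBasis F ⟨n, o⟩ := by
  rw [orbEquiv_basis_apply, orbBasis_apply]

/-- Both sides are linear in f and agree on normalised orbit indicators because the square of the
scale times the orbit size is |GLₙ|. So `form` is the hermitian form without the conjugation. -/
theorem form_incl {n : ℕ} (f g : InvFun F n) :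
    form F (incl F n f) (incl F n g) =
      (Fintype.card (GL (Fin n) F) : ℂ)⁻¹ * ∑ x, f.1 x * g.1 x := by
  let φ : InvFun F n →ₗ[ℂ] ℂ := (LinearMap.flip (form F) (incl F n g)) ∘ₗ incl F n
  let ψ : InvFun F n →ₗ[ℂ] ℂ := (Fintype.card (GL (Fin n) F) : ℂ)⁻¹ •
    ∑ x, g.1 x • (LinearMap.proj x ∘ₗ (InvFun F n).subtype)
  have hφ : φ = ψ := by
    refine (Basis.ofEquivFun (orbEquiv (F := F) n)).ext fun o => ?_
    rw [orbEquiv_basis_apply]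
    have h1 : incl F n ((orbScale o : ℂ) • orbInd o.out) = orbBasis F ⟨n, o⟩ :=
      (orbBasis_apply ⟨n, o⟩).symm
    simp only [φ, ψ, LinearMap.comp_apply, LinearMap.flip_apply, h1, form_orbBasis, orbBasis_repr,
      ev_toLin', comp_incl, LinearMap.smul_apply, LinearMap.sum_apply, LinearMap.map_smul,
      smul_eq_mul]
    have h2 : ∑ x, g.1 x * (orbScale o * (orbInd o.out).1 x) =
        orbScale o * (orbCard o.out * g.1 o.out) := by
      rw [← sum_orbInd_mul, Finset.mul_sum]
      exact Finset.sum_congr rfl fun x _ => by ring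
    have h3 : (orbScale o : ℂ) * orbScale o = Fintype.card (GL (Fin n) F) / orbCard o.out := by
      rw [← Complex.ofReal_mul, orbScale_sq]
      push_cast
      rfl
    have hG : (Fintype.card (GL (Fin n) F) : ℂ) ≠ 0 := Nat.cast_ne_zero.2 Fintype.card_ne_zero
    have hO : (orbCard o.out : ℂ) ≠ 0 := Nat.cast_ne_zero.2 (orbCard_pos _).ne'
    have hs := orbScale_ne o
    have h4 : (orbScale o : ℂ)⁻¹ =
        (Fintype.card (GL (Fin n) F) : ℂ)⁻¹ * (orbScale o * orbCard o.out) := by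
      field_simp
      rw [sq, h3]
      field_simp
    change _ = (Fintype.card (GL (Fin n) F) : ℂ)⁻¹ * ∑ x, g.1 x * (orbScale o * (orbInd o.out).1 x)
    rw [h2, h4]
    ring
  have h := LinearMap.congr_fun hφ f
  simp only [φ, ψ, LinearMap.comp_apply, LinearMap.flip_apply, LinearMap.smul_apply,
    LinearMap.sum_apply, smul_eq_mul] at h
  rw [h]
  congr 1
  exact Finset.sum_congr rfl fun x _ => mul_comm _ _

theorem form_incl_of_ne {m n : ℕ} (h : m ≠ n) (f : InvFun F m) (g : InvFun F n) :
    form F (incl F m f) (incl F n g) = 0 := by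
  have key : ∀ c : C F, comp F m c = 0 → form F (incl F m f) c = 0 := by
    intro c hc
    have h1 : (form F c) ∘ₗ incl F m = 0 := by
      refine (Basis.ofEquivFun (orbEquiv (F := F) m)).ext fun o => ?_
      rw [LinearMap.comp_apply, incl_orbEquiv_basis, form_comm, form_orbBasis, orbBasis_repr, ev_toLin', hc]
      simp
    rw [form_comm]
    exact LinearMap.congr_fun h1 f
  exact key _ (comp_incl_of_ne h.symm g)

variable (F) in
/-- The induced form on `C(q) ⊗ C(q)`. -/
noncomputable def form₂ : LinearMap.BilinForm ℂ (C F ⊗[ℂ] C F) :=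
  (form F).tmul (form F)

theorem form₂_tmul (a b c d : C F) :
    form₂ F (a ⊗ₜ[ℂ] b) (c ⊗ₜ[ℂ] d) = form F a c * form F b d := by
  simp [form₂, LinearMap.BilinForm.tmul, mul_comm]

theorem form_nondegenerate {a b : C F} (h : ∀ c, form F c a = form F c b) : a = b :=
  (orbBasis F).ext_elem fun i => by rw [← form_orbBasis, ← form_orbBasis, h]

theorem form₂_orbBasis (i j : OrbIx F) (t : C F ⊗[ℂ] C F) :
    form₂ F (orbBasis F i ⊗ₜ[ℂ] orbBasis F j) t =
      ((orbBasis F).tensorProduct (orbBasis F)).repr t (i, j) := by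
  induction t using TensorProduct.induction_on with
  | zero => simp
  | add s t hs ht => simp [hs, ht]
  | tmul c d =>
    rw [form₂_tmul, form_orbBasis, form_orbBasis, Basis.tensorProduct_repr_tmul_apply, smul_eq_mul,
      mul_comm]

theorem form₂_nondegenerate {s t : C F ⊗[ℂ] C F}
    (h : ∀ c d, form₂ F (c ⊗ₜ[ℂ] d) s = form₂ F (c ⊗ₜ[ℂ] d) t) : s = t :=
  ((orbBasis F).tensorProduct (orbBasis F)).ext_elem fun ⟨i, j⟩ => by
    rw [← form₂_orbBasis, ← form₂_orbBasis, h]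

end Form

/-! ### Self-duality -/

section Adjoint

variable {k l n : ℕ}

theorem form₂_map_incl (f : InvFun F k) (g : InvFun F l) (t : InvFun F k ⊗[ℂ] InvFun F l) :
    form₂ F (incl F k f ⊗ₜ[ℂ] incl F l g) (TensorProduct.map (incl F k) (incl F l) t) =
      (Fintype.card (GL (Fin k) F) : ℂ)⁻¹ * (Fintype.card (GL (Fin l) F) : ℂ)⁻¹ *
        ∑ X, ∑ Y, f.1 X * g.1 Y * (boxEquiv F k l t).1 (X, Y) := by
  let ψ : InvFun F k ⊗[ℂ] InvFun F l →ₗ[ℂ] ℂ :=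
    ((Fintype.card (GL (Fin k) F) : ℂ)⁻¹ * (Fintype.card (GL (Fin l) F) : ℂ)⁻¹) •
      ∑ X, ∑ Y, (f.1 X * g.1 Y) • (LinearMap.proj (X, Y) ∘ₗ
        (InvFun₂ F k l).subtype ∘ₗ (boxEquiv F k l).toLinearMap)
  have h : form₂ F (incl F k f ⊗ₜ[ℂ] incl F l g) ∘ₗ TensorProduct.map (incl F k) (incl F l) = ψ := by
    refine TensorProduct.ext' fun a b => ?_
    rw [LinearMap.comp_apply, TensorProduct.map_tmul, form₂_tmul, form_incl, form_incl]
    simp only [ψ, LinearMap.smul_apply, LinearMap.sum_apply, smul_eq_mul]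
    have h2 : ∀ X Y, (LinearMap.proj (X, Y) ∘ₗ (InvFun₂ F k l).subtype ∘ₗ
        (boxEquiv F k l).toLinearMap) (a ⊗ₜ[ℂ] b) = a.1 X * b.1 Y := fun X Y => rfl
    simp only [h2]
    rw [mul_mul_mul_comm, Finset.sum_mul_sum]
    congr 1
    refine Finset.sum_congr rfl fun X _ => Finset.sum_congr rfl fun Y _ => ?_
    ring
  have h3 := LinearMap.congr_fun h t
  rw [LinearMap.comp_apply] at h3
  rw [h3]
  simp only [ψ, LinearMap.smul_apply, LinearMap.sum_apply, smul_eq_mul]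
  rfl

theorem form₂_map_incl_of_ne {p q : ℕ} (hkl : k ≠ p ∨ l ≠ q) (f : InvFun F k) (g : InvFun F l)
    (t : InvFun F p ⊗[ℂ] InvFun F q) :
    form₂ F (incl F k f ⊗ₜ[ℂ] incl F l g) (TensorProduct.map (incl F p) (incl F q) t) = 0 := by
  induction t using TensorProduct.induction_on with
  | zero => simp
  | add s t hs ht => simp [hs, ht]
  | tmul a b =>
    rw [TensorProduct.map_tmul, form₂_tmul]
    rcases hkl with h | h
    · rw [form_incl_of_ne h, zero_mul]
    · rw [form_incl_of_ne h, mul_zero]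

theorem comul_incl (f : InvFun F n) : (bialgC F).comul (incl F n f) =
    ∑ p ∈ (Finset.HasAntidiagonal.antidiagonal n).attach,
      TensorProduct.map (incl F p.1.1) (incl F p.1.2)
        (comulComp (Finset.HasAntidiagonal.mem_antidiagonal.1 p.2) f) := by
  change liftC _ (incl F n f) = _
  rw [liftC_incl, LinearMap.sum_apply]
  rfl

theorem mul_incl (f : InvFun F k) (g : InvFun F l) :
    (bialgC F).mul (incl F k f ⊗ₜ[ℂ] incl F l g) = incl F (k + l) (mulComp rfl (f ⊗ₜ[ℂ] g)) := by
  simp [bialgC]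

/-- Frobenius reciprocity: as c is invariant, the substitution of Ad a in the sum over z makes all a
contribute equally, and |GLₙ| cancels. -/
theorem sum_mulComp_mul (h : k + l = n) (f : InvFun F k) (g : InvFun F l) (c : InvFun F n) :
    (Fintype.card (GL (Fin n) F) : ℂ)⁻¹ * ∑ z, (mulComp h (f ⊗ₜ[ℂ] g)).1 z * c.1 z =
      (parCard F (twoBlock h) : ℂ)⁻¹ *
        ∑ X, ∑ Y, ∑ u, f.1 X * g.1 Y * c.1 (blockUpper h (X, Y, u)) := by
  classical
  have h1 : ∀ z, (mulComp h (f ⊗ₜ[ℂ] g)).1 z = (parCard F (twoBlock h) : ℂ)⁻¹ *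
      ∑ a : GL (Fin n) F, if (Ad a z).BlockTriangular (twoBlock h) then
        f.1 (blocks h (leviProj (twoBlock h) (Ad a z)).1).1 *
          g.1 (blocks h (leviProj (twoBlock h) (Ad a z)).1).2 else 0 := fun z => rfl
  have h2 : ∀ a : GL (Fin n) F, (∑ z, (if (Ad a z).BlockTriangular (twoBlock h) then
        f.1 (blocks h (leviProj (twoBlock h) (Ad a z)).1).1 *
          g.1 (blocks h (leviProj (twoBlock h) (Ad a z)).1).2 else 0) * c.1 z) =
      ∑ X, ∑ Y, ∑ u, f.1 X * g.1 Y * c.1 (blockUpper h (X, Y, u)) := by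
    intro a
    rw [Fintype.sum_equiv ({ toFun := Ad a, invFun := Ad a⁻¹, left_inv := Ad_inv_Ad a,
                             right_inv := Ad_Ad_inv a } : Mat F n ≃ Mat F n) _
      (fun z => if z.BlockTriangular (twoBlock h) then
        f.1 (blocks h z).1 * g.1 (blocks h z).2 * c.1 z else 0)]
    · rw [sum_blockTriangular]
      simp only [blocks_blockUpper]
    · intro z
      simp only [blocks_leviProj, Equiv.coe_fn_mk, ite_mul, zero_mul]
      rw [c.2 a z]
  simp only [h1, mul_assoc, Finset.sum_mul]
  rw [← Finset.mul_sum, Finset.sum_comm, mul_left_comm]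
  congr 1
  simp only [mul_assoc] at h2
  rw [Finset.sum_congr rfl fun a _ => h2 a, Finset.sum_const, Finset.card_univ, nsmul_eq_mul,
    inv_mul_cancel_left₀ (Nat.cast_ne_zero.2 Fintype.card_ne_zero)]

/-- After `sum_mulComp_mul` only the normalisations differ. They agree since |P| = |GLₖ| |GLₗ|
|Hom|, the first two factors coming from the forms and the last from the restriction. -/
theorem form_mul_incl (f : InvFun F k) (g : InvFun F l) (c : InvFun F n) :
    form F ((bialgC F).mul (incl F k f ⊗ₜ[ℂ] incl F l g)) (incl F n c) =
      form₂ F (incl F k f ⊗ₜ[ℂ] incl F l g) ((bialgC F).comul (incl F n c)) := by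
  classical
  rw [comul_incl, map_sum, mul_incl]
  by_cases h : k + l = n
  · rw [Finset.sum_eq_single ⟨(k, l), Finset.HasAntidiagonal.mem_antidiagonal.2 h⟩]
    · subst h
      rw [form_incl, form₂_map_incl, sum_mulComp_mul, parCard_twoBlock_eq]
      have h1 : ∀ X Y, (boxEquiv F k l (comulComp rfl c)).1 (X, Y) =
          (Nat.card (Matrix (Fin k) (Fin l) F) : ℂ)⁻¹ *
            ∑ u, c.1 (blockUpper rfl (X, Y, u)) := by
        intro X Y
        rw [comulComp, LinearMap.comp_apply, LinearEquiv.coe_coe, LinearEquiv.apply_symm_apply]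
        change (uniCard F _ : ℂ)⁻¹ * _ = _
        rw [uniCard_eq, Nat.card_congr (nilRadEquiv rfl)]
        congr 1
        refine Fintype.sum_equiv (nilRadEquiv rfl) _ _ fun u => ?_
        rw [blockUpper_eq, Equiv.symm_apply_apply]
        rfl
      simp only [h1, Finset.mul_sum]
      refine Finset.sum_congr rfl fun X _ => Finset.sum_congr rfl fun Y _ =>
        Finset.sum_congr rfl fun u _ => ?_
      rw [Nat.card_eq_fintype_card, Nat.card_eq_fintype_card]
      push_cast
      rw [mul_inv, mul_inv]
      ring
    · rintro ⟨⟨p, q⟩, hpq⟩ _ hne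
      refine form₂_map_incl_of_ne ?_ f g _
      by_contra hcon
      push Not at hcon
      exact hne (Subtype.ext (Prod.ext hcon.1.symm hcon.2.symm))
    · simp
  · rw [form_incl_of_ne h, Finset.sum_eq_zero]
    rintro ⟨⟨p, q⟩, hpq⟩ _
    refine form₂_map_incl_of_ne ?_ f g _
    by_contra hcon
    push Not at hcon
    rw [hcon.1, hcon.2] at h
    exact h (Finset.HasAntidiagonal.mem_antidiagonal.1 hpq)

/-- Multiplication and comultiplication are adjoint. -/
theorem form_mul (t : C F ⊗[ℂ] C F) (c : C F) :
    form F ((bialgC F).mul t) c = form₂ F t ((bialgC F).comul c) := by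
  induction t using TensorProduct.induction_on with
  | zero => simp
  | add s t hs ht => simp only [map_add, LinearMap.add_apply, hs, ht]
  | tmul a b =>
    induction a using C.induction with
    | zero => simp
    | add a a' ha ha' =>
      simp only [TensorProduct.add_tmul, map_add, LinearMap.add_apply, ha, ha']
    | incl k f =>
      induction b using C.induction with
      | zero => simp
      | add a a' ha ha' =>
        simp only [TensorProduct.tmul_add, map_add, LinearMap.add_apply, ha, ha']
      | incl l g =>
        induction c using C.induction with
        | zero => simp
        | add a a' ha ha' => simp only [map_add, ha, ha']
        | incl n c => exact form_mul_incl f g c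

end Adjoint

end GLInv

/-! ## Graded bialgebras with a homogeneous basis -/

namespace BialgData

open Module

theorem apply_mem_of_mem_span {R A B : Type*} [CommRing R] [AddCommGroup A] [Module R A]
    [AddCommGroup B] [Module R B] {S : Set A} {a : A} (ha : a ∈ Submodule.span R S)
    (f : A →ₗ[R] B) (N : Submodule R B) (h : ∀ s ∈ S, f s ∈ N) : f a ∈ N :=
  (Submodule.span_le (p := N.comap f)).2 h ha

section Graded

variable {R A ι : Type*} [Field R] [AddCommGroup A] [Module R A] {D : BialgData R A}
  (b : Basis ι R A) (deg : ι → ℕ) {𝒜 : ℕ → Submodule R A}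

theorem isInternal_of_basis (hmem : ∀ n a, a ∈ 𝒜 n ↔ ∀ i, deg i ≠ n → b.repr a i = 0) :
    DirectSum.IsInternal 𝒜 := by
  classical
  refine DirectSum.isInternal_submodule_of_iSupIndep_of_iSup_eq_top ?_ ?_
  · rw [iSupIndep_iff_finsetSum_eq_zero_imp_eq_zero]
    intro s v hv hs n hn
    refine b.ext_elem fun i => ?_
    by_cases hi : deg i = n
    · have h1 := congrArg (fun a => b.repr a i) hs
      simp only [map_sum, Finsupp.coe_finsetSum, Finset.sum_apply] at h1
      rw [Finset.sum_eq_single n] at h1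
      · exact h1
      · intro m hm hmn
        exact (hmem m _).1 (hv m hm) i (fun h => hmn (h.symm.trans hi))
      · exact fun h => absurd hn h
    · rw [(hmem n _).1 (hv n hn) i hi]
      simp
  · rw [eq_top_iff, ← b.span_eq, Submodule.span_le]
    rintro _ ⟨i, rfl⟩
    refine Submodule.mem_iSup_of_mem (deg i) ((hmem _ _).2 fun j hj => ?_)
    rw [b.repr_self, Finsupp.single_apply, if_neg]
    rintro rfl
    exact hj rfl

theorem basis_mem_grading (hmem : ∀ n a, a ∈ 𝒜 n ↔ ∀ i, deg i ≠ n → b.repr a i = 0) (i : ι) :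
    b i ∈ 𝒜 (deg i) := by
  classical
  refine (hmem _ _).2 fun j hj => ?_
  rw [b.repr_self, Finsupp.single_apply, if_neg]
  rintro rfl
  exact hj rfl

theorem mem_span_basis (hmem : ∀ n a, a ∈ 𝒜 n ↔ ∀ i, deg i ≠ n → b.repr a i = 0) {n : ℕ} {a : A}
    (ha : a ∈ 𝒜 n) : a ∈ Submodule.span R {x | ∃ i, deg i = n ∧ x = b i} := by
  rw [← b.linearCombination_repr a, Finsupp.linearCombination_apply]
  refine Submodule.sum_mem _ fun i hi => Submodule.smul_mem _ _ (Submodule.subset_span ⟨i, ?_, rfl⟩)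
  by_contra h
  exact Finsupp.mem_support_iff.1 hi ((hmem n a).1 ha i h)

theorem mem_span_tmul_basis (p : ι → ι → Prop) {t : A ⊗[R] A}
    (ht : ∀ i j, (b.tensorProduct b).repr t (i, j) ≠ 0 → p i j) :
    t ∈ Submodule.span R {x | ∃ i j, p i j ∧ x = b i ⊗ₜ[R] b j} := by
  rw [← (b.tensorProduct b).linearCombination_repr t, Finsupp.linearCombination_apply]
  refine Submodule.sum_mem _ fun i hi => Submodule.smul_mem _ _ (Submodule.subset_span
    ⟨i.1, i.2, ht _ _ (Finsupp.mem_support_iff.1 hi), ?_⟩)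
  rw [Basis.tensorProduct_apply']

/-- With a homogeneous basis having a single element in degree 0, the graded axioms are conditions
on structure constants. The field is general because this serves both over ℂ and over ℝ. -/
theorem isConnectedGradedHopf_of_basis
    (hmem : ∀ n a, a ∈ 𝒜 n ↔ ∀ i, deg i ≠ n → b.repr a i = 0)
    (hD : D.IsBialgebra) (hS : ∃ S, D.IsAntipode S)
    (hmul : ∀ i j k, b.repr (D.mul (b i ⊗ₜ[R] b j)) k ≠ 0 → deg k = deg i + deg j)
    (hcomul : ∀ i j k, (b.tensorProduct b).repr (D.comul (b k)) (i, j) ≠ 0 →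
      deg k = deg i + deg j)
    (i₀ : ι) (hi₀ : ∀ i, deg i = 0 ↔ i = i₀) (hunit : D.unit 1 = b i₀)
    (hcounit : ∀ i, i ≠ i₀ → D.counit (b i) = 0) : D.IsConnectedGradedHopf 𝒜 where
  toIsBialgebra := hD
  exists_antipode := hS
  isInternal := isInternal_of_basis b deg hmem
  mul_mem k l x hx y hy := by
    refine apply_mem_of_mem_span (mem_span_basis b deg hmem hx)
      (D.mul ∘ₗ (TensorProduct.mk R A A).flip y) _ ?_
    rintro _ ⟨i, rfl, rfl⟩
    refine apply_mem_of_mem_span (mem_span_basis b deg hmem hy)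
      (D.mul ∘ₗ (TensorProduct.mk R A A (b i))) _ ?_
    rintro _ ⟨j, rfl, rfl⟩
    refine (hmem _ _).2 fun m hm => ?_
    by_contra h
    exact hm (hmul i j m h)
  comul_mem n a ha := by
    refine apply_mem_of_mem_span (mem_span_basis b deg hmem ha) D.comul _ ?_
    rintro _ ⟨k, rfl, rfl⟩
    refine Submodule.span_le.2 ?_ (mem_span_tmul_basis b (fun i j => deg k = deg i + deg j)
      fun i j => hcomul i j k)
    rintro _ ⟨i, j, hij, rfl⟩
    refine Submodule.mem_iSup_of_mem (deg i, deg j) (Submodule.mem_iSup_of_mem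
      (Finset.HasAntidiagonal.mem_antidiagonal.2 hij.symm) ?_)
    exact ⟨⟨b i, basis_mem_grading b deg hmem i⟩ ⊗ₜ ⟨b j, basis_mem_grading b deg hmem j⟩, rfl⟩
  counit_eq_zero n hn a ha := by
    refine (Submodule.mem_bot R).1 (apply_mem_of_mem_span (mem_span_basis b deg hmem ha)
      D.counit ⊥ ?_)
    rintro _ ⟨k, rfl, rfl⟩
    exact (Submodule.mem_bot R).2 (hcounit k fun h => hn ((hi₀ k).2 h))
  unit_injective := by
    refine Function.HasLeftInverse.injective ⟨D.counit, fun r => ?_⟩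
    have : r = r • (1 : R) := by simp
    rw [this, map_smul, map_smul, hD.counit_one]
  range_unit := by
    refine le_antisymm ?_ fun a ha => ?_
    · rintro _ ⟨r, rfl⟩
      have : r = r • (1 : R) := by simp
      rw [this, map_smul, hunit]
      exact Submodule.smul_mem _ _ ((hi₀ i₀).2 rfl ▸ basis_mem_grading b deg hmem i₀)
    · refine Submodule.span_le.2 ?_ (mem_span_basis b deg hmem ha)
      rintro _ ⟨i, hi, rfl⟩
      exact ⟨1, by rw [hunit, (hi₀ i).1 hi]⟩

end Graded

end BialgData

namespace GLInv

open Module BialgData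
open scoped BigOperators ComplexOrder

variable {F : Type*} [Field F] [Fintype F] [DecidableEq F]

/-! ### Structure constants in the basis of normalised orbit indicators -/

theorem mem_gradC_iff (n : ℕ) (a : C F) :
    a ∈ gradC F n ↔ ∀ i : OrbIx F, i.1 ≠ n → (orbBasis F).repr a i = 0 := by
  constructor
  · rintro ⟨f, rfl⟩ i hi
    rw [orbBasis_repr, ev_toLin', comp_incl_of_ne hi.symm]
    simp
  · intro h
    rw [← (orbBasis F).linearCombination_repr a, Finsupp.linearCombination_apply]
    refine Submodule.sum_mem _ fun i hi => Submodule.smul_mem _ _ ?_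
    have : i.1 = n := by
      by_contra hn
      exact Finsupp.mem_support_iff.1 hi (h i hn)
    subst this
    rw [orbBasis_apply]
    exact ⟨_, rfl⟩

theorem repr_mul_degree (i j k : OrbIx F)
    (h : (orbBasis F).repr ((bialgC F).mul (orbBasis F i ⊗ₜ[ℂ] orbBasis F j)) k ≠ 0) :
    k.1 = i.1 + j.1 := by
  by_contra hk
  refine h ?_
  rw [orbBasis_apply i, orbBasis_apply j, mul_incl]
  exact (mem_gradC_iff _ _).1 ⟨_, rfl⟩ k hk

theorem repr_comul (i j : OrbIx F) (c : C F) :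
    ((orbBasis F).tensorProduct (orbBasis F)).repr ((bialgC F).comul c) (i, j) =
      form F ((bialgC F).mul (orbBasis F i ⊗ₜ[ℂ] orbBasis F j)) c := by
  rw [form_mul, form₂_orbBasis]

/-- Self-duality in coordinates: multiplication and comultiplication share their structure
constants. -/
theorem repr_comul_basis (i j k : OrbIx F) :
    ((orbBasis F).tensorProduct (orbBasis F)).repr ((bialgC F).comul (orbBasis F k)) (i, j) =
      (orbBasis F).repr ((bialgC F).mul (orbBasis F i ⊗ₜ[ℂ] orbBasis F j)) k := by
  rw [repr_comul, form_comm, form_orbBasis]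

/-! ### Nonnegativity of the structure constants -/

section Nonneg

variable {V : Type*} [AddCommGroup V] [Module F V] [Finite V]

theorem ev_eq_ev_toLin' (x : End F V) :
    ev x = ev (Matrix.toLin' (LinearMap.toMatrix (finBasis F V) (finBasis F V) x)) := by
  refine ev_congr (finBasis F V).equivFun fun v => ?_
  rw [Matrix.toLin'_apply]
  exact (LinearMap.toMatrix_mulVec_repr (finBasis F V) (finBasis F V) x v).symm

theorem ev_orbBasis_nonneg (x : End F V) (i : OrbIx F) : 0 ≤ ev x (orbBasis F i) := by
  classical
  rw [ev_eq_ev_toLin', ev_toLin', orbBasis_apply]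
  obtain ⟨n, o⟩ := i
  by_cases h : n = finrank F V
  · subst h
    rw [comp_incl, Submodule.coe_smul, Pi.smul_apply, orbInd_out, smul_eq_mul]
    refine mul_nonneg (Complex.zero_le_real.2 (orbScale_pos o).le) ?_
    split_ifs <;> simp
  · rw [comp_incl_of_ne h]
    simp

theorem hallTerm_nonneg {a b : C F}
    (ha : ∀ n (A : Mat F n), 0 ≤ ev (Matrix.toLin' A) a)
    (hb : ∀ n (A : Mat F n), 0 ≤ ev (Matrix.toLin' A) b) (x : End F V) (N : Submodule F V) :
    0 ≤ hallTerm a b x N := by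
  unfold hallTerm
  split_ifs
  · rw [ev_eq_ev_toLin', ev_eq_ev_toLin' (N.mapQ N x _)]
    exact mul_nonneg (ha _ _) (hb _ _)
  · exact le_rfl

end Nonneg

/-- A Hall product of functions with nonnegative values has nonnegative values, and coordinates are
positive multiples of values. -/
theorem repr_mul_nonneg (i j k : OrbIx F) :
    0 ≤ (orbBasis F).repr ((bialgC F).mul (orbBasis F i ⊗ₜ[ℂ] orbBasis F j)) k := by
  rw [orbBasis_repr, ev_mul]
  refine mul_nonneg ?_ (Finset.sum_nonneg fun N _ =>
    hallTerm_nonneg (fun _ _ => ev_orbBasis_nonneg _ i) (fun _ _ => ev_orbBasis_nonneg _ j) _ N)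
  rw [← Complex.ofReal_inv]
  exact Complex.zero_le_real.2 (inv_nonneg.2 (orbScale_pos _).le)

/-! ### Commutativity -/

/-- On vectors with real coordinates the complex bilinear form is a sum of squares, hence definite.
-/
theorem form_self_eq_zero {a : C F} (ha : ∀ i, ((orbBasis F).repr a i).im = 0)
    (h : form F a a = 0) : a = 0 := by
  have h1 : form F a a = ∑ i ∈ ((orbBasis F).repr a).support,
      (((((orbBasis F).repr a i).re ^ 2 : ℝ)) : ℂ) := by
    conv_lhs => rw [form, Basis.constr_apply, Finsupp.sum, LinearMap.sum_apply]
    refine Finset.sum_congr rfl fun i _ => ?_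
    rw [LinearMap.smul_apply, Basis.coord_apply, smul_eq_mul]
    have : (orbBasis F).repr a i = (((orbBasis F).repr a i).re : ℂ) :=
      Complex.ext rfl (by simp [ha i])
    rw [this]
    push_cast
    rw [Complex.ofReal_re]
    ring
  rw [h1, ← Complex.ofReal_sum, Complex.ofReal_eq_zero,
    Finset.sum_eq_zero_iff_of_nonneg fun i _ => sq_nonneg _] at h
  refine (orbBasis F).ext_elem fun i => ?_
  by_cases hi : i ∈ ((orbBasis F).repr a).support
  · have := h i hi
    rw [map_zero, Finsupp.zero_apply]
    exact Complex.ext (by simpa using this) (ha i)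
  · rw [Finsupp.notMem_support_iff.1 hi]
    simp

variable (F) in
/-- The unit orbit. -/
def orbZero : OrbIx F := ⟨0, Quotient.mk _ 0⟩

theorem degree_eq_zero_iff (i : OrbIx F) : i.1 = 0 ↔ i = orbZero F := by
  constructor
  · obtain ⟨n, o⟩ := i
    rintro rfl
    refine Sigma.ext rfl (heq_of_eq ?_)
    refine Quotient.inductionOn o fun x => ?_
    exact congrArg _ (Subsingleton.elim _ _)
  · rintro rfl
    rfl

theorem unit_one_eq : (bialgC F).unit 1 = orbBasis F (orbZero F) := by
  rw [orbBasis_apply]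
  have h : (bialgC F).unit 1 = incl F 0 (oneFun F 0) := by simp [bialgC]
  rw [h]
  congr 1
  have hO : orbCard (orbZero F).2.out = 1 := by
    have h1 := orbCard_pos (orbZero F).2.out
    have h2 : orbCard (orbZero F).2.out ≤ 1 := by
      classical
      have : Subsingleton (Mat F (orbZero F).1) := inferInstanceAs (Subsingleton (Mat F 0))
      exact (Finset.card_le_univ _).trans (Fintype.card_le_one_iff_subsingleton.2 inferInstance)
    omega
  have hG : Fintype.card (GL (Fin 0) F) = 1 :=
    Fintype.card_eq_one_iff.2 ⟨1, fun g => Units.ext (Subsingleton.elim _ _)⟩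
  have hs : orbScale (orbZero F).2 = 1 := by
    unfold orbScale
    rw [hO]
    change Real.sqrt ((Fintype.card (GL (Fin 0) F) : ℝ) / (1 : ℕ)) = 1
    rw [hG]
    simp
  ext x
  rw [hs, Subsingleton.elim x (orbZero F).2.out]
  simp only [oneFun, orbInd, Submodule.coe_smul, Pi.smul_apply]
  rw [if_pos ⟨1, (Ad_one _).symm⟩]
  simp

theorem form₂_tensorTensorTensorComm (x y : C F) (a b c d : C F) :
    form₂ F (x ⊗ₜ[ℂ] y) (TensorProduct.map (bialgC F).mul (bialgC F).mul
      (TensorProduct.tensorTensorTensorComm ℂ (C F) (C F) (C F) (C F)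
        ((a ⊗ₜ[ℂ] b) ⊗ₜ[ℂ] (c ⊗ₜ[ℂ] d)))) =
      form F x ((bialgC F).mul (a ⊗ₜ[ℂ] c)) * form F y ((bialgC F).mul (b ⊗ₜ[ℂ] d)) := by
  rw [TensorProduct.tensorTensorTensorComm_tmul, TensorProduct.map_tmul, form₂_tmul]

/-- Let d be the commutator. It has real coordinates, so (d, d) = 0 suffices. By adjointness and
multiplicativity of Δ, the pairing of e_x e_y with e_z e_w is that of e_x ⊗ e_y with Δ(e_z) Δ(e_w).
For x, y of positive degree this involves only products of smaller degree, which commute by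
induction, so z and w may be exchanged. -/
theorem orbBasis_mul_comm (n : ℕ) : ∀ i j : OrbIx F, i.1 + j.1 = n →
    (bialgC F).mul (orbBasis F i ⊗ₜ[ℂ] orbBasis F j) =
      (bialgC F).mul (orbBasis F j ⊗ₜ[ℂ] orbBasis F i) := by
  induction n using Nat.strong_induction_on with
  | _ n ih =>
  intro i j hij
  by_cases hi : i.1 = 0
  · rw [(degree_eq_zero_iff i).1 hi, ← unit_one_eq, isBialgebra.one_mul, isBialgebra.mul_one]
  by_cases hj : j.1 = 0
  · rw [(degree_eq_zero_iff j).1 hj, ← unit_one_eq, isBialgebra.one_mul, isBialgebra.mul_one]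
  let M := TensorProduct.map (bialgC F).mul (bialgC F).mul ∘ₗ
        (TensorProduct.tensorTensorTensorComm ℂ (C F) (C F) (C F) (C F)).toLinearMap
  have hM : ∀ a b, (bialgC F).comul ((bialgC F).mul (a ⊗ₜ[ℂ] b)) =
      M ((bialgC F).comul a ⊗ₜ[ℂ] (bialgC F).comul b) := fun a b =>
    LinearMap.congr_fun (isBialgebra (F := F)).comul_mul (a ⊗ₜ[ℂ] b)
  have hspan : ∀ k : OrbIx F, (bialgC F).comul (orbBasis F k) ∈ Submodule.span ℂ
      {x | ∃ p q : OrbIx F, k.1 = p.1 + q.1 ∧ x = orbBasis F p ⊗ₜ[ℂ] orbBasis F q} := fun k =>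
    mem_span_tmul_basis (orbBasis F) _ fun p q hpq =>
      repr_mul_degree p q k (by rwa [← repr_comul_basis])
  have key : ∀ x y z w : OrbIx F, x.1 + y.1 = n → z.1 + w.1 = n → x.1 ≠ 0 → y.1 ≠ 0 →
      form₂ F (orbBasis F x ⊗ₜ[ℂ] orbBasis F y)
        (M ((bialgC F).comul (orbBasis F z) ⊗ₜ[ℂ] (bialgC F).comul (orbBasis F w))) =
      form₂ F (orbBasis F x ⊗ₜ[ℂ] orbBasis F y)
        (M ((bialgC F).comul (orbBasis F w) ⊗ₜ[ℂ] (bialgC F).comul (orbBasis F z))) := by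
    intro x y z w hxy hzw hx hy
    let f := form₂ F (orbBasis F x ⊗ₜ[ℂ] orbBasis F y) ∘ₗ M
    have hf : ∀ s ∈ Submodule.span ℂ
        {u | ∃ p q : OrbIx F, z.1 = p.1 + q.1 ∧ u = orbBasis F p ⊗ₜ[ℂ] orbBasis F q},
        ∀ t ∈ Submodule.span ℂ
        {u | ∃ p q : OrbIx F, w.1 = p.1 + q.1 ∧ u = orbBasis F p ⊗ₜ[ℂ] orbBasis F q},
        f (s ⊗ₜ[ℂ] t) - f (t ⊗ₜ[ℂ] s) = 0 := by
      intro s hs t ht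
      refine (Submodule.mem_bot ℂ).1 (apply_mem_of_mem_span hs
        (f ∘ₗ (TensorProduct.mk ℂ _ _).flip t - f ∘ₗ TensorProduct.mk ℂ _ _ t) ⊥ ?_)
      rintro _ ⟨p, q, hpq, rfl⟩
      refine apply_mem_of_mem_span ht (f ∘ₗ TensorProduct.mk ℂ _ _ (orbBasis F p ⊗ₜ orbBasis F q) -
        f ∘ₗ (TensorProduct.mk ℂ _ _).flip (orbBasis F p ⊗ₜ orbBasis F q)) ⊥ ?_
      rintro _ ⟨r, s, hrs, rfl⟩
      refine (Submodule.mem_bot ℂ).2 (sub_eq_zero.2 ?_)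
      simp only [f, M, LinearMap.comp_apply, TensorProduct.mk_apply, LinearMap.flip_apply,
        LinearEquiv.coe_coe, form₂_tensorTensorTensorComm]
      -- If the degrees match, the two products have degrees x.1 and y.1, each below n because the
      -- other is positive; otherwise both pairings vanish.
      by_cases hx' : x.1 = p.1 + r.1
      · rw [ih x.1 (by omega) p r hx'.symm, ih y.1 (by omega) q s (by omega)]
      · have h1 : (orbBasis F).repr ((bialgC F).mul (orbBasis F p ⊗ₜ orbBasis F r)) x = 0 := by
          by_contra h
          exact hx' (repr_mul_degree _ _ _ h)
        have h2 : (orbBasis F).repr ((bialgC F).mul (orbBasis F r ⊗ₜ orbBasis F p)) x = 0 := by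
          by_contra h
          exact hx' ((repr_mul_degree _ _ _ h).trans (add_comm _ _))
        rw [form_orbBasis, form_orbBasis, form_orbBasis, form_orbBasis, h1, h2, zero_mul, zero_mul]
    exact sub_eq_zero.1 (hf _ (hspan z) _ (hspan w))
  refine sub_eq_zero.1 (form_self_eq_zero (fun k => ?_) ?_)
  · rw [map_sub, Finsupp.sub_apply, Complex.sub_im,
      ← (Complex.nonneg_iff.1 (repr_mul_nonneg i j k)).2,
      ← (Complex.nonneg_iff.1 (repr_mul_nonneg j i k)).2, sub_zero]
  · rw [map_sub, map_sub, LinearMap.sub_apply, LinearMap.sub_apply, form_mul, form_mul, form_mul,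
      form_mul, hM, hM, key i j i j hij hij hi hj,
      key j i i j ((add_comm _ _).trans hij) hij hj hi]
    ring

theorem mul_comm' (a b : C F) : (bialgC F).mul (a ⊗ₜ[ℂ] b) = (bialgC F).mul (b ⊗ₜ[ℂ] a) := by
  have h : (bialgC F).mul = (bialgC F).mul ∘ₗ (TensorProduct.comm ℂ (C F) (C F)).toLinearMap := by
    refine ((orbBasis F).tensorProduct (orbBasis F)).ext fun ⟨i, j⟩ => ?_
    rw [Basis.tensorProduct_apply]
    exact orbBasis_mul_comm _ i j rfl
  exact LinearMap.congr_fun h (a ⊗ₜ[ℂ] b)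

/-- The adjoint statement of commutativity. -/
theorem comul_comm (a : C F) :
    TensorProduct.comm ℂ (C F) (C F) ((bialgC F).comul a) = (bialgC F).comul a := by
  refine form₂_nondegenerate fun c d => ?_
  have h : ∀ t : C F ⊗[ℂ] C F, form₂ F (c ⊗ₜ[ℂ] d) (TensorProduct.comm ℂ (C F) (C F) t) =
      form₂ F (d ⊗ₜ[ℂ] c) t := by
    intro t
    induction t using TensorProduct.induction_on with
    | zero => simp
    | add s t hs ht => simp only [map_add, hs, ht]
    | tmul x y => rw [TensorProduct.comm_tmul, form₂_tmul, form₂_tmul, mul_comm]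
  rw [h, ← form_mul, ← form_mul, mul_comm']

end GLInv

namespace GLInv

open Module BialgData
open scoped BigOperators

variable {F : Type*} [Field F] [Fintype F] [DecidableEq F]

/-! ### Restriction followed by induction -/

section IndRes

variable {n : ℕ} {α : Type*} [LinearOrder α] (b : Fin n → α)

variable (F) in
/-- Harish-Chandra restriction followed by Harish-Chandra induction. -/
noncomputable def hcIndRes : InvFun F n →ₗ[ℂ] InvFun F n :=
  hcIndLin b ∘ₗ hcResLin b ∘ₗ (InvFun F n).subtype

open Classical in
-- For x in 𝒫, π(x) − x lies in 𝒰 and is absorbed by the sum, so the projection can be dropped when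
-- induction follows restriction.
theorem sum_leviProj_add {x : Mat F n} (hx : x.BlockTriangular b) (f : Mat F n → ℂ) :
    ∑ u : NilRad F b, f ((leviProj b x).1 + u.1) = ∑ u : NilRad F b, f (x + u.1) := by
  have h0 : ∀ i j, b j ≤ b i → ((leviProj b x).1 - x) i j = 0 := by
    intro i j hij
    rw [Matrix.sub_apply]
    rcases hij.lt_or_eq with h | h
    · rw [hx h, (leviProj b x).2 i j h.ne', sub_zero]
    · exact sub_eq_zero.2 (if_pos h.symm)
  let e : NilRad F b ≃ NilRad F b :=
    { toFun := fun u => ⟨(leviProj b x).1 - x + u.1, fun i j hij => by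
        rw [Matrix.add_apply, h0 i j hij, u.2 i j hij, add_zero]⟩
      invFun := fun u => ⟨u.1 - ((leviProj b x).1 - x), fun i j hij => by
        rw [Matrix.sub_apply, h0 i j hij, u.2 i j hij, sub_zero]⟩
      left_inv := by intro u; apply Subtype.ext; simp
      right_inv := by intro u; apply Subtype.ext; simp }
  refine Fintype.sum_equiv e _ _ fun u => congrArg f ?_
  simp only [e, Equiv.coe_fn_mk]
  abel

open Classical in
theorem hcIndRes_apply (f : InvFun F n) (x : Mat F n) :
    (hcIndRes F b f).1 x = (parCard F b : ℂ)⁻¹ * ((uniCard F b : ℂ)⁻¹ *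
      ∑ g : GL (Fin n) F, if (Ad g x).BlockTriangular b then
        ∑ u : NilRad F b, f.1 (Ad g x + u.1) else 0) := by
  change (parCard F b : ℂ)⁻¹ * (∑ g : GL (Fin n) F, if (Ad g x).BlockTriangular b then
    (uniCard F b : ℂ)⁻¹ * ∑ u : NilRad F b, f.1 ((leviProj b (Ad g x)).1 + u.1) else 0) = _
  congr 1
  rw [Finset.mul_sum]
  refine Finset.sum_congr rfl fun g _ => ?_
  split_ifs with hg
  · rw [sum_leviProj_add b hg]
  · simp

end IndRes

/-! ### Induction and restriction in stages -/

section Cons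

variable {k l n : ℕ} (h : k + l = n) {α β : Type*} [LinearOrder α] [LinearOrder β]

/-- The block function `b` consists of one block followed by the blocks of `b'`. -/
structure IsBlockCons (b : Fin n → α) (b' : Fin l → β) : Prop where
  inl_lt_inr : ∀ i j, b (blockIx h (Sum.inl i)) < b (blockIx h (Sum.inr j))
  inl_eq_inl : ∀ i j, b (blockIx h (Sum.inl i)) = b (blockIx h (Sum.inl j))
  inr_lt_inr : ∀ i j, b (blockIx h (Sum.inr i)) < b (blockIx h (Sum.inr j)) ↔ b' i < b' j

variable {h} {b : Fin n → α} {b' : Fin l → β}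

theorem IsBlockCons.inr_le_inr (hb : IsBlockCons h b b') (i j : Fin l) :
    b (blockIx h (Sum.inr i)) ≤ b (blockIx h (Sum.inr j)) ↔ b' i ≤ b' j := by
  rw [← not_lt, hb.inr_lt_inr, not_lt]

theorem IsBlockCons.blockTriangular_iff (hb : IsBlockCons h b b') (z : Mat F n) :
    z.BlockTriangular b ↔
      z.BlockTriangular (twoBlock h) ∧ (blocks h z).2.BlockTriangular b' := by
  rw [blockTriangular_twoBlock_iff]
  constructor
  · intro hz
    exact ⟨fun i j => hz (hb.inl_lt_inr j i), fun i j hij => hz ((hb.inr_lt_inr j i).2 hij)⟩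
  · rintro ⟨h1, h2⟩ i j hij
    obtain ⟨i, rfl⟩ := (blockIx h).surjective i
    obtain ⟨j, rfl⟩ := (blockIx h).surjective j
    rcases i with i | i <;> rcases j with j | j
    · exact absurd hij (by rw [hb.inl_eq_inl i j]; exact lt_irrefl _)
    · exact absurd hij (hb.inl_lt_inr i j).asymm
    · exact h1 i j
    · exact h2 ((hb.inr_lt_inr j i).1 hij)

theorem IsBlockCons.parCard_eq (hb : IsBlockCons h b b') :
    parCard F b = Nat.card (GL (Fin k) F) * (parCard F b' *
        Nat.card (Matrix (Fin k) (Fin l) F)) := by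
  rw [parCard, parCard, ← card_parabolic h (fun z => z.BlockTriangular b')]
  exact Nat.card_congr (Equiv.subtypeEquivRight fun g => hb.blockTriangular_iff _)

/-- The nilradical for a block function `b` consisting of one block followed by those of `b'`. -/
def IsBlockCons.nilRadEquiv (hb : IsBlockCons h b b') : NilRad F b' × Matrix (Fin k) (Fin l) F ≃ NilRad F b where
  toFun p := ⟨blockUpper h (0, p.1.1, p.2), fun i j hij => by
    obtain ⟨i, rfl⟩ := (blockIx h).surjective i
    obtain ⟨j, rfl⟩ := (blockIx h).surjective j
    rcases i with i | i <;> rcases j with j | j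
    · simp [blockUpper]
    · exact absurd hij (hb.inl_lt_inr i j).not_ge
    · simp [blockUpper]
    · simpa [blockUpper] using p.1.2 i j ((hb.inr_le_inr j i).1 hij)⟩
  invFun u := (⟨(blocks h u.1).2, fun i j hij => u.2 _ _ ((hb.inr_le_inr j i).2 hij)⟩,
    u.1.submatrix (blockIx h ∘ Sum.inl) (blockIx h ∘ Sum.inr))
  left_inv p := by
    refine Prod.ext (Subtype.ext ?_) ?_ <;> ext i j <;> simp [blockUpper, blocks]
  right_inv u := by
    ext i j
    have hu := u.2 i j
    obtain ⟨i, rfl⟩ := (blockIx h).surjective i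
    obtain ⟨j, rfl⟩ := (blockIx h).surjective j
    rcases i with i | i <;> rcases j with j | j
    · simp [blockUpper, hu (hb.inl_eq_inl j i).le]
    · simp [blockUpper]
    · simp [blockUpper, hu (hb.inl_lt_inr j i).le]
    · simp [blockUpper, blocks]

theorem IsBlockCons.uniCard_eq (hb : IsBlockCons h b b') :
    uniCard F b = uniCard F b' * Nat.card (Matrix (Fin k) (Fin l) F) := by
  rw [GLInv.uniCard_eq, GLInv.uniCard_eq, ← Nat.card_prod]
  exact (Nat.card_congr hb.nilRadEquiv).symm

theorem blockUpper_add (p q : Mat F k × Mat F l × Matrix (Fin k) (Fin l) F) :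
    blockUpper h (p + q) = blockUpper h p + blockUpper h q := by
  ext i j
  obtain ⟨i, rfl⟩ := (blockIx h).surjective i
  obtain ⟨j, rfl⟩ := (blockIx h).surjective j
  rcases i with i | i <;> rcases j with j | j <;> simp [blockUpper]

theorem Ad_blockDiagGL_blockUpper (g' : GL (Fin l) F)
    (p : Mat F k × Mat F l × Matrix (Fin k) (Fin l) F) :
    Ad (blockDiagGL h 1 g') (blockUpper h p) =
      blockUpper h (p.1, Ad g' p.2.1, p.2.2 * ((g'⁻¹ : GL (Fin l) F) : Mat F l)) := by
  have : ((blockDiagGL h (1 : GL (Fin k) F) g')⁻¹ : GL (Fin n) F).1 =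
    (blockDiag h 1 ((g'⁻¹ : GL (Fin l) F) : Mat F l)).1 := rfl
  unfold Ad
  rw [this]
  simp [blockDiagGL, blockDiag, blockUpper, Matrix.submatrix_mul_equiv, Matrix.fromBlocks_multiply]

open Classical in
theorem boxEquiv_comulComp (f : InvFun F n) (X : Mat F k) (Y : Mat F l) :
    (boxEquiv F k l (comulComp h f)).1 (X, Y) =
      (Nat.card (Matrix (Fin k) (Fin l) F) : ℂ)⁻¹ * ∑ u, f.1 (blockUpper h (X, Y, u)) := by
  rw [comulComp, LinearMap.comp_apply, LinearEquiv.coe_coe, LinearEquiv.apply_symm_apply]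
  change (uniCard F _ : ℂ)⁻¹ * _ = _
  rw [GLInv.uniCard_eq, Nat.card_congr (GLInv.nilRadEquiv h)]
  congr 1
  refine Fintype.sum_equiv (GLInv.nilRadEquiv h) _ _ fun u => ?_
  rw [blockUpper_eq, Equiv.symm_apply_apply]
  rfl

open Classical in
theorem boxEquiv_lTensor_hcIndRes (t : InvFun F k ⊗[ℂ] InvFun F l) (X : Mat F k) (Y : Mat F l) :
    (boxEquiv F k l ((hcIndRes F b').lTensor (InvFun F k) t)).1 (X, Y) =
      (parCard F b' : ℂ)⁻¹ * ((uniCard F b' : ℂ)⁻¹ *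
      ∑ g : GL (Fin l) F, if (Ad g Y).BlockTriangular b' then
        ∑ u : NilRad F b', (boxEquiv F k l t).1 (X, Ad g Y + u.1) else 0) := by
  induction t using TensorProduct.induction_on with
  | zero =>
    rw [LinearMap.map_zero, LinearEquiv.map_zero]
    simp
  | add s t hs ht =>
    simp only [LinearMap.map_add, LinearEquiv.map_add, Submodule.coe_add, Pi.add_apply, hs, ht, Finset.sum_add_distrib]
    rw [← mul_add, ← mul_add, ← Finset.sum_add_distrib]
    congr 2
    refine Finset.sum_congr rfl fun g _ => ?_
    split_ifs <;> simp
  | tmul a c =>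
    rw [LinearMap.lTensor_tmul]
    change a.1 X * (hcIndRes F b' c).1 Y = (parCard F b' : ℂ)⁻¹ * ((uniCard F b' : ℂ)⁻¹ *
      ∑ g : GL (Fin l) F, if (Ad g Y).BlockTriangular b' then
        ∑ u : NilRad F b', a.1 X * c.1 (Ad g Y + u.1) else 0)
    rw [hcIndRes_apply]
    simp only [← Finset.mul_sum, ← mul_ite_zero]
    ring

open Classical in
-- The nilradical of b consists of the nilradical of b' together with the free corner: restricting
-- in two steps sums over the same matrices as restricting at once.
theorem sum_boxEquiv_comulComp (hb : IsBlockCons h b b') (f : InvFun F n) (z : Mat F n) (hz : z.BlockTriangular b) :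
    ∑ u' : NilRad F b', (boxEquiv F k l (comulComp h f)).1
        ((blocks h z).1, (blocks h z).2 + u'.1) =
      (Nat.card (Matrix (Fin k) (Fin l) F) : ℂ)⁻¹ * ∑ u : NilRad F b, f.1 (z + u.1) := by
  obtain ⟨⟨X, Y, w⟩, rfl⟩ : ∃ p, blockUpper h p = z :=
    ⟨blockTriEquiv h ⟨z, (hb.blockTriangular_iff z).1 hz |>.1⟩,
      congrArg Subtype.val ((blockTriEquiv h).symm_apply_apply ⟨z, _⟩)⟩
  simp only [blocks_blockUpper, boxEquiv_comulComp]
  rw [← Finset.mul_sum]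
  congr 1
  rw [← Fintype.sum_prod_type', ← hb.nilRadEquiv.sum_comp]
  -- The corner w of z is absorbed by translating the free corner.
  refine Fintype.sum_equiv ((Equiv.refl _).prodCongr (Equiv.subRight w)) _ _ fun p => ?_
  change _ = f.1 (blockUpper h (X, Y, w) + blockUpper h (0, p.1.1, p.2 - w))
  rw [← blockUpper_add]
  simp

open Classical in
/-- Restriction and induction in stages. -/
theorem IsBlockCons.hcIndRes_eq (hb : IsBlockCons h b b') (f : InvFun F n) :
    hcIndRes F b f = mulComp h ((hcIndRes F b').lTensor (InvFun F k) (comulComp h f)) := by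
  ext x
  have h1 : (mulComp h ((hcIndRes F b').lTensor (InvFun F k) (comulComp h f))).1 x =
      (parCard F (twoBlock h) : ℂ)⁻¹ *
      ∑ a : GL (Fin n) F, if (Ad a x).BlockTriangular (twoBlock h) then
        (boxEquiv F k l ((hcIndRes F b').lTensor (InvFun F k) (comulComp h f))).1
          (blocks h (leviProj (twoBlock h) (Ad a x)).1) else 0 := rfl
  rw [h1]
  let ψ : Mat F n → ℂ := fun z => if z.BlockTriangular b then ∑ u : NilRad F b, f.1 (z + u.1) else 0
  -- The inner induction from the Levi of GLₗ is rewritten as a sum over block diagonal elements of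
  -- GLₙ acting by conjugation.
  have h2 : ∀ a : GL (Fin n) F, (if (Ad a x).BlockTriangular (twoBlock h) then
        (boxEquiv F k l ((hcIndRes F b').lTensor (InvFun F k) (comulComp h f))).1
          (blocks h (leviProj (twoBlock h) (Ad a x)).1) else 0) =
      (parCard F b' : ℂ)⁻¹ * ((uniCard F b' : ℂ)⁻¹ *
        ((Nat.card (Matrix (Fin k) (Fin l) F) : ℂ)⁻¹ *
          ∑ g : GL (Fin l) F, ψ (Ad (blockDiagGL h 1 g) (Ad a x)))) := by
    intro a
    generalize Ad a x = z
    rw [blocks_leviProj]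
    split_ifs with hz
    · obtain ⟨⟨X, Y, w⟩, rfl⟩ : ∃ p, blockUpper h p = z :=
        ⟨blockTriEquiv h ⟨z, hz⟩,
          congrArg Subtype.val ((blockTriEquiv h).symm_apply_apply ⟨z, hz⟩)⟩
      rw [blocks_blockUpper, boxEquiv_lTensor_hcIndRes]
      refine congrArg _ (congrArg _ ?_)
      rw [Finset.mul_sum]
      refine Finset.sum_congr rfl fun g _ => ?_
      simp only [ψ]
      have h3 : (Ad (blockDiagGL h 1 g) (blockUpper h (X, Y, w))).BlockTriangular b ↔
          (Ad g Y).BlockTriangular b' := by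
        rw [hb.blockTriangular_iff, Ad_blockDiagGL_blockUpper, blocks_blockUpper]
        exact and_iff_right (blockTriangular_blockUpper h _)
      by_cases hg : (Ad g Y).BlockTriangular b'
      · rw [if_pos hg, if_pos (h3.2 hg), ← sum_boxEquiv_comulComp hb f _ (h3.2 hg),
          Ad_blockDiagGL_blockUpper, blocks_blockUpper]
      · rw [if_neg hg, if_neg (fun hc => hg (h3.1 hc)), mul_zero]
    -- Conjugation by block diagonal elements preserves block triangularity in both directions, so ψ
    -- vanishes on all these conjugates.
    · rw [Finset.sum_eq_zero]
      · simp
      · intro g _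
        refine if_neg fun hc => hz ?_
        have h3 := ((hb.blockTriangular_iff _).1 hc).1
        obtain ⟨p, hp⟩ : ∃ p, blockUpper h p = Ad (blockDiagGL h 1 g) z :=
          ⟨blockTriEquiv h ⟨_, h3⟩,
            congrArg Subtype.val ((blockTriEquiv h).symm_apply_apply ⟨_, h3⟩)⟩
        have h4 : z = Ad (blockDiagGL h 1 g⁻¹) (blockUpper h p) := by
          rw [hp]
          exact (Ad_inv_Ad (blockDiagGL h 1 g) z).symm
        rw [h4, Ad_blockDiagGL_blockUpper]
        exact blockTriangular_blockUpper h _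
  -- Left translation by a block diagonal element permutes GLₙ, so the inner sum merely contributes
  -- |GLₗ|.
  have h5 : ∑ a : GL (Fin n) F, ∑ g : GL (Fin l) F, ψ (Ad (blockDiagGL h 1 g) (Ad a x)) =
      Nat.card (GL (Fin l) F) * ∑ a : GL (Fin n) F, ψ (Ad a x) := by
    rw [Finset.sum_comm, Nat.card_eq_fintype_card, ← Finset.card_univ, ← nsmul_eq_mul,
      ← Finset.sum_const]
    refine Finset.sum_congr rfl fun g _ => ?_
    refine Fintype.sum_equiv (Equiv.mulLeft (blockDiagGL h 1 g)) _ _ fun a => ?_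
    rw [Equiv.coe_mulLeft, Ad_mul]
  rw [Finset.sum_congr rfl fun a _ => h2 a, ← Finset.mul_sum, ← Finset.mul_sum, ← Finset.mul_sum,
    h5, hcIndRes_apply, hb.parCard_eq, hb.uniCard_eq, parCard_twoBlock_eq]
  have hG : (Nat.card (GL (Fin l) F) : ℂ) ≠ 0 := Nat.cast_ne_zero.2 Nat.card_pos.ne'
  push_cast
  simp only [mul_inv, ψ]
  field_simp

end Cons

end GLInv

/-! ## Antipodes of commutative bialgebras -/

namespace BialgData

variable {R A : Type*} [CommRing R] [AddCommGroup A] [Module R A] {D : BialgData R A}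

theorem IsBialgebra.mul_assoc_apply (hD : D.IsBialgebra) (a b c : A) :
    D.mul (D.mul (a ⊗ₜ[R] b) ⊗ₜ[R] c) = D.mul (a ⊗ₜ[R] D.mul (b ⊗ₜ[R] c)) :=
  LinearMap.congr_fun hD.mul_assoc ((a ⊗ₜ[R] b) ⊗ₜ[R] c)

/-- The commutative ring underlying a commutative bialgebra. -/
abbrev IsBialgebra.toCommRing (hD : D.IsBialgebra)
    (hc : ∀ a b, D.mul (a ⊗ₜ[R] b) = D.mul (b ⊗ₜ[R] a)) : CommRing A :=
  { (inferInstance : AddCommGroup A) with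
    mul := fun a b => D.mul (a ⊗ₜ[R] b)
    one := D.unit 1
    mul_assoc := hD.mul_assoc_apply
    one_mul := hD.one_mul
    mul_one := hD.mul_one
    mul_comm := hc
    left_distrib := fun a b c => by
      change D.mul (a ⊗ₜ[R] (b + c)) = D.mul (a ⊗ₜ[R] b) + D.mul (a ⊗ₜ[R] c)
      rw [TensorProduct.tmul_add, map_add]
    right_distrib := fun a b c => by
      change D.mul ((a + b) ⊗ₜ[R] c) = D.mul (a ⊗ₜ[R] c) + D.mul (b ⊗ₜ[R] c)
      rw [TensorProduct.add_tmul, map_add]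
    zero_mul := fun a => by
      change D.mul (0 ⊗ₜ[R] a) = 0
      simp
    mul_zero := fun a => by
      change D.mul (a ⊗ₜ[R] 0) = 0
      simp }

/-- The algebra underlying a commutative bialgebra. -/
abbrev IsBialgebra.toAlgebra (hD : D.IsBialgebra)
    (hc : ∀ a b, D.mul (a ⊗ₜ[R] b) = D.mul (b ⊗ₜ[R] a)) :
    letI := hD.toCommRing hc
    Algebra R A :=
  letI := hD.toCommRing hc
  Algebra.ofModule
    (fun r x y => by
      change D.mul ((r • x) ⊗ₜ[R] y) = r • D.mul (x ⊗ₜ[R] y)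
      rw [← TensorProduct.smul_tmul', map_smul])
    (fun r x y => by
      change D.mul (x ⊗ₜ[R] (r • y)) = r • D.mul (x ⊗ₜ[R] y)
      rw [TensorProduct.tmul_smul, map_smul])

/-- The coalgebra underlying a bialgebra. -/
abbrev IsBialgebra.toCoalgebra (hD : D.IsBialgebra) : Coalgebra R A where
  comul := D.comul
  counit := D.counit
  coassoc := hD.coassoc
  rTensor_counit_comp_comul := LinearMap.ext hD.counit_comul
  lTensor_counit_comp_comul := LinearMap.ext hD.comul_counit

theorem IsBialgebra.mul'_eq (hD : D.IsBialgebra)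
    (hc : ∀ a b, D.mul (a ⊗ₜ[R] b) = D.mul (b ⊗ₜ[R] a)) :
    letI := hD.toCommRing hc
    letI := hD.toAlgebra hc
    LinearMap.mul' R A = D.mul :=
  letI := hD.toCommRing hc
  letI := hD.toAlgebra hc
  TensorProduct.ext' fun _ _ => rfl

theorem IsBialgebra.linearMap_eq (hD : D.IsBialgebra)
    (hc : ∀ a b, D.mul (a ⊗ₜ[R] b) = D.mul (b ⊗ₜ[R] a)) :
    letI := hD.toCommRing hc
    letI := hD.toAlgebra hc
    Algebra.linearMap R A = D.unit := by
  refine LinearMap.ext fun r => ?_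
  change r • D.unit 1 = D.unit r
  rw [← map_smul, smul_eq_mul, _root_.mul_one]

/-- Inverses for the convolution product are unique. -/
theorem IsBialgebra.convolution_inverse_unique (hD : D.IsBialgebra)
    (hc : ∀ a b, D.mul (a ⊗ₜ[R] b) = D.mul (b ⊗ₜ[R] a)) {f g h : A →ₗ[R] A}
    (hfg : D.mul ∘ₗ TensorProduct.map f g ∘ₗ D.comul = D.unit ∘ₗ D.counit)
    (hgh : D.mul ∘ₗ TensorProduct.map g h ∘ₗ D.comul = D.unit ∘ₗ D.counit) : f = h := by
  let := hD.toCommRing hc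
  let := hD.toAlgebra hc
  let := hD.toCoalgebra
  have h1 : WithConv.toConv f * WithConv.toConv g = 1 := by
    rw [LinearMap.convMul_def, LinearMap.convOne_def, hD.mul'_eq hc, hD.linearMap_eq hc]
    exact congrArg WithConv.toConv hfg
  have h2 : WithConv.toConv g * WithConv.toConv h = 1 := by
    rw [LinearMap.convMul_def, LinearMap.convOne_def, hD.mul'_eq hc, hD.linearMap_eq hc]
    exact congrArg WithConv.toConv hgh
  exact WithConv.toConv_injective (left_inv_eq_right_inv h1 h2)

/-- The antipode of a commutative bialgebra is multiplicative. -/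
theorem IsAntipode.map_mul {S : A →ₗ[R] A} (hS : D.IsAntipode S) (hD : D.IsBialgebra)
    (hc : ∀ a b, D.mul (a ⊗ₜ[R] b) = D.mul (b ⊗ₜ[R] a)) (a b : A) :
    S (D.mul (a ⊗ₜ[R] b)) = D.mul (S a ⊗ₜ[R] S b) := by
  let := hD.toCommRing hc
  let := hD.toAlgebra hc
  let := hD.toCoalgebra
  have e : LinearMap.mul' R (A ⊗[R] A) = TensorProduct.map D.mul D.mul ∘ₗ
      (TensorProduct.tensorTensorTensorComm R A A A A).toLinearMap :=
    TensorProduct.ext_fourfold' fun x y z w =>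
      LinearMap.mul'_apply.trans (Algebra.TensorProduct.tmul_mul_tmul x z y w)
  let : Bialgebra R A := Bialgebra.mk' R A hD.counit_one (fun {a b} => hD.counit_mul a b)
    hD.comul_one (fun {a b} => by
      have h1 := LinearMap.congr_fun hD.comul_mul (a ⊗ₜ[R] b)
      refine h1.trans ?_
      exact (LinearMap.congr_fun e (D.comul a ⊗ₜ[R] D.comul b)).symm)
  -- S becomes the antipode of a commutative Hopf algebra, where an antipode preserves products
  -- without reversing them.
  let : HopfAlgebra R A :=
    { antipode := S
      mul_antipode_rTensor_comul := by
        rw [hD.mul'_eq hc, hD.linearMap_eq hc]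
        exact hS.left
      mul_antipode_lTensor_comul := by
        rw [hD.mul'_eq hc, hD.linearMap_eq hc]
        exact hS.right }
  exact HopfAlgebra.antipode_mul_distrib (R := R) a b

theorem IsAntipode.comp_mul {S : A →ₗ[R] A} (hS : D.IsAntipode S) (hD : D.IsBialgebra)
    (hc : ∀ a b, D.mul (a ⊗ₜ[R] b) = D.mul (b ⊗ₜ[R] a)) :
    S ∘ₗ D.mul = D.mul ∘ₗ TensorProduct.map S S :=
  TensorProduct.ext' (hS.map_mul hD hc)

theorem IsAntipode.apply_unit {S : A →ₗ[R] A} (hS : D.IsAntipode S) (hD : D.IsBialgebra) (r : R) :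
    S (D.unit r) = D.unit r := by
  have h := LinearMap.congr_fun hS.left (D.unit 1)
  simp only [LinearMap.comp_apply, hD.comul_one, LinearMap.rTensor_tmul, hD.mul_one,
    hD.counit_one] at h
  have : r = r • (1 : R) := by simp
  rw [this, map_smul, map_smul, h]

/-- The antipode of a commutative bialgebra is an involution. -/
theorem IsAntipode.involutive {S : A →ₗ[R] A} (hS : D.IsAntipode S) (hD : D.IsBialgebra)
    (hc : ∀ a b, D.mul (a ⊗ₜ[R] b) = D.mul (b ⊗ₜ[R] a)) (a : A) : S (S a) = a := by
  -- Applying the multiplicative map S to the identity S * id = ηε gives (S ∘ S) * S = ηε. So S ∘ S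
  -- and id are a left and a right convolution inverse of S.
  have h1 : D.mul ∘ₗ TensorProduct.map (S ∘ₗ S) S ∘ₗ D.comul = D.unit ∘ₗ D.counit := by
    have h2 : TensorProduct.map (S ∘ₗ S) S = TensorProduct.map S S ∘ₗ S.rTensor A := by
      rw [LinearMap.rTensor, ← TensorProduct.map_comp, LinearMap.comp_id]
    refine LinearMap.ext fun x => ?_
    have h3 := LinearMap.congr_fun hS.left x
    simp only [LinearMap.comp_apply] at h3
    rw [h2]
    simp only [LinearMap.comp_apply]
    rw [← LinearMap.comp_apply D.mul, ← hS.comp_mul hD hc, LinearMap.comp_apply, h3,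
      hS.apply_unit hD]
  exact LinearMap.congr_fun (hD.convolution_inverse_unique hc (h := LinearMap.id) h1 hS.left) a

/-- A bialgebra endomorphism commutes with the antipode. -/
theorem IsAntipode.comm_of_isHom {S φ : A →ₗ[R] A} (hS : D.IsAntipode S) (hD : D.IsBialgebra)
    (hc : ∀ a b, D.mul (a ⊗ₜ[R] b) = D.mul (b ⊗ₜ[R] a)) (hφ : IsHom D D φ) (a : A) :
    S (φ a) = φ (S a) := by
  -- S ∘ φ is a left and φ ∘ S a right convolution inverse of φ.
  refine LinearMap.congr_fun (hD.convolution_inverse_unique hc (f := S ∘ₗ φ) (g := φ) (h := φ ∘ₗ S)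
    ?_ ?_) a
  · have h2 : TensorProduct.map (S ∘ₗ φ) φ = S.rTensor A ∘ₗ TensorProduct.map φ φ := by
      rw [LinearMap.rTensor, ← TensorProduct.map_comp, LinearMap.id_comp]
    refine LinearMap.ext fun x => ?_
    have h3 := LinearMap.congr_fun hS.left (φ x)
    simp only [LinearMap.comp_apply] at h3
    rw [h2]
    simp only [LinearMap.comp_apply]
    rw [hφ.map_comul, h3, ← hφ.map_counit x]
  · have h2 : TensorProduct.map φ (φ ∘ₗ S) = TensorProduct.map φ φ ∘ₗ S.lTensor A := by
      rw [LinearMap.lTensor, ← TensorProduct.map_comp, LinearMap.comp_id]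
    refine LinearMap.ext fun x => ?_
    have h3 := LinearMap.congr_fun hS.right x
    simp only [LinearMap.comp_apply] at h3
    rw [h2]
    simp only [LinearMap.comp_apply]
    rw [← hφ.map_mul, h3, hφ.map_unit]

end BialgData

/-! ## Adding a first block to a composition -/

namespace Composition

theorem index_val_eq {n : ℕ} (c : Composition n) (j : Fin n) (i : ℕ) (h1 : c.sizeUpTo i ≤ j)
    (h2 : (j : ℕ) < c.sizeUpTo (i + 1)) : (c.index j : ℕ) = i := by
  have h3 := c.sizeUpTo_index_le j
  have h4 := c.lt_sizeUpTo_index_succ j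
  rcases lt_trichotomy (c.index j : ℕ) i with h | h | h
  · exact absurd (c.monotone_sizeUpTo (Nat.succ_le_of_lt h)) (by simp at *; omega)
  · exact h
  · exact absurd (c.monotone_sizeUpTo (Nat.succ_le_of_lt h)) (by simp at *; omega)

/-- The composition with first block `k` and then the blocks of `c`. -/
def consBlock {k l n : ℕ} (hk : 0 < k) (h : k + l = n) (c : Composition l) : Composition n where
  blocks := k :: c.blocks
  blocks_pos := by
    intro i hi
    rcases List.mem_cons.1 hi with rfl | hi
    · exact hk
    · exact c.blocks_pos hi
  blocks_sum := by rw [List.sum_cons, c.blocks_sum, h]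

section

variable {k l n : ℕ} (hk : 0 < k) (h : k + l = n) (c : Composition l)

theorem consBlock_length : (c.consBlock hk h).length = c.length + 1 := rfl

theorem consBlock_sizeUpTo_succ (i : ℕ) :
    (c.consBlock hk h).sizeUpTo (i + 1) = k + c.sizeUpTo i := by
  simp [sizeUpTo, consBlock]

theorem consBlock_index_inl (i : Fin k) :
    ((c.consBlock hk h).index (GLInv.blockIx h (Sum.inl i)) : ℕ) = 0 := by
  refine index_val_eq _ _ _ (by simp) ?_
  rw [consBlock_sizeUpTo_succ]
  simp [GLInv.blockIx]

theorem consBlock_index_inr (i : Fin l) :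
    ((c.consBlock hk h).index (GLInv.blockIx h (Sum.inr i)) : ℕ) = c.index i + 1 := by
  have h1 := c.sizeUpTo_index_le i
  have h2 := c.lt_sizeUpTo_index_succ i
  refine index_val_eq _ _ _ ?_ ?_
  · rw [consBlock_sizeUpTo_succ]
    simpa [GLInv.blockIx] using h1
  · rw [consBlock_sizeUpTo_succ]
    simpa [GLInv.blockIx] using h2

theorem isBlockCons_consBlock :
    GLInv.IsBlockCons h (c.consBlock hk h).index c.index where
  inl_lt_inr i j := by
    rw [Fin.lt_def, consBlock_index_inl, consBlock_index_inr]
    omega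
  inl_eq_inl i j := by
    rw [Fin.ext_iff, consBlock_index_inl, consBlock_index_inl]
  inr_lt_inr i j := by
    rw [Fin.lt_def, Fin.lt_def, consBlock_index_inr, consBlock_index_inr]
    omega

end

/-- A nonempty composition is given by its first block and the remaining ones. -/
noncomputable def consEquiv {n : ℕ} (hn : n ≠ 0) :
    (Σ p : {p : {p : ℕ × ℕ // p ∈ Finset.HasAntidiagonal.antidiagonal n} // 0 < p.1.1},
      Composition p.1.1.2) ≃ Composition n :=
  Equiv.ofBijective (fun s => s.2.consBlock s.1.2
    (Finset.HasAntidiagonal.mem_antidiagonal.1 s.1.1.2)) <| by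
    constructor
    · rintro ⟨⟨⟨⟨k, l⟩, hp⟩, hk⟩, c⟩ ⟨⟨⟨⟨k', l'⟩, hp'⟩, hk'⟩, c'⟩ he
      have h1 : k :: c.blocks = k' :: c'.blocks := congrArg blocks he
      obtain ⟨rfl, h2⟩ := List.cons.inj h1
      have e1 : c.blocks.sum = l := c.blocks_sum
      have e2 : c'.blocks.sum = l' := c'.blocks_sum
      obtain rfl : l = l' := by rw [← e1, ← e2, h2]
      obtain rfl := Composition.ext h2
      rfl
    · rintro ⟨bl, hpos, hsum⟩
      cases bl with
      | nil => exact absurd hsum.symm hn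
      | cons k bl =>
        refine ⟨⟨⟨⟨(k, bl.sum), ?_⟩, hpos (List.mem_cons_self)⟩,
          ⟨bl, fun hi => hpos (List.mem_cons_of_mem _ hi), rfl⟩⟩, rfl⟩
        simpa using hsum

theorem sum_eq_sum_consBlock {M : Type*} [AddCommMonoid M] {n : ℕ} (hn : n ≠ 0)
    (φ : Composition n → M) :
    ∑ c, φ c = ∑ p ∈ (Finset.HasAntidiagonal.antidiagonal n).attach,
      if hp : 0 < p.1.1 then ∑ c : Composition p.1.2,
        φ (c.consBlock hp (Finset.HasAntidiagonal.mem_antidiagonal.1 p.2)) else 0 := by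
  classical
  rw [← (consEquiv hn).sum_comp, Fintype.sum_sigma]
  rw [← Finset.sum_filter_add_sum_filter_not (Finset.HasAntidiagonal.antidiagonal n).attach
    (fun p => 0 < p.1.1)]
  rw [Finset.sum_eq_zero (s := Finset.filter (fun p => ¬ 0 < p.1.1)
    (Finset.HasAntidiagonal.antidiagonal n).attach), add_zero]
  · refine Finset.sum_bij (fun p _ => p.1) ?_ ?_ ?_ ?_
    · intro p _
      simp [p.2]
    · intro p _ q _ hpq
      exact Subtype.ext hpq
    · intro p hp
      exact ⟨⟨p, (Finset.mem_filter.1 hp).2⟩, Finset.mem_univ _, rfl⟩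
    · intro p _
      rw [dif_pos p.2]
      rfl
  · intro p hp
    exact dif_neg (Finset.mem_filter.1 hp).2

end Composition

namespace GLInv

open Module BialgData
open scoped BigOperators

variable {F : Type*} [Field F] [Fintype F] [DecidableEq F]

/-! ### The antipode -/

variable (F) in
/-- The antipode in degree `n`. -/
noncomputable def antipodeComp (n : ℕ) : InvFun F n →ₗ[ℂ] InvFun F n :=
  ∑ c : Composition n, (-1 : ℂ) ^ c.length • hcIndRes F c.index

/-- The signs combine to (−1) to the number of blocks, the form suited to a recursion on the first
block. -/
theorem smul_dual (n : ℕ) : (-1 : ℂ) ^ n • dual F n = antipodeComp F n := by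
  rw [dual, antipodeComp, Finset.smul_sum]
  refine Finset.sum_congr rfl fun c _ => ?_
  rw [smul_smul]
  congr 1
  obtain ⟨m, hm⟩ := Nat.exists_eq_add_of_le c.length_le
  have h1 : n - c.length = m := by omega
  rw [h1]
  nth_rewrite 1 [hm]
  rw [pow_add, mul_assoc, ← mul_pow]
  simp

theorem antipodeC_incl (n : ℕ) (f : InvFun F n) :
    antipodeC F (incl F n f) = incl F n (antipodeComp F n f) := by
  rw [antipodeC, liftC_incl, ← smul_dual]
  simp

theorem mul_map_incl {k l n : ℕ} (h : k + l = n) (t : InvFun F k ⊗[ℂ] InvFun F l) :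
    (bialgC F).mul (TensorProduct.map (incl F k) (incl F l) t) = incl F n (mulComp h t) := by
  subst h
  induction t using TensorProduct.induction_on with
  | zero => simp
  | add s t hs ht => simp only [map_add, hs, ht]
  | tmul f g => rw [TensorProduct.map_tmul, mul_incl]

theorem lTensor_antipodeC_map_incl {k l : ℕ} (t : InvFun F k ⊗[ℂ] InvFun F l) :
    (antipodeC F).lTensor (C F) (TensorProduct.map (incl F k) (incl F l) t) =
      TensorProduct.map (incl F k) (incl F l) ((antipodeComp F l).lTensor (InvFun F k) t) := by
  induction t using TensorProduct.induction_on with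
  | zero => simp
  | add s t hs ht => simp only [map_add, hs, ht]
  | tmul f g =>
    rw [TensorProduct.map_tmul, LinearMap.lTensor_tmul, antipodeC_incl, LinearMap.lTensor_tmul,
      TensorProduct.map_tmul]

theorem mulComp_antipodeComp {k l n : ℕ} (h : k + l = n) (f : InvFun F n) :
    mulComp h ((antipodeComp F l).lTensor (InvFun F k) (comulComp h f)) =
      ∑ c : Composition l, (-1 : ℂ) ^ c.length •
        mulComp h ((hcIndRes F c.index).lTensor (InvFun F k) (comulComp h f)) := by
  have h1 : (antipodeComp F l).lTensor (InvFun F k) =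
      ∑ c : Composition l, (-1 : ℂ) ^ c.length • (hcIndRes F c.index).lTensor (InvFun F k) := by
    rw [antipodeComp, ← LinearMap.coe_lTensorHom, map_sum]
    simp only [map_smul]
  rw [h1, LinearMap.sum_apply, map_sum]
  simp only [LinearMap.smul_apply, map_smul]

/-- By induction in stages, the degree k term of id * S collects the compositions of n with first
block k; the extra block gives the sign. -/
theorem mulComp_antipodeComp_of_pos {k l n : ℕ} (h : k + l = n) (hk : 0 < k) (f : InvFun F n) :
    mulComp h ((antipodeComp F l).lTensor (InvFun F k) (comulComp h f)) =
      -∑ c : Composition l, (-1 : ℂ) ^ (c.consBlock hk h).length •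
        hcIndRes F (c.consBlock hk h).index f := by
  rw [mulComp_antipodeComp, ← Finset.sum_neg_distrib]
  refine Finset.sum_congr rfl fun c _ => ?_
  rw [(c.isBlockCons_consBlock hk h).hcIndRes_eq, c.consBlock_length, pow_succ,
    mul_neg_one]
  refine Subtype.ext (funext fun x => ?_)
  simp only [NegMemClass.coe_neg, Submodule.coe_smul, Pi.neg_apply, Pi.smul_apply, smul_eq_mul]
  ring

/-- The formula in stages holds with an empty first block, which adds no block to the composition;
hence no sign. -/
theorem mulComp_antipodeComp_zero {n : ℕ} (h : 0 + n = n) (f : InvFun F n) :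
    mulComp h ((antipodeComp F n).lTensor (InvFun F 0) (comulComp h f)) = antipodeComp F n f := by
  rw [mulComp_antipodeComp, antipodeComp, LinearMap.sum_apply]
  refine Finset.sum_congr rfl fun c _ => ?_
  have e : ∀ j : Fin n, blockIx h (Sum.inr j) = j := fun j => Fin.ext (by simp [blockIx])
  have hb : IsBlockCons h c.index c.index :=
    ⟨fun i => i.elim0, fun i => i.elim0, fun i j => by rw [e, e]⟩
  rw [LinearMap.smul_apply, hb.hcIndRes_eq]

theorem antipodeComp_zero (f : InvFun F 0) : antipodeComp F 0 f = f := by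
  classical
  have hl : ∀ c : Composition 0, (-1 : ℂ) ^ c.length • hcIndRes F c.index f = f := by
    intro c
    have h0 : c.length = 0 := c.length_eq_zero.2 rfl
    rw [show (-1 : ℂ) ^ c.length = 1 by rw [h0, pow_zero], one_smul]
    ext x
    rw [hcIndRes_apply]
    have hu : uniCard F c.index = 1 := by
      rw [uniCard_eq]
      exact Nat.card_eq_one_iff_unique.2 ⟨inferInstance, ⟨⟨0, fun i => i.elim0⟩⟩⟩
    have hp : parCard F c.index = 1 :=
      Nat.card_eq_one_iff_unique.2 ⟨inferInstance, ⟨⟨1, fun i => i.elim0⟩⟩⟩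
    have hbt : ∀ z : Mat F 0, z.BlockTriangular c.index := fun z i => i.elim0
    have hf : ∀ z : Mat F 0, f.1 z = f.1 x := fun z => congrArg _ (Subsingleton.elim _ _)
    have c1 : Fintype.card (GL (Fin 0) F) = 1 :=
      Fintype.card_eq_one_iff.2 ⟨1, fun g => Units.ext (Subsingleton.elim _ _)⟩
    have c2 : Fintype.card (NilRad F c.index) = 1 := by
      rw [← Nat.card_eq_fintype_card, ← uniCard_eq, hu]
    simp only [hu, hp, hbt, if_true, hf, Finset.sum_const, Finset.card_univ, c1, c2]
    simp
  rw [antipodeComp, LinearMap.sum_apply]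
  simp only [LinearMap.smul_apply, hl, Finset.sum_const, Finset.card_univ, composition_card]
  simp

/-- In degree n > 0 the k = 0 term of id * S is S itself, a signed sum over all compositions. The
terms with k > 0 are minus its parts sorted by the first block, so everything cancels. -/
theorem mul_lTensor_antipodeC (a : C F) :
    (bialgC F).mul ((antipodeC F).lTensor (C F) ((bialgC F).comul a)) =
      (bialgC F).unit ((bialgC F).counit a) := by
  induction a using C.induction with
  | zero => simp
  | add a b ha hb => simp only [map_add, ha, hb]
  | incl n f =>
    rw [comul_incl, map_sum, map_sum]
    have h1 : ∀ p ∈ (Finset.HasAntidiagonal.antidiagonal n).attach,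
        (bialgC F).mul ((antipodeC F).lTensor (C F)
          (TensorProduct.map (incl F p.1.1) (incl F p.1.2)
          (comulComp (Finset.HasAntidiagonal.mem_antidiagonal.1 p.2) f))) =
        incl F n (mulComp (Finset.HasAntidiagonal.mem_antidiagonal.1 p.2)
          ((antipodeComp F p.1.2).lTensor (InvFun F p.1.1)
            (comulComp (Finset.HasAntidiagonal.mem_antidiagonal.1 p.2) f))) := by
      intro p _
      rw [lTensor_antipodeC_map_incl, mul_map_incl]
    rw [Finset.sum_congr rfl h1, ← map_sum]
    by_cases hn : n = 0
    · subst hn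
      have h2 : (Finset.HasAntidiagonal.antidiagonal 0).attach =
          {⟨(0, 0), Finset.HasAntidiagonal.mem_antidiagonal.2 rfl⟩} := rfl
      rw [h2, Finset.sum_singleton, mulComp_antipodeComp_zero, antipodeComp_zero]
      have h3 : (bialgC F).counit (incl F 0 f) = f.1 0 := by
        change (comp F 0 (incl F 0 f)).1 0 = _
        rw [comp_incl]
      rw [h3]
      change _ = f.1 0 • incl F 0 (oneFun F 0)
      rw [← map_smul]
      congr 1
      ext x
      rw [Subsingleton.elim x 0]
      simp [oneFun]
    · have h3 : (bialgC F).counit (incl F n f) = 0 := by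
        change (comp F 0 (incl F n f)).1 0 = _
        rw [comp_incl_of_ne hn]
        rfl
      rw [h3, map_zero]
      have h4 : antipodeComp F n f = ∑ p ∈ (Finset.HasAntidiagonal.antidiagonal n).attach,
          if hp : 0 < p.1.1 then -mulComp (Finset.HasAntidiagonal.mem_antidiagonal.1 p.2)
          ((antipodeComp F p.1.2).lTensor (InvFun F p.1.1)
            (comulComp (Finset.HasAntidiagonal.mem_antidiagonal.1 p.2) f)) else 0 := by
        rw [antipodeComp, LinearMap.sum_apply, Composition.sum_eq_sum_consBlock hn]
        refine Finset.sum_congr rfl fun p _ => ?_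
        split_ifs with hp
        · rw [mulComp_antipodeComp_of_pos _ hp, neg_neg]
          rfl
        · rfl
      rw [← map_zero (incl F n)]
      congr 1
      let p₀ : {p // p ∈ Finset.HasAntidiagonal.antidiagonal n} :=
        ⟨(0, n), Finset.HasAntidiagonal.mem_antidiagonal.2 (zero_add n)⟩
      rw [← Finset.add_sum_erase _ _ (Finset.mem_attach _ p₀), mulComp_antipodeComp_zero, h4,
        ← Finset.add_sum_erase _ _ (Finset.mem_attach _ p₀), dif_neg (lt_irrefl 0), zero_add,
        ← Finset.sum_add_distrib]
      refine Finset.sum_eq_zero fun p hp => ?_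
      have hp0 : 0 < p.1.1 := by
        refine Nat.pos_of_ne_zero fun h0 => (Finset.mem_erase.1 hp).1 (Subtype.ext ?_)
        have := Finset.HasAntidiagonal.mem_antidiagonal.1 p.2
        exact Prod.ext h0 (by simp only [p₀]; omega)
      rw [dif_pos hp0, neg_add_cancel]

/-- `S` is the antipode of `C(q)`. -/
theorem isAntipode : (bialgC F).IsAntipode (antipodeC F) where
  right := LinearMap.ext mul_lTensor_antipodeC
  left := by
    refine LinearMap.ext fun a => ?_
    simp only [LinearMap.comp_apply]
    rw [← mul_lTensor_antipodeC]
    -- Cocommutativity together with commutativity converts one antipode identity into the other.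
    conv_lhs => rw [← comul_comm]
    generalize (bialgC F).comul a = t
    induction t using TensorProduct.induction_on with
    | zero => simp
    | add s t hs ht => simp only [map_add, hs, ht]
    | tmul x y =>
      rw [TensorProduct.comm_tmul, LinearMap.rTensor_tmul, LinearMap.lTensor_tmul, mul_comm']

theorem antipodeC_mul (t : C F ⊗[ℂ] C F) : antipodeC F ((bialgC F).mul t) =
    (bialgC F).mul (TensorProduct.map (antipodeC F) (antipodeC F) t) :=
  LinearMap.congr_fun (isAntipode.comp_mul isBialgebra mul_comm') t

theorem antipodeC_antipodeC (a : C F) : antipodeC F (antipodeC F a) = a :=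
  isAntipode.involutive isBialgebra mul_comm' a

/-- `C(q)` is a connected graded Hopf algebra. -/
theorem isConnectedGradedHopf : (bialgC F).IsConnectedGradedHopf (gradC F) := by
  refine isConnectedGradedHopf_of_basis (orbBasis F) Sigma.fst (fun n a => mem_gradC_iff n a)
    isBialgebra ⟨_, isAntipode⟩ repr_mul_degree (fun i j k h => ?_) (orbZero F)
    degree_eq_zero_iff unit_one_eq fun i hi => ?_
  · rw [repr_comul_basis] at h
    exact repr_mul_degree i j k h
  · rw [orbBasis_apply]
    change (comp F 0 _).1 0 = _
    rw [comp_incl_of_ne fun h => hi ((degree_eq_zero_iff i).1 h)]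
    rfl

/-! ### Self-adjointness of the antipode -/

/-- Substitute z + u for z and −u for u; 𝒫 is stable under translation by 𝒰. -/
theorem sum_blockTriangular_mul {n : ℕ} {α : Type*} [LinearOrder α] (b : Fin n → α)
    [DecidablePred fun z : Mat F n => z.BlockTriangular b] [Fintype (NilRad F b)]
    (f g : Mat F n → ℂ) :
    ∑ z, (if z.BlockTriangular b then ∑ u : NilRad F b, f (z + u.1) else 0) * g z =
      ∑ z, (if z.BlockTriangular b then ∑ u : NilRad F b, g (z + u.1) else 0) * f z := by
  have hadd : ∀ (z : Mat F n) (u : NilRad F b), z.BlockTriangular b →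
      (z + u.1).BlockTriangular b := fun z u hz i j hij => by
    rw [Matrix.add_apply, hz hij, u.2 i j hij.le, add_zero]
  have h1 : ∀ f g : Mat F n → ℂ,
      ∑ z, (if z.BlockTriangular b then ∑ u : NilRad F b, f (z + u.1) else 0) * g z =
      ∑ u : NilRad F b, ∑ z, if z.BlockTriangular b then f (z + u.1) * g z else 0 := by
    intro f g
    rw [Finset.sum_comm]
    refine Finset.sum_congr rfl fun z _ => ?_
    split_ifs
    · rw [Finset.sum_mul]
    · simp
  rw [h1, h1]
  let e : NilRad F b ≃ NilRad F b :=
    { toFun := fun u => ⟨-u.1, fun i j hij => by rw [Matrix.neg_apply, u.2 i j hij, neg_zero]⟩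
      invFun := fun u => ⟨-u.1, fun i j hij => by rw [Matrix.neg_apply, u.2 i j hij, neg_zero]⟩
      left_inv := fun u => Subtype.ext (neg_neg _)
      right_inv := fun u => Subtype.ext (neg_neg _) }
  refine Fintype.sum_equiv e _ _ fun u => Fintype.sum_equiv (Equiv.addRight u.1) _ _ fun z => ?_
  have h2 : (z + u.1).BlockTriangular b ↔ z.BlockTriangular b := by
    refine ⟨fun h => ?_, hadd z u⟩
    have := hadd _ (e u) h
    simpa [e] using this
  simp only [Equiv.coe_addRight, h2, e, Equiv.coe_fn_mk, add_neg_cancel_right, mul_comm]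

/-- Self-adjointness of induction after restriction: invariance removes the sum over GLₙ, leaving a
double sum over 𝒫 and 𝒰 that is symmetric in f and g. -/
theorem sum_hcIndRes_mul {n : ℕ} {α : Type*} [LinearOrder α] (b : Fin n → α) (f g : InvFun F n) :
    ∑ x, (hcIndRes F b f).1 x * g.1 x = ∑ x, (hcIndRes F b g).1 x * f.1 x := by
  classical
  have h1 : ∀ f g : InvFun F n, ∑ x, (hcIndRes F b f).1 x * g.1 x =
      (parCard F b : ℂ)⁻¹ * ((uniCard F b : ℂ)⁻¹ * (Fintype.card (GL (Fin n) F) *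
        ∑ z, (if z.BlockTriangular b then ∑ u : NilRad F b, f.1 (z + u.1) else 0) * g.1 z)) := by
    intro f g
    simp only [hcIndRes_apply, mul_assoc, Finset.sum_mul, ← Finset.mul_sum]
    congr 2
    rw [Finset.sum_comm, ← Finset.card_univ, ← nsmul_eq_mul, ← Finset.sum_const]
    refine Finset.sum_congr rfl fun a _ => ?_
    refine Fintype.sum_equiv ({ toFun := Ad a, invFun := Ad a⁻¹, left_inv := Ad_inv_Ad a,
                                right_inv := Ad_Ad_inv a } : Mat F n ≃ Mat F n) _ _ fun z => ?_
    exact congrArg (_ * ·) (g.2 a z).symm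
  rw [h1, h1, sum_blockTriangular_mul]

theorem form_antipodeC (a b : C F) : form F (antipodeC F a) b = form F a (antipodeC F b) := by
  induction a using C.induction with
  | zero => simp
  | add a a' ha ha' => simp only [map_add, LinearMap.add_apply, ha, ha']
  | incl m f =>
    induction b using C.induction with
    | zero => simp
    | add a a' ha ha' => simp only [map_add, ha, ha']
    | incl n g =>
      rw [antipodeC_incl, antipodeC_incl]
      by_cases h : m = n
      · subst h
        rw [form_incl, form_incl]
        congr 1
        simp only [antipodeComp, LinearMap.sum_apply, LinearMap.smul_apply, Submodule.coe_sum,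
          Submodule.coe_smul, Finset.sum_apply, Pi.smul_apply, smul_eq_mul, Finset.sum_mul,
          Finset.mul_sum]
        rw [Finset.sum_comm, Finset.sum_comm (s := Finset.univ (α := Mat F m))]
        refine Finset.sum_congr rfl fun c _ => ?_
        have := congrArg (fun s => (-1 : ℂ) ^ c.length * s) (sum_hcIndRes_mul c.index f g)
        simp only [Finset.mul_sum] at this
        simp only [mul_assoc]
        rw [this]
        exact Finset.sum_congr rfl fun x _ => by ring
      · rw [form_incl_of_ne h, form_incl_of_ne h]

/-- The adjoint of multiplicativity, as S is self-adjoint. No flip of the factors occurs since S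
preserves products in their order. -/
theorem antipodeC_comul (a : C F) :
    TensorProduct.map (antipodeC F) (antipodeC F) ((bialgC F).comul a) =
      (bialgC F).comul (antipodeC F a) := by
  have h : ∀ (c d : C F) (t : C F ⊗[ℂ] C F), form₂ F (c ⊗ₜ[ℂ] d)
      (TensorProduct.map (antipodeC F) (antipodeC F) t) =
        form₂ F (antipodeC F c ⊗ₜ[ℂ] antipodeC F d) t := by
    intro c d t
    induction t using TensorProduct.induction_on with
    | zero => simp
    | add s t hs ht => simp only [map_add, hs, ht]
    | tmul x y => rw [TensorProduct.map_tmul, form₂_tmul, form₂_tmul, form_antipodeC, form_antipodeC]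
  refine form₂_nondegenerate fun c d => ?_
  rw [h, ← form_mul, ← form_mul, ← form_antipodeC, antipodeC_mul, TensorProduct.map_tmul]

theorem antipodeC_unit (r : ℂ) : antipodeC F ((bialgC F).unit r) = (bialgC F).unit r :=
  isAntipode.apply_unit isBialgebra r

theorem form_unit (r : ℂ) (a : C F) : form F ((bialgC F).unit r) a = r * (bialgC F).counit a := by
  classical
  have h1 : (bialgC F).unit r = r • orbBasis F (orbZero F) := by
    rw [← unit_one_eq, ← map_smul, smul_eq_mul, mul_one]
  rw [h1, map_smul, LinearMap.smul_apply, smul_eq_mul, form_orbBasis]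
  congr 1
  have h2 : (orbBasis F).coord (orbZero F) = (bialgC F).counit := by
    refine (orbBasis F).ext fun i => ?_
    rw [Basis.coord_apply, Basis.repr_self, Finsupp.single_apply]
    split_ifs with hi
    · rw [hi, ← unit_one_eq, isBialgebra.counit_one]
    · exact (isConnectedGradedHopf.counit_eq_zero i.1
        (fun h => hi ((degree_eq_zero_iff i).1 h)) _ (by rw [orbBasis_apply]; exact ⟨_, rfl⟩)).symm
  exact LinearMap.congr_fun h2 a

theorem counit_antipodeC (a : C F) : (bialgC F).counit (antipodeC F a) = (bialgC F).counit a := by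
  have h := form_unit 1 (antipodeC F a)
  rw [← form_antipodeC, antipodeC_unit, form_unit, one_mul, one_mul] at h
  exact h.symm

/-- The antipode is a bialgebra endomorphism. -/
theorem isHom_antipodeC : IsHom (bialgC F) (bialgC F) (antipodeC F) where
  map_mul := antipodeC_mul
  map_unit := antipodeC_unit
  map_comul := antipodeC_comul
  map_counit a := (counit_antipodeC a).symm

end GLInv

namespace GLInv

open Module BialgData
open scoped BigOperators

variable {F : Type*} [Field F] [Fintype F] [DecidableEq F]

/-! ### The Fourier transform -/

section Char

variable (F) in
/-- A nontrivial additive character of `F`. -/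
noncomputable def psi : AddChar F ℂ := AddChar.FiniteField.primitiveChar_to_Complex F

theorem psi_neg (t : F) : psi F (-t) = starRingEnd ℂ (psi F t) :=
  AddChar.map_neg_eq_conj _ _

open Classical in
-- u ↦ ψ(tr(u c)) is an additive character, trivial only for c = 0 because the trace pairing is
-- nondegenerate and ψ is nontrivial.
theorem sum_psi_trace {k l : ℕ} (c : Matrix (Fin l) (Fin k) F) :
    ∑ u : Matrix (Fin k) (Fin l) F, psi F (u * c).trace =
      if c = 0 then (Fintype.card (Matrix (Fin k) (Fin l) F) : ℂ) else 0 := by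
  let χ : AddChar (Matrix (Fin k) (Fin l) F) ℂ :=
    { toFun := fun u => psi F (u * c).trace
      map_zero_eq_one' := by simp
      map_add_eq_mul' := fun a b => by
        rw [Matrix.add_mul, Matrix.trace_add, AddChar.map_add_eq_mul] }
  have h : χ = 0 ↔ c = 0 := by
    constructor
    · intro hχ
      by_contra hc
      obtain ⟨i, j, hij⟩ : ∃ i j, c i j ≠ 0 := by
        by_contra hcon
        push Not at hcon
        exact hc (Matrix.ext hcon)
      refine (AddChar.FiniteField.primitiveChar_to_Complex_isPrimitive (F := F)
        (one_ne_zero)) ?_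
      ext t
      -- This multiple of a matrix unit has product with c of trace t, so triviality of χ would make
      -- ψ trivial.
      have h1 := DFunLike.congr_fun hχ (Matrix.single j i (t * (c i j)⁻¹))
      have h2 : χ (Matrix.single j i (t * (c i j)⁻¹)) = psi F t := by
        change psi F (Matrix.single j i (t * (c i j)⁻¹) * c).trace = _
        rw [Matrix.trace_single_mul]
        congr 1
        simp [hij]
      rw [h2] at h1
      simpa [AddChar.mulShift_apply, psi] using h1
    · rintro rfl
      ext u
      change psi F (u * (0 : Matrix (Fin l) (Fin k) F)).trace = 1
      simp
  have h1 := χ.sum_eq_ite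
  simp only [h] at h1
  exact h1

end Char

variable (F) in
/-- The Fourier transform on `Cₙ(q)`, without normalisation. -/
noncomputable def fhat (n : ℕ) : InvFun F n →ₗ[ℂ] InvFun F n where
  toFun f := ⟨fun x => ∑ y, f.1 y * psi F (x * y).trace, fun g x => by
    refine (Fintype.sum_equiv ({ toFun := Ad g, invFun := Ad g⁻¹, left_inv := Ad_inv_Ad g,
                                 right_inv := Ad_Ad_inv g } : Mat F n ≃ Mat F n) _ _ fun y => ?_).symm
    have h1 : Ad g x * Ad g y = Ad g (x * y) := by simp [Ad, Matrix.mul_assoc]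
    have h2 : (Ad g (x * y)).trace = (x * y).trace := by
      rw [Ad, Matrix.trace_mul_comm, ← Matrix.mul_assoc]
      simp
    rw [Equiv.coe_fn_mk, f.2 g y, h1, h2]⟩
  map_add' f g := by
    ext x
    simp [add_mul, Finset.sum_add_distrib]
  map_smul' c f := by
    ext x
    simp [Finset.mul_sum, mul_assoc]

theorem fhat_apply {n : ℕ} (f : InvFun F n) (x : Mat F n) :
    (fhat F n f).1 x = ∑ y, f.1 y * psi F (x * y).trace := rfl

theorem sum_fhat_mul {n : ℕ} (f g : InvFun F n) :
    ∑ x, (fhat F n f).1 x * g.1 x = ∑ x, f.1 x * (fhat F n g).1 x := by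
  simp only [fhat_apply, Finset.sum_mul, Finset.mul_sum]
  rw [Finset.sum_comm]
  refine Finset.sum_congr rfl fun x _ => Finset.sum_congr rfl fun y _ => ?_
  rw [Matrix.trace_mul_comm]
  ring

theorem fhat_fhat {n : ℕ} (f : InvFun F n) (x : Mat F n) :
    (fhat F n (fhat F n f)).1 x = Fintype.card (Mat F n) * f.1 (-x) := by
  classical
  simp only [fhat_apply, Finset.sum_mul]
  rw [Finset.sum_comm]
  have h : ∀ z : Mat F n, ∑ y, f.1 z * psi F (y * z).trace * psi F (x * y).trace =
      if z = -x then Fintype.card (Mat F n) * f.1 (-x) else 0 := by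
    intro z
    have h1 : ∀ y : Mat F n, f.1 z * psi F (y * z).trace * psi F (x * y).trace =
        f.1 z * psi F (y * (z + x)).trace := by
      intro y
      rw [mul_assoc, ← AddChar.map_add_eq_mul, Matrix.trace_mul_comm x y, ← Matrix.trace_add,
        ← Matrix.mul_add]
    rw [Finset.sum_congr rfl fun y _ => h1 y, ← Finset.mul_sum, sum_psi_trace]
    simp only [← eq_neg_iff_add_eq_zero]
    split_ifs with hz
    · rw [hz, mul_comm]
    · simp
  rw [Finset.sum_congr rfl fun z _ => h z]
  simp

variable (F) in
/-- The square root of `|𝔤𝔩ₙ(F)|`. -/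
noncomputable def sqrtCard (n : ℕ) : ℝ := Real.sqrt (Fintype.card (Mat F n))

theorem sqrtCard_pos (n : ℕ) : 0 < sqrtCard F n :=
  Real.sqrt_pos.2 (Nat.cast_pos.2 Fintype.card_pos)

theorem sqrtCard_ne (n : ℕ) : (sqrtCard F n : ℂ) ≠ 0 :=
  Complex.ofReal_ne_zero.2 (sqrtCard_pos n).ne'

theorem sqrtCard_sq (n : ℕ) : (sqrtCard F n : ℂ) * sqrtCard F n = Fintype.card (Mat F n) := by
  rw [← Complex.ofReal_mul, sqrtCard, Real.mul_self_sqrt (Nat.cast_nonneg _)]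
  simp

/-- From (k + l)² = k² + l² + 2kl: the square root leaves exactly one factor |Hom|, the one by which
the unnormalised transform fails to commute with restriction. -/
theorem sqrtCard_mul {k l n : ℕ} (h : k + l = n) : (sqrtCard F n : ℂ) =
    sqrtCard F k * sqrtCard F l * Nat.card (Matrix (Fin k) (Fin l) F) := by
  rw [← Complex.ofReal_natCast, ← Complex.ofReal_mul, ← Complex.ofReal_mul, Complex.ofReal_inj]
  refine (Real.sqrt_eq_iff_mul_self_eq (Nat.cast_nonneg _) ?_).2 ?_
  · have := sqrtCard_pos (F := F) k
    have := sqrtCard_pos (F := F) l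
    positivity
  · have h1 : ∀ m, sqrtCard F m * sqrtCard F m = Fintype.card (Mat F m) := fun m =>
      Real.mul_self_sqrt (Nat.cast_nonneg _)
    have h2 : ∀ a b c : ℝ, a * b * c * (a * b * c) = (a * a) * (b * b) * (c * c) := by
      intros
      ring
    rw [h2, h1, h1, Nat.card_eq_fintype_card]
    have h3 : ∀ a b : ℕ, Fintype.card (Matrix (Fin a) (Fin b) F) = Fintype.card F ^ (a * b) :=
      fun a b => by
        rw [← Nat.card_eq_fintype_card, Matrix, Nat.card_eq_fintype_card]
        simp [pow_mul']
    rw [h3, h3, h3, h3]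
    push_cast
    subst h
    ring

/-- The Fourier transform on `C(q)`. -/
noncomputable def fourierC : C F →ₗ[ℂ] C F :=
  liftC fun n => (sqrtCard F n : ℂ)⁻¹ • (incl F n ∘ₗ fhat F n)

theorem fourierC_incl (n : ℕ) (f : InvFun F n) :
    fourierC (incl F n f) = incl F n ((sqrtCard F n : ℂ)⁻¹ • fhat F n f) := by
  rw [fourierC, liftC_incl]
  simp

theorem form_fourierC (a b : C F) : form F (fourierC a) b = form F a (fourierC b) := by
  induction a using C.induction with
  | zero => simp
  | add a a' ha ha' => simp only [map_add, LinearMap.add_apply, ha, ha']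
  | incl m f =>
    induction b using C.induction with
    | zero => simp
    | add a a' ha ha' => simp only [map_add, ha, ha']
    | incl n g =>
      rw [fourierC_incl, fourierC_incl]
      by_cases h : m = n
      · subst h
        simp only [map_smul, LinearMap.smul_apply]
        rw [form_incl, form_incl, sum_fhat_mul]
      · rw [form_incl_of_ne h, form_incl_of_ne h]

/-- The square of the transform is f ↦ f(−·), so its fourth power is the identity. -/
theorem fourierC_bijective : Function.Bijective (fourierC (F := F)) := by
  have h4 : ∀ a : C F, fourierC (fourierC (fourierC (fourierC a))) = a := by
    intro a
    induction a using C.induction with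
    | zero => simp
    | add a b ha hb => simp only [map_add, ha, hb]
    | incl n f =>
      simp only [fourierC_incl, map_smul, smul_smul]
      rw [← map_smul]
      congr 1
      refine Subtype.ext (funext fun x => ?_)
      simp only [Submodule.coe_smul, Pi.smul_apply, smul_eq_mul, fhat_fhat, neg_neg]
      rw [← sqrtCard_sq]
      have := sqrtCard_ne (F := F) n
      field_simp
  exact ⟨fun a b hab => by rw [← h4 a, hab, h4], fun a => ⟨_, h4 a⟩⟩

/-! ### Compatibility of the Fourier transform with restriction -/

section Comul

variable {k l n : ℕ} (h : k + l = n)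

theorem boxEquiv_map_fhat (t : InvFun F k ⊗[ℂ] InvFun F l) (X : Mat F k) (Y : Mat F l) :
    (boxEquiv F k l (TensorProduct.map (fhat F k) (fhat F l) t)).1 (X, Y) =
      ∑ a, ∑ d, (boxEquiv F k l t).1 (a, d) * (psi F (X * a).trace * psi F (Y * d).trace) := by
  induction t using TensorProduct.induction_on with
  | zero =>
    rw [LinearMap.map_zero, LinearEquiv.map_zero]
    simp
  | add s t hs ht =>
    simp only [LinearMap.map_add, LinearEquiv.map_add, Submodule.coe_add, Pi.add_apply, hs, ht,
      add_mul, Finset.sum_add_distrib]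
  | tmul f g =>
    rw [TensorProduct.map_tmul]
    change (fhat F k f).1 X * (fhat F l g).1 Y = ∑ a, ∑ d, f.1 a * g.1 d * _
    rw [fhat_apply, fhat_apply, Finset.sum_mul_sum]
    exact Finset.sum_congr rfl fun a _ => Finset.sum_congr rfl fun d _ => by ring

open Classical in
-- The trace pairing splits into the two diagonal parts and tr(u c), with c the lower left block of
-- z. Summing over u kills all z with c ≠ 0: 𝒫 is the orthogonal of 𝒰.
theorem sum_psi_blockUpper (X : Mat F k) (Y : Mat F l) (z : Mat F n) :
    ∑ u, psi F (blockUpper h (X, Y, u) * z).trace = if z.BlockTriangular (twoBlock h) then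
      (Nat.card (Matrix (Fin k) (Fin l) F) : ℂ) *
        (psi F (X * (blocks h z).1).trace * psi F (Y * (blocks h z).2).trace) else 0 := by
  let c : Matrix (Fin l) (Fin k) F := z.submatrix (blockIx h ∘ Sum.inr) (blockIx h ∘ Sum.inl)
  have h1 : ∀ u, (blockUpper h (X, Y, u) * z).trace =
      (X * (blocks h z).1).trace + (Y * (blocks h z).2).trace + (u * c).trace := by
    intro u
    simp only [Matrix.trace, Matrix.diag_apply, Matrix.mul_apply]
    simp only [← (blockIx h).sum_comp, Fintype.sum_sum_type]
    simp only [blockUpper, blocks, c, Matrix.reindex_apply, Matrix.submatrix_apply,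
      Equiv.symm_apply_apply, Matrix.fromBlocks_apply₁₁, Matrix.fromBlocks_apply₁₂,
      Matrix.fromBlocks_apply₂₁, Matrix.fromBlocks_apply₂₂, Matrix.zero_apply, zero_mul,
      Finset.sum_const_zero, zero_add, Function.comp_apply, Finset.sum_add_distrib]
    ring
  have h2 : z.BlockTriangular (twoBlock h) ↔ c = 0 := by
    rw [blockTriangular_twoBlock_iff]
    exact Matrix.ext_iff
  simp only [h1, AddChar.map_add_eq_mul]
  rw [← Finset.mul_sum, sum_psi_trace]
  simp only [h2, Nat.card_eq_fintype_card, mul_ite, mul_zero]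
  congr 1
  ring

theorem comulComp_fhat (f : InvFun F n) :
    TensorProduct.map (fhat F k) (fhat F l) (comulComp h f) =
      (Nat.card (Matrix (Fin k) (Fin l) F) : ℂ)⁻¹ • comulComp h (fhat F n f) := by
  classical
  refine (boxEquiv F k l).injective (Subtype.ext (funext fun p => ?_))
  obtain ⟨X, Y⟩ := p
  rw [map_smul]
  change _ = (Nat.card (Matrix (Fin k) (Fin l) F) : ℂ)⁻¹ * (boxEquiv F k l _).1 (X, Y)
  rw [boxEquiv_map_fhat, boxEquiv_comulComp]
  simp only [boxEquiv_comulComp, fhat_apply]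
  rw [Finset.sum_comm (s := Finset.univ (α := Matrix (Fin k) (Fin l) F))]
  simp only [← Finset.mul_sum, sum_psi_blockUpper]
  have h1 : ∀ z : Mat F n, f.1 z * (if z.BlockTriangular (twoBlock h) then
      (Nat.card (Matrix (Fin k) (Fin l) F) : ℂ) *
        (psi F (X * (blocks h z).1).trace * psi F (Y * (blocks h z).2).trace) else 0) =
      (Nat.card (Matrix (Fin k) (Fin l) F) : ℂ) *
        (if z.BlockTriangular (twoBlock h) then f.1 z *
        (psi F (X * (blocks h z).1).trace * psi F (Y * (blocks h z).2).trace) else 0) := by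
    intro z
    split_ifs
    · ring
    · simp
  simp only [h1]
  rw [← Finset.mul_sum, sum_blockTriangular]
  simp only [blocks_blockUpper]
  have hM : (Nat.card (Matrix (Fin k) (Fin l) F) : ℂ) ≠ 0 := Nat.cast_ne_zero.2 Nat.card_pos.ne'
  rw [inv_mul_cancel_left₀ hM, Finset.mul_sum]
  refine Finset.sum_congr rfl fun a _ => ?_
  rw [Finset.mul_sum]
  refine Finset.sum_congr rfl fun d _ => ?_
  rw [mul_assoc, Finset.sum_mul]

end Comul

theorem map_fourierC_map_incl {k l : ℕ} (t : InvFun F k ⊗[ℂ] InvFun F l) :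
    TensorProduct.map fourierC fourierC (TensorProduct.map (incl F k) (incl F l) t) =
      ((sqrtCard F k : ℂ)⁻¹ * (sqrtCard F l : ℂ)⁻¹) •
        TensorProduct.map (incl F k) (incl F l) (TensorProduct.map (fhat F k) (fhat F l) t) := by
  induction t using TensorProduct.induction_on with
  | zero => simp
  | add s t hs ht => simp only [map_add, hs, ht, smul_add]
  | tmul f g =>
    simp only [TensorProduct.map_tmul, fourierC_incl, map_smul, TensorProduct.smul_tmul_smul]

theorem fourierC_comul (a : C F) :
    TensorProduct.map fourierC fourierC ((bialgC F).comul a) = (bialgC F).comul (fourierC a) := by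
  induction a using C.induction with
  | zero => simp
  | add a b ha hb => simp only [map_add, ha, hb]
  | incl n f =>
    rw [fourierC_incl, map_smul, map_smul, comul_incl, comul_incl, map_sum, Finset.smul_sum]
    refine Finset.sum_congr rfl fun p _ => ?_
    have hp := Finset.HasAntidiagonal.mem_antidiagonal.1 p.2
    rw [map_fourierC_map_incl, comulComp_fhat, map_smul, smul_smul, sqrtCard_mul hp, mul_inv,
      mul_inv]

/-- A self-adjoint coalgebra endomorphism is a bialgebra endomorphism. -/
theorem isHom_of_self_adjoint {φ : C F →ₗ[ℂ] C F}
    (hform : ∀ a b, form F (φ a) b = form F a (φ b))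
    (hcomul : ∀ a, TensorProduct.map φ φ ((bialgC F).comul a) = (bialgC F).comul (φ a))
    (hunit : φ ((bialgC F).unit 1) = (bialgC F).unit 1) : IsHom (bialgC F) (bialgC F) φ where
  map_mul t := by
    have h : ∀ s t : C F ⊗[ℂ] C F, form₂ F (TensorProduct.map φ φ s) t =
        form₂ F s (TensorProduct.map φ φ t) := by
      intro s t
      induction s using TensorProduct.induction_on with
      | zero => simp
      | add s s' hs hs' => simp only [map_add, LinearMap.add_apply, hs, hs']
      | tmul x y =>
        induction t using TensorProduct.induction_on with
        | zero => simp
        | add s t hs ht => simp only [map_add, hs, ht]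
        | tmul z w => simp only [TensorProduct.map_tmul, form₂_tmul, hform]
    refine form_nondegenerate fun c => ?_
    rw [form_comm, form_comm c, hform, form_mul, form_mul, h, hcomul]
  map_unit r := by
    rw [← mul_one r, ← smul_eq_mul, map_smul, map_smul, hunit]
  map_comul := hcomul
  map_counit a := by
    have h := form_unit 1 (φ a)
    rw [← hform, hunit, form_unit, one_mul, one_mul] at h
    exact h

theorem isHom_fourierC : IsHom (bialgC F) (bialgC F) fourierC := by
  refine isHom_of_self_adjoint form_fourierC fourierC_comul ?_
  have h : (bialgC F).unit 1 = incl F 0 (oneFun F 0) := by simp [bialgC]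
  rw [h, fourierC_incl]
  congr 1
  refine Subtype.ext (funext fun x => ?_)
  have h1 : Fintype.card (Mat F 0) = 1 := Fintype.card_eq_one_iff.2 ⟨0, fun _ => Subsingleton.elim _ _⟩
  have h2 : ∀ y : Mat F 0, (x * y).trace = 0 := fun y => by simp [Matrix.trace]
  simp only [Submodule.coe_smul, Pi.smul_apply, smul_eq_mul, fhat_apply, oneFun, h2, sqrtCard, h1,
    AddChar.map_zero_eq_one, Finset.sum_const, Finset.card_univ]
  simp

theorem antipodeC_fourierC (a : C F) : antipodeC F (fourierC a) = fourierC (antipodeC F a) :=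
  isAntipode.comm_of_isHom isBialgebra mul_comm' isHom_fourierC a

/-- The Fourier transform followed by the antipode. -/
noncomputable def twistEquiv : C F ≃ₗ[ℂ] C F :=
  LinearEquiv.ofBijective (antipodeC F ∘ₗ fourierC)
    ((Function.Involutive.bijective antipodeC_antipodeC).comp fourierC_bijective)

theorem isHom_twistEquiv : IsHom (bialgC F) (bialgC F) (twistEquiv (F := F)).toLinearMap where
  map_mul t := by
    change antipodeC F (fourierC ((bialgC F).mul t)) = _
    rw [isHom_fourierC.map_mul, isHom_antipodeC.map_mul]
    exact congrArg _ (LinearMap.congr_fun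
      (TensorProduct.map_comp (antipodeC F) (antipodeC F) fourierC fourierC) t).symm
  map_unit r := by
    change antipodeC F (fourierC ((bialgC F).unit r)) = _
    rw [isHom_fourierC.map_unit, isHom_antipodeC.map_unit]
  map_comul a := by
    change _ = (bialgC F).comul (antipodeC F (fourierC a))
    rw [← isHom_antipodeC.map_comul, ← isHom_fourierC.map_comul]
    exact LinearMap.congr_fun (TensorProduct.map_comp (antipodeC F) (antipodeC F) fourierC fourierC)
      ((bialgC F).comul a)
  map_counit a := by
    change _ = (bialgC F).counit (antipodeC F (fourierC a))
    rw [← isHom_antipodeC.map_counit, ← isHom_fourierC.map_counit]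

end GLInv

namespace GLInv

open Module BialgData
open scoped BigOperators

variable {F : Type*} [Field F] [Fintype F] [DecidableEq F]

/-! ### Invariant characters -/

section Characters

variable {n : ℕ}

/-- The function takes values in the natural numbers. -/
def IsNatValued (m : InvFun F n) : Prop := ∀ x, ∃ k : ℕ, m.1 x = k

/-- The averaging operator is a projection onto the invariants, so its trace is their dimension. -/
theorem exists_nat_average {G : Type*} [Group G] [Fintype G] {d : ℕ}
    (ρ : Representation ℂ G (Fin d → ℂ)) :
    ∃ k : ℕ, ∑ g, LinearMap.trace ℂ (Fin d → ℂ) (ρ g) = Fintype.card G * k := by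
  have hG : (Fintype.card G : ℂ) ≠ 0 := Nat.cast_ne_zero.2 Fintype.card_ne_zero
  let : Invertible (Fintype.card G : ℂ) := invertibleOfNonzero hG
  refine ⟨finrank ℂ ρ.invariants, ?_⟩
  have h1 := ρ.isProj_averageMap.trace
  have h2 : ρ.averageMap = (Fintype.card G : ℂ)⁻¹ • ∑ g, ρ g := by
    rw [Representation.averageMap, GroupAlgebra.average, map_smul, map_sum, invOf_eq_inv]
    congr 1
    refine Finset.sum_congr rfl fun g _ => ?_
    simp
  rw [h2, map_smul, map_sum, smul_eq_mul] at h1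
  rw [← h1, mul_inv_cancel_left₀ hG]

variable (F n) in
theorem cardMat_ne : (Fintype.card (Mat F n) : ℂ) ≠ 0 := Nat.cast_ne_zero.2 Fintype.card_ne_zero

theorem fhat_injective : Function.Injective (fhat F n) := by
  intro f g hfg
  refine Subtype.ext (funext fun x => ?_)
  have h := congrArg (fun φ => (fhat F n φ).1 (-x)) hfg
  simp only [fhat_fhat, neg_neg] at h
  exact mul_left_cancel₀ (cardMat_ne F n) h

/-- Fourier inversion. When χ is a character, m(x) is the multiplicity of y ↦ ψ(tr(x y)) in it. -/
theorem exists_eq_fhat (χ : InvFun F n) : ∃ m : InvFun F n, χ = fhat F n m ∧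
    ∀ x, m.1 x = (Fintype.card (Mat F n) : ℂ)⁻¹ * ∑ y, χ.1 y * psi F (-(x * y).trace) := by
  let neg : InvFun F n := ⟨fun x => χ.1 (-x), fun g x => by
    have : -Ad g x = Ad g (-x) := by simp [Ad]
    change χ.1 (-Ad g x) = χ.1 (-x)
    rw [this, χ.2]⟩
  have h1 : ∀ x, (fhat F n neg).1 x = ∑ y, χ.1 y * psi F (-(x * y).trace) := by
    intro x
    rw [fhat_apply]
    refine Fintype.sum_equiv (Equiv.neg _) _ _ fun y => ?_
    simp [neg]
  refine ⟨(Fintype.card (Mat F n) : ℂ)⁻¹ • fhat F n neg, ?_, fun x => ?_⟩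
  · rw [map_smul]
    refine Subtype.ext (funext fun x => ?_)
    rw [Submodule.coe_smul, Pi.smul_apply, fhat_fhat, smul_eq_mul,
      inv_mul_cancel_left₀ (cardMat_ne F n)]
    simp [neg]
  · rw [Submodule.coe_smul, Pi.smul_apply, h1, smul_eq_mul]

/-- In one direction, m(x) is the dimension of the invariants of ρ twisted by the inverse of y ↦
ψ(tr(x y)). In the other, the diagonal representation containing each such character m(x) times has
the required trace. -/
theorem isInvChar_iff (χ : InvFun F n) :
    IsInvChar χ ↔ ∃ m : InvFun F n, IsNatValued m ∧ χ = fhat F n m := by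
  constructor
  · rintro ⟨d, ρ, hρ⟩
    obtain ⟨m, hm, hm'⟩ := exists_eq_fhat χ
    refine ⟨m, fun x => ?_, hm⟩
    let ρ' : Representation ℂ (Multiplicative (Mat F n)) (Fin d → ℂ) :=
      { toFun := fun y => psi F (-(x * y.toAdd).trace) • ρ y
        map_one' := by simp
        map_mul' := fun y z => by
          rw [toAdd_mul, mul_add, Matrix.trace_add, neg_add, AddChar.map_add_eq_mul, map_mul,
            smul_mul_smul_comm] }
    obtain ⟨k, hk⟩ := exists_nat_average ρ'
    refine ⟨k, ?_⟩
    have h1 : ∑ y, χ.1 y * psi F (-(x * y).trace) = Fintype.card (Mat F n) * k := by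
      rw [show Fintype.card (Mat F n) = Fintype.card (Multiplicative (Mat F n)) from
        (Fintype.card_multiplicative _).symm, ← hk]
      refine Fintype.sum_equiv Multiplicative.ofAdd _ _ fun y => ?_
      change _ = LinearMap.trace ℂ _ (psi F (-(x * y).trace) • ρ (Multiplicative.ofAdd y))
      rw [map_smul, smul_eq_mul, hρ, mul_comm]
    rw [hm', h1, inv_mul_cancel_left₀ (cardMat_ne F n)]
  · rintro ⟨m, hm, rfl⟩
    choose k hk using hm
    let e := (Fintype.equivFin (Σ x, Fin (k x))).symm
    refine ⟨Fintype.card (Σ x, Fin (k x)),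
      { toFun := fun y => Matrix.toLin' (Matrix.diagonal fun i => psi F ((e i).1 * y.toAdd).trace)
        map_one' := by
          simp only [toAdd_one, mul_zero, Matrix.trace_zero, AddChar.map_zero_eq_one,
            Matrix.diagonal_one, Matrix.toLin'_one]
          rfl
        map_mul' := fun y z => by
          rw [Module.End.mul_eq_comp, ← Matrix.toLin'_mul, Matrix.diagonal_mul_diagonal]
          simp only [toAdd_mul, mul_add, Matrix.trace_add, AddChar.map_add_eq_mul] }, fun y => ?_⟩
    change _ = LinearMap.trace ℂ _ (Matrix.toLin' (Matrix.diagonal fun i =>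
      psi F ((e i).1 * y).trace))
    rw [Matrix.trace_toLin'_eq, Matrix.trace_diagonal, e.sum_comp fun s => psi F (s.1 * y).trace,
      Fintype.sum_sigma, fhat_apply]
    refine Finset.sum_congr rfl fun x _ => ?_
    change _ = ∑ _j : Fin (k x), psi F (x * y).trace
    rw [hk, Finset.sum_const, Finset.card_univ, Fintype.card_fin, nsmul_eq_mul,
      Matrix.trace_mul_comm]

theorem orbInd_apply_self (x : Mat F n) : (orbInd x).1 x = 1 := if_pos ⟨1, (Ad_one x).symm⟩

theorem orbInd_eq_zero_or (x y : Mat F n) :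
    (orbInd x).1 y = 0 ∨ ((orbInd x).1 y = 1 ∧ ∃ g : GL (Fin n) F, y = Ad g x) := by
  by_cases h : ∃ g : GL (Fin n) F, y = Ad g x
  · exact Or.inr ⟨if_pos h, h⟩
  · exact Or.inl (if_neg h)

theorem isNatValued_orbInd (x : Mat F n) : IsNatValued (orbInd x) := fun y => by
  rcases orbInd_eq_zero_or x y with h | ⟨h, -⟩
  · exact ⟨0, by rw [h, Nat.cast_zero]⟩
  · exact ⟨1, by rw [h, Nat.cast_one]⟩

theorem IsNatValued.sub_orbInd {m : InvFun F n} (hm : IsNatValued m) {x : Mat F n}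
    (hx : m.1 x ≠ 0) : IsNatValued (m - orbInd x) := fun y => by
  obtain ⟨k, hk⟩ := hm y
  rcases orbInd_eq_zero_or x y with h | ⟨h, g, rfl⟩
  · exact ⟨k, by rw [Submodule.coe_sub, Pi.sub_apply, h, hk, sub_zero]⟩
  · refine ⟨k - 1, ?_⟩
    have : k ≠ 0 := by
      rintro rfl
      rw [m.2] at hk
      exact hx (by rw [hk, Nat.cast_zero])
    rw [Submodule.coe_sub, Pi.sub_apply, h, hk, Nat.cast_sub (Nat.one_le_iff_ne_zero.2 this),
      Nat.cast_one]

theorem exists_apply_ne_zero {m : InvFun F n} (hm : m ≠ 0) : ∃ x, m.1 x ≠ 0 := by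
  by_contra h
  push Not at h
  exact hm (Subtype.ext (funext h))

/-- Through the Fourier transform, invariant characters form the monoid of natural-valued functions
constant on orbits. It is free on the orbit indicators, which are therefore its indecomposable
elements. -/
theorem isIrrInvChar_iff (χ : InvFun F n) :
    IsIrrInvChar χ ↔ ∃ x : Mat F n, χ = fhat F n (orbInd x) := by
  constructor
  · rintro ⟨hχ, h0, hirr⟩
    obtain ⟨m, hm, rfl⟩ := (isInvChar_iff χ).1 hχ
    have hm0 : m ≠ 0 := by
      rintro rfl
      exact h0 (map_zero _)
    obtain ⟨x, hx⟩ := exists_apply_ne_zero hm0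
    refine ⟨x, ?_⟩
    by_contra hne
    refine hirr ⟨fhat F n (orbInd x), fhat F n (m - orbInd x),
      (isInvChar_iff _).2 ⟨_, isNatValued_orbInd x, rfl⟩,
      (isInvChar_iff _).2 ⟨_, hm.sub_orbInd hx, rfl⟩, fun h => ?_, fun h => ?_, ?_⟩
    · have h1 := fhat_injective (h.trans (map_zero _).symm)
      have h2 := orbInd_apply_self x
      rw [h1] at h2
      exact zero_ne_one h2
    · rw [map_sub] at h
      exact hne (sub_eq_zero.1 h)
    · rw [map_sub, add_sub_cancel]
  · rintro ⟨x, rfl⟩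
    have h1 := orbInd_apply_self x
    refine ⟨(isInvChar_iff _).2 ⟨_, isNatValued_orbInd x, rfl⟩, fun h => ?_, ?_⟩
    · have h2 : orbInd x = 0 := fhat_injective (h.trans (map_zero _).symm)
      rw [h2] at h1
      exact zero_ne_one h1
    · rintro ⟨χ₁, χ₂, hχ₁, hχ₂, h01, h02, he⟩
      obtain ⟨m₁, hm₁, rfl⟩ := (isInvChar_iff χ₁).1 hχ₁
      obtain ⟨m₂, hm₂, rfl⟩ := (isInvChar_iff χ₂).1 hχ₂
      rw [← map_add] at he
      have he := fhat_injective he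
      -- A nonzero summand of an orbit indicator is supported on the orbit and constant there, so it
      -- is at least 1 at x; two of them would give at least 2.
      have key : ∀ m m' : InvFun F n, IsNatValued m → IsNatValued m' → fhat F n m ≠ 0 →
          orbInd x = m + m' → ∃ k : ℕ, 1 ≤ k ∧ m.1 x = k := by
        intro m m' hm hm' h0 he
        obtain ⟨y, hy⟩ := exists_apply_ne_zero (m := m) fun h => h0 (by rw [h, map_zero])
        obtain ⟨k, hk⟩ := hm y
        obtain ⟨k', hk'⟩ := hm' y
        have hk0 : k ≠ 0 := by
          rintro rfl
          exact hy (by rw [hk, Nat.cast_zero])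
        rcases orbInd_eq_zero_or x y with h | ⟨-, g, rfl⟩
        · rw [he, Submodule.coe_add, Pi.add_apply, hk, hk'] at h
          have : k + k' = 0 := by exact_mod_cast h
          omega
        · exact ⟨k, by omega, by rw [← hk, m.2]⟩
      obtain ⟨k, hk1, hk⟩ := key m₁ m₂ hm₁ hm₂ h01 he
      obtain ⟨l, hl1, hl⟩ := key m₂ m₁ hm₂ hm₁ h02 (he.trans (add_comm _ _))
      rw [he, Submodule.coe_add, Pi.add_apply, hk, hl] at h1
      have : k + l = 1 := by exact_mod_cast h1
      omega

theorem fhat_neg {f : InvFun F n} (hf : ∀ x, starRingEnd ℂ (f.1 x) = f.1 x) (x : Mat F n) :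
    (fhat F n f).1 (-x) = starRingEnd ℂ ((fhat F n f).1 x) := by
  rw [fhat_apply, fhat_apply, map_sum]
  refine Finset.sum_congr rfl fun y _ => ?_
  rw [map_mul, hf, ← psi_neg, neg_mul, Matrix.trace_neg]

theorem conj_orbInd (x y : Mat F n) : starRingEnd ℂ ((orbInd x).1 y) = (orbInd x).1 y := by
  rcases orbInd_eq_zero_or x y with h | ⟨h, -⟩ <;> rw [h] <;> simp

/-- Plancherel: the squared norm is |𝔤𝔩ₙ| |O| / |GLₙ|. -/
theorem herm_fhat_orbInd (o : Orb F n) : herm (fhat F n (orbInd o.out)) (fhat F n (orbInd o.out)) =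
    ((sqrtCard F n / orbScale o : ℝ) : ℂ) * ((sqrtCard F n / orbScale o : ℝ) : ℂ) := by
  classical
  have h1 : ∑ x, (fhat F n (orbInd o.out)).1 x *
      starRingEnd ℂ ((fhat F n (orbInd o.out)).1 x) = Fintype.card (Mat F n) * orbCard o.out := by
    -- For a real-valued function, conjugating the transform is reflecting it, which is a further
    -- double transform. This allows the bilinear identity `sum_fhat_mul` to be used.
    have h2 : ∀ x, (Fintype.card (Mat F n) : ℂ) * starRingEnd ℂ ((fhat F n (orbInd o.out)).1 x) =
        (fhat F n (fhat F n (fhat F n (orbInd o.out)))).1 x := by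
      intro x
      rw [fhat_fhat, fhat_neg (conj_orbInd _)]
    refine mul_left_cancel₀ (cardMat_ne F n) ?_
    rw [Finset.mul_sum]
    simp only [mul_left_comm _ ((fhat F n (orbInd o.out)).1 _), h2]
    rw [sum_fhat_mul (orbInd o.out)]
    simp only [fhat_fhat, neg_neg, mul_left_comm _ (Fintype.card (Mat F n) : ℂ)]
    rw [← Finset.mul_sum, ← Finset.mul_sum, sum_orbInd_mul, orbInd_apply_self, mul_one]
  rw [herm, h1]
  have h3 : (orbScale o : ℂ) * orbScale o = Fintype.card (GL (Fin n) F) / orbCard o.out := by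
    rw [← Complex.ofReal_mul, orbScale_sq]
    push_cast
    rfl
  rw [Complex.ofReal_div, div_mul_div_comm, sqrtCard_sq, h3]
  have hG : (Fintype.card (GL (Fin n) F) : ℂ) ≠ 0 := Nat.cast_ne_zero.2 Fintype.card_ne_zero
  have hO : (orbCard o.out : ℂ) ≠ 0 := Nat.cast_ne_zero.2 (orbCard_pos _).ne'
  field_simp

theorem normalised_fhat_orbInd (o : Orb F n) :
    incl F n (((Real.sqrt (herm (fhat F n (orbInd o.out)) (fhat F n (orbInd o.out))).re : ℝ) : ℂ)⁻¹ •
      fhat F n (orbInd o.out)) = fourierC (orbBasis F ⟨n, o⟩) := by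
  have h1 : 0 ≤ sqrtCard F n / orbScale o := div_nonneg (sqrtCard_pos n).le (orbScale_pos o).le
  rw [herm_fhat_orbInd, ← Complex.ofReal_mul, Complex.ofReal_re, Real.sqrt_mul_self h1,
    orbBasis_apply, fourierC_incl]
  change _ = incl F n ((sqrtCard F n : ℂ)⁻¹ • fhat F n ((orbScale o : ℂ) • orbInd o.out))
  rw [map_smul (fhat F n), smul_smul]
  congr 2
  rw [Complex.ofReal_div, inv_div, div_eq_inv_mul]

theorem orbInd_mk_out (x : Mat F n) : orbInd (Quotient.mk (orbSetoid F n) x).out = orbInd x := by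
  classical
  refine Subtype.ext (funext fun y => ?_)
  rw [orbInd_out]
  change _ = if _ then (1 : ℂ) else 0
  congr 1
  refine propext ⟨fun h => ?_, ?_⟩
  · exact Quotient.exact h.symm
  · rintro ⟨g, rfl⟩
    exact mk_Ad g x

variable (F n) in
theorem incl_image_omegaDeg : incl F n '' omegaDeg F n =
    Set.range fun o : Orb F n => fourierC (orbBasis F ⟨n, o⟩) := by
  ext a
  constructor
  · rintro ⟨_, ⟨χ, hχ, rfl⟩, rfl⟩
    obtain ⟨x, rfl⟩ := (isIrrInvChar_iff χ).1 hχ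
    refine ⟨Quotient.mk _ x, ?_⟩
    change fourierC (orbBasis F ⟨n, Quotient.mk _ x⟩) = _
    rw [← normalised_fhat_orbInd, orbInd_mk_out]
  · rintro ⟨o, rfl⟩
    exact ⟨_, ⟨_, (isIrrInvChar_iff _).2 ⟨o.out, rfl⟩, rfl⟩, normalised_fhat_orbInd o⟩

variable (F) in
theorem omega_eq_range : omega F = Set.range fun i : OrbIx F => fourierC (orbBasis F i) := by
  ext a
  constructor
  · rintro ⟨n, φ, hφ, rfl⟩
    have h := (incl_image_omegaDeg F n).le ⟨φ, hφ, rfl⟩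
    obtain ⟨o, ho⟩ := h
    exact ⟨⟨n, o⟩, ho⟩
  · rintro ⟨⟨n, o⟩, rfl⟩
    obtain ⟨φ, hφ, h⟩ := (incl_image_omegaDeg F n).ge ⟨o, rfl⟩
    exact ⟨n, φ, hφ, h.symm⟩

end Characters

end GLInv

/-! ## Real forms of complex bialgebras -/

namespace BialgData

open Module

section RealForm

variable {X Y C E ι κ : Type*} [AddCommGroup X] [Module ℝ X] [AddCommGroup Y] [Module ℝ Y]
  [AddCommGroup C] [Module ℂ C] [AddCommGroup E] [Module ℂ E]

/-- The tensor product of two real linear maps to complex spaces. -/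
noncomputable def realTensor (f : X →ₗ[ℝ] C) (g : Y →ₗ[ℝ] E) : X ⊗[ℝ] Y →ₗ[ℝ] C ⊗[ℂ] E :=
  TensorProduct.lift
    (LinearMap.mk₂ ℝ (fun x y => f x ⊗ₜ[ℂ] g y)
      (fun _ _ _ => by simp [TensorProduct.add_tmul])
      (fun _ _ _ => by simp [TensorProduct.smul_tmul'])
      (fun _ _ _ => by simp [TensorProduct.tmul_add])
      (fun _ _ _ => by simp))

/-- The map `f` identifies a real space with the real span of a complex basis. -/
def IsRealForm (f : X →ₗ[ℝ] C) (bX : Basis ι ℝ X) (bC : Basis ι ℂ C) : Prop :=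
  ∀ i, f (bX i) = bC i

theorem IsRealForm.repr_apply {f : X →ₗ[ℝ] C} {bX : Basis ι ℝ X} {bC : Basis ι ℂ C}
    (h : IsRealForm f bX bC) (x : X) (i : ι) : bC.repr (f x) i = (bX.repr x i : ℝ) := by
  classical
  let φ : X →ₗ[ℝ] ℂ := (bC.coord i).restrictScalars ℝ ∘ₗ f
  let ψ : X →ₗ[ℝ] ℂ := Complex.ofRealCLM.toLinearMap ∘ₗ bX.coord i
  have e : φ = ψ := bX.ext fun j => by
    change bC.repr (f (bX j)) i = ((bX.repr (bX j) i : ℝ) : ℂ)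
    rw [h, Basis.repr_self, Basis.repr_self, Finsupp.single_apply, Finsupp.single_apply]
    split_ifs <;> simp
  exact LinearMap.congr_fun e x

theorem IsRealForm.injective {f : X →ₗ[ℝ] C} {bX : Basis ι ℝ X} {bC : Basis ι ℂ C}
    (h : IsRealForm f bX bC) : Function.Injective f := by
  intro x y hxy
  refine bX.ext_elem fun i => Complex.ofReal_injective ?_
  rw [← h.repr_apply, ← h.repr_apply, hxy]

theorem IsRealForm.tensor {f : X →ₗ[ℝ] C} {bX : Basis ι ℝ X} {bC : Basis ι ℂ C}
    (h : IsRealForm f bX bC) {g : Y →ₗ[ℝ] E} {bY : Basis κ ℝ Y} {bE : Basis κ ℂ E}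
    (h' : IsRealForm g bY bE) :
    IsRealForm (realTensor f g) (bX.tensorProduct bY) (bC.tensorProduct bE) := by
  rintro ⟨i, j⟩
  rw [Basis.tensorProduct_apply, Basis.tensorProduct_apply, ← h, ← h']
  rfl

theorem mem_span_real_image_iff (b : Basis ι ℂ C) (s : Set ι) (a : C) :
    a ∈ Submodule.span ℝ (b '' s) ↔ (∀ i, (b.repr a i).im = 0) ∧ ∀ i ∉ s, b.repr a i = 0 := by
  classical
  constructor
  · intro ha
    let N : Submodule ℝ C :=
      { carrier := {a | (∀ i, (b.repr a i).im = 0) ∧ ∀ i ∉ s, b.repr a i = 0}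
        add_mem' := fun {x y} hx hy =>
          ⟨fun i => by simp [hx.1 i, hy.1 i], fun i hi => by simp [hx.2 i hi, hy.2 i hi]⟩
        zero_mem' := ⟨fun i => by simp, fun i _ => by simp⟩
        smul_mem' := fun r x hx => by
          refine ⟨fun i => ?_, fun i hi => ?_⟩
          · change (b.repr ((r : ℂ) • x) i).im = 0
            rw [map_smul, Finsupp.smul_apply, smul_eq_mul, Complex.im_ofReal_mul, hx.1, mul_zero]
          · change b.repr ((r : ℂ) • x) i = 0
            rw [map_smul, Finsupp.smul_apply, hx.2 i hi, smul_zero] }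
    refine (Submodule.span_le (p := N)).2 ?_ ha
    rintro _ ⟨j, hj, rfl⟩
    refine ⟨fun i => ?_, fun i hi => ?_⟩
    · rw [b.repr_self, Finsupp.single_apply]
      split_ifs <;> simp
    · rw [b.repr_self, Finsupp.single_apply, if_neg]
      rintro rfl
      exact hi hj
  · rintro ⟨ha, hs⟩
    rw [← b.linearCombination_repr a, Finsupp.linearCombination_apply]
    refine Submodule.sum_mem _ fun i hi => ?_
    have h1 : b.repr a i = ((b.repr a i).re : ℂ) := Complex.ext rfl (by simp [ha i])
    have hi' : i ∈ s := by
      by_contra h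
      exact Finsupp.mem_support_iff.1 hi (hs i h)
    change b.repr a i • b i ∈ _
    rw [h1]
    exact Submodule.smul_mem _ (b.repr a i).re (Submodule.subset_span ⟨i, hi', rfl⟩)

end RealForm

/-! ### Nonnegative cones and orthonormal forms of a real basis -/

section Hull

variable {X Y ι κ : Type*} [AddCommGroup X] [Module ℝ X] [AddCommGroup Y] [Module ℝ Y]

theorem mem_hull_range_iff (b : Basis ι ℝ X) (x : X) :
    x ∈ PointedCone.hull ℝ (Set.range b) ↔ ∀ i, 0 ≤ b.repr x i := by
  classical
  constructor
  · intro hx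
    refine Submodule.span_induction ?_ ?_ ?_ ?_ hx
    · rintro _ ⟨j, rfl⟩ i
      rw [b.repr_self, Finsupp.single_apply]
      split_ifs <;> simp
    · intro i
      simp
    · intro x y _ _ hx hy i
      rw [map_add, Finsupp.add_apply]
      exact add_nonneg (hx i) (hy i)
    · intro r x _ hx i
      have : r • x = (r : ℝ) • x := rfl
      rw [this, map_smul, Finsupp.smul_apply]
      exact mul_nonneg r.2 (hx i)
  · intro hx
    rw [← b.linearCombination_repr x, Finsupp.linearCombination_apply]
    refine Submodule.sum_mem _ fun i _ => ?_
    exact Submodule.smul_mem _ (⟨b.repr x i, hx i⟩ : {c : ℝ // 0 ≤ c})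
      (Submodule.subset_span ⟨i, rfl⟩)

theorem map_mem_hull (f : X →ₗ[ℝ] Y) (b : Basis ι ℝ X) (c : Basis κ ℝ Y)
    (h : ∀ i j, 0 ≤ c.repr (f (b i)) j) {x : X} (hx : x ∈ PointedCone.hull ℝ (Set.range b)) :
    f x ∈ PointedCone.hull ℝ (Set.range c) := by
  refine Submodule.span_induction ?_ ?_ ?_ ?_ hx
  · rintro _ ⟨i, rfl⟩
    exact (mem_hull_range_iff c _).2 (h i)
  · rw [map_zero]
    exact Submodule.zero_mem _
  · intro x y _ _ hx hy
    rw [map_add]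
    exact Submodule.add_mem _ hx hy
  · intro r x _ hx
    have : r • x = (r : ℝ) • x := rfl
    rw [this, map_smul]
    exact Submodule.smul_mem _ r hx

theorem tensorSet_range (b : Basis ι ℝ X) :
    tensorSet ℝ (Set.range b) = Set.range (b.tensorProduct b) := by
  ext t
  constructor
  · rintro ⟨_, ⟨i, rfl⟩, _, ⟨j, rfl⟩, rfl⟩
    exact ⟨(i, j), Basis.tensorProduct_apply _ _ _ _⟩
  · rintro ⟨⟨i, j⟩, rfl⟩
    exact ⟨_, ⟨i, rfl⟩, _, ⟨j, rfl⟩, Basis.tensorProduct_apply _ _ _ _⟩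

/-- The bilinear form for which a basis is orthonormal. -/
noncomputable def basisForm (b : Basis ι ℝ X) : LinearMap.BilinForm ℝ X :=
  b.constr ℝ fun i => b.coord i

theorem basisForm_apply (b : Basis ι ℝ X) (i : ι) (x : X) : basisForm b (b i) x = b.repr x i := by
  rw [basisForm, Basis.constr_basis]
  rfl

theorem basisForm_comm (b : Basis ι ℝ X) (x y : X) : basisForm b x y = basisForm b y x := by
  classical
  have e : basisForm b = (basisForm b).flip := b.ext fun i => b.ext fun j => by
    change basisForm b (b i) (b j) = basisForm b (b j) (b i)
    rw [basisForm_apply, basisForm_apply, b.repr_self, b.repr_self,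
      Finsupp.single_apply, Finsupp.single_apply]
    simp only [eq_comm]
  exact LinearMap.congr_fun (LinearMap.congr_fun e x) y

theorem basisForm_adjoint {b : Basis ι ℝ X} {c : Basis κ ℝ Y} {f : X →ₗ[ℝ] Y} {g : Y →ₗ[ℝ] X}
    (h : ∀ i j, c.repr (f (b i)) j = b.repr (g (c j)) i) (x : X) (y : Y) :
    basisForm c (f x) y = basisForm b x (g y) := by
  have e : basisForm c ∘ₗ f = (basisForm b).compl₂ g := b.ext fun i => c.ext fun j => by
    change basisForm c (f (b i)) (c j) = basisForm b (b i) (g (c j))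
    rw [basisForm_comm, basisForm_apply, basisForm_apply, h]
  exact LinearMap.congr_fun (LinearMap.congr_fun e x) y

theorem isOrthonormalFor_basisForm (b : Basis ι ℝ X) {Ω : Type*} (v : Ω → X) (e : Ω → ι)
    (he : Function.Injective e) (hv : ∀ ω, v ω = b (e ω)) : IsOrthonormalFor (basisForm b) v := by
  classical
  refine ⟨fun ω => ?_, fun ω ω' hne => ?_⟩
  · rw [hv, basisForm_apply, b.repr_self, Finsupp.single_eq_same]
  · rw [hv, hv, basisForm_apply, b.repr_self, Finsupp.single_apply, if_neg]
    exact fun h => hne (he h).symm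

end Hull

/-! ### Transfer of the Hopf algebra laws to a real form -/

section Restriction

variable {C ι : Type*} [AddCommGroup C] [Module ℂ C] {D : BialgData ℂ C} {V : Submodule ℝ C}
  {D₀ : BialgData ℝ V}

theorem IsRestriction.coe_mul (h : IsRestriction V D₀ D) (t : V ⊗[ℝ] V) :
    (D₀.mul t : C) = D.mul (realTensorIncl V t) := by
  induction t using TensorProduct.induction_on with
  | zero => simp
  | add s t hs ht => simp only [map_add, Submodule.coe_add, hs, ht]
  | tmul x y => exact h.mul x y

theorem realTensorIncl_tmul (x y : V) :
    realTensorIncl V (x ⊗ₜ[ℝ] y) = (x : C) ⊗ₜ[ℂ] (y : C) := rfl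

/-- The laws of a bialgebra pass to a real form. -/
theorem IsRestriction.isBialgebra (h : IsRestriction V D₀ D) (hD : D.IsBialgebra)
    (bV : Basis ι ℝ V) (b : Basis ι ℂ C) (hb : IsRealForm V.subtype bV b) : D₀.IsBialgebra := by
  -- Tensor powers of a real form are real forms of the tensor powers, so each law may be checked
  -- after embedding into the complex space.
  have hκ : Function.Injective (realTensorIncl V) := (hb.tensor hb).injective
  have hκ₃ : Function.Injective (realTensor V.subtype (realTensorIncl V)) :=
    (hb.tensor (hb.tensor hb)).injective
  have hunit : (D₀.unit 1 : C) = D.unit 1 := by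
    rw [h.unit, Complex.ofReal_one]
  have hmul : D₀.mul ∘ₗ D₀.mul.rTensor V
      = D₀.mul ∘ₗ D₀.mul.lTensor V ∘ₗ (TensorProduct.assoc ℝ V V V).toLinearMap := by
    refine TensorProduct.ext_threefold fun x y z => Subtype.ext ?_
    have h1 := hD.mul_assoc_apply (x : C) y z
    rw [← h.mul, ← h.mul y, ← h.mul, ← h.mul] at h1
    exact h1
  refine ⟨hmul, fun a => Subtype.ext ?_, fun a => Subtype.ext ?_, ?_, fun a => ?_, fun a => ?_,
    ?_, ?_, fun x y => ?_, ?_⟩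
  · rw [h.mul, hunit, hD.one_mul]
  · rw [h.mul, hunit, hD.mul_one]
  · refine LinearMap.ext fun x => hκ₃ ?_
    let κ' := realTensor (realTensorIncl V) V.subtype
    have e1 : ∀ t, realTensor V.subtype (realTensorIncl V) (TensorProduct.assoc ℝ V V V t) =
        TensorProduct.assoc ℂ C C C (κ' t) := by
      intro t
      induction t using TensorProduct.induction_on with
      | zero => simp
      | add s t hs ht => simp only [map_add, hs, ht]
      | tmul s z =>
        induction s using TensorProduct.induction_on with
        | zero => simp
        | add s t hs ht => simp only [TensorProduct.add_tmul, map_add, hs, ht]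
        | tmul x y => rfl
    have e2 : ∀ s, κ' (D₀.comul.rTensor V s) = D.comul.rTensor C (realTensorIncl V s) := by
      intro s
      induction s using TensorProduct.induction_on with
      | zero => simp
      | add s t hs ht => simp only [map_add, hs, ht]
      | tmul x y =>
        change realTensorIncl V (D₀.comul x) ⊗ₜ[ℂ] (y : C) = D.comul x ⊗ₜ[ℂ] (y : C)
        rw [h.comul]
    have e3 : ∀ s, realTensor V.subtype (realTensorIncl V) (D₀.comul.lTensor V s) =
        D.comul.lTensor C (realTensorIncl V s) := by
      intro s
      induction s using TensorProduct.induction_on with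
      | zero => simp
      | add s t hs ht => simp only [map_add, hs, ht]
      | tmul x y =>
        change (x : C) ⊗ₜ[ℂ] realTensorIncl V (D₀.comul y) = (x : C) ⊗ₜ[ℂ] D.comul y
        rw [h.comul]
    have h1 := LinearMap.congr_fun hD.coassoc (x : C)
    simp only [LinearMap.comp_apply, LinearEquiv.coe_coe] at h1 ⊢
    rw [e1, e2, e3, h.comul, h1]
  · refine (TensorProduct.lid ℝ V).injective (Subtype.ext ?_)
    have e : ∀ s, (TensorProduct.lid ℝ V (D₀.counit.rTensor V s) : C) =
        TensorProduct.lid ℂ C (D.counit.rTensor C (realTensorIncl V s)) := by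
      intro s
      induction s using TensorProduct.induction_on with
      | zero => simp
      | add s t hs ht => simp only [map_add, Submodule.coe_add, hs, ht]
      | tmul x y =>
        rw [LinearMap.rTensor_tmul, TensorProduct.lid_tmul, realTensorIncl_tmul,
          LinearMap.rTensor_tmul, TensorProduct.lid_tmul, ← h.counit]
        rfl
    rw [e, h.comul, hD.counit_comul]
    simp
  · refine (TensorProduct.rid ℝ V).injective (Subtype.ext ?_)
    have e : ∀ s, (TensorProduct.rid ℝ V (D₀.counit.lTensor V s) : C) =
        TensorProduct.rid ℂ C (D.counit.lTensor C (realTensorIncl V s)) := by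
      intro s
      induction s using TensorProduct.induction_on with
      | zero => simp
      | add s t hs ht => simp only [map_add, Submodule.coe_add, hs, ht]
      | tmul x y =>
        rw [LinearMap.lTensor_tmul, TensorProduct.rid_tmul, realTensorIncl_tmul,
          LinearMap.lTensor_tmul, TensorProduct.rid_tmul, ← h.counit]
        rfl
    rw [e, h.comul, hD.comul_counit]
    simp
  · refine TensorProduct.ext' fun x y => hκ ?_
    have e : ∀ s t, realTensorIncl V (TensorProduct.map D₀.mul D₀.mul
        (TensorProduct.tensorTensorTensorComm ℝ V V V V (s ⊗ₜ[ℝ] t))) =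
        TensorProduct.map D.mul D.mul (TensorProduct.tensorTensorTensorComm ℂ C C C C
          (realTensorIncl V s ⊗ₜ[ℂ] realTensorIncl V t)) := by
      intro s t
      induction s using TensorProduct.induction_on with
      | zero => simp
      | add s s' hs hs' => simp only [TensorProduct.add_tmul, map_add, hs, hs']
      | tmul x y =>
        induction t using TensorProduct.induction_on with
        | zero => simp
        | add s t hs ht => simp only [TensorProduct.tmul_add, map_add, hs, ht]
        | tmul z w =>
          rw [TensorProduct.tensorTensorTensorComm_tmul, TensorProduct.map_tmul,
            realTensorIncl_tmul, realTensorIncl_tmul, realTensorIncl_tmul, h.mul, h.mul,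
            TensorProduct.tensorTensorTensorComm_tmul, TensorProduct.map_tmul]
    have h1 := LinearMap.congr_fun hD.comul_mul ((x : C) ⊗ₜ[ℂ] (y : C))
    simp only [LinearMap.comp_apply, LinearEquiv.coe_coe, TensorProduct.map_tmul] at h1 ⊢
    rw [e, h.comul, h.comul, h.comul, h.mul, h1]
  · refine hκ ?_
    rw [h.comul, hunit, hD.comul_one, realTensorIncl_tmul, hunit]
  · refine Complex.ofReal_injective ?_
    rw [h.counit, h.mul, hD.counit_mul, Complex.ofReal_mul, h.counit, h.counit]
  · refine Complex.ofReal_injective ?_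
    rw [h.counit, hunit, hD.counit_one, Complex.ofReal_one]

theorem IsRestriction.exists_antipode (h : IsRestriction V D₀ D) {S : C →ₗ[ℂ] C}
    (hS : D.IsAntipode S) (hSV : ∀ x ∈ V, S x ∈ V) : ∃ S₀ : V →ₗ[ℝ] V, D₀.IsAntipode S₀ := by
  let S₀ : V →ₗ[ℝ] V := (S.restrictScalars ℝ).restrict hSV
  have h0 : ∀ r, (D₀.unit r : C) = D.unit r := h.unit
  refine ⟨S₀, ⟨LinearMap.ext fun x => Subtype.ext ?_, LinearMap.ext fun x => Subtype.ext ?_⟩⟩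
  · have e : ∀ s, realTensorIncl V (S₀.rTensor V s) = S.rTensor C (realTensorIncl V s) := by
      intro s
      induction s using TensorProduct.induction_on with
      | zero => simp
      | add s t hs ht => simp only [map_add, hs, ht]
      | tmul x y => rfl
    have h1 := LinearMap.congr_fun hS.left (x : C)
    simp only [LinearMap.comp_apply] at h1 ⊢
    rw [h.coe_mul, e, h.comul, h1, h0, h.counit]
  · have e : ∀ s, realTensorIncl V (S₀.lTensor V s) = S.lTensor C (realTensorIncl V s) := by
      intro s
      induction s using TensorProduct.induction_on with
      | zero => simp
      | add s t hs ht => simp only [map_add, hs, ht]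
      | tmul x y => rfl
    have h1 := LinearMap.congr_fun hS.right (x : C)
    simp only [LinearMap.comp_apply] at h1 ⊢
    rw [h.coe_mul, e, h.comul, h1, h0, h.counit]

end Restriction

end BialgData

/-! ## Real PSH algebras from self-dual bases -/

namespace BialgData

open Module
open scoped ComplexOrder

/-! ### Complex maps with real matrices -/

section Descent

variable {X Y C E ι κ : Type*} [AddCommGroup X] [Module ℝ X] [AddCommGroup Y] [Module ℝ Y]
  [AddCommGroup C] [Module ℂ C] [AddCommGroup E] [Module ℂ E]
  {f : X →ₗ[ℝ] C} {bX : Basis ι ℝ X} {bC : Basis ι ℂ C}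
  {g : Y →ₗ[ℝ] E} {bY : Basis κ ℝ Y} {bE : Basis κ ℂ E} {T : C →ₗ[ℂ] E}

/-- The real linear map whose matrix consists of the real parts of the matrix entries of `T`. -/
noncomputable def descend (bX : Basis ι ℝ X) (bC : Basis ι ℂ C) (bY : Basis κ ℝ Y)
    (bE : Basis κ ℂ E) (T : C →ₗ[ℂ] E) : X →ₗ[ℝ] Y :=
  bX.constr ℝ fun i => bY.repr.symm ((bE.repr (T (bC i))).mapRange Complex.re rfl)

theorem repr_descend (i : ι) (j : κ) :
    bY.repr (descend bX bC bY bE T (bX i)) j = (bE.repr (T (bC i)) j).re := by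
  rw [descend, Basis.constr_basis, LinearEquiv.apply_symm_apply, Finsupp.mapRange_apply]

theorem IsRealForm.apply_descend (hf : IsRealForm f bX bC) (hg : IsRealForm g bY bE)
    (hT : ∀ i j, (bE.repr (T (bC i)) j).im = 0) (x : X) :
    g (descend bX bC bY bE T x) = T (f x) := by
  have e : g ∘ₗ descend bX bC bY bE T = T.restrictScalars ℝ ∘ₗ f := bX.ext fun i => by
    change g (descend bX bC bY bE T (bX i)) = T (f (bX i))
    refine bE.ext_elem fun j => ?_
    rw [hg.repr_apply, repr_descend, hf]
    exact Complex.ext rfl (hT i j).symm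
  exact LinearMap.congr_fun e x

theorem isRealForm_ofReal : IsRealForm Complex.ofRealCLM.toLinearMap
    (Basis.singleton Unit ℝ) (Basis.singleton Unit ℂ) := fun i => by
  simp

end Descent

/-! ### Real PSH algebras from nonnegative self-dual structure constants -/

section RealPSH

variable {C ι : Type*} [AddCommGroup C] [Module ℂ C] (D : BialgData ℂ C) {V : Submodule ℝ C}
  (bV : Basis ι ℝ V) (b : Basis ι ℂ C)

/-- The structure maps on a real form with the real parts of the structure constants. -/
noncomputable def realData : BialgData ℝ V where
  mul := descend (bV.tensorProduct bV) (b.tensorProduct b) bV b D.mul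
  unit := descend (Basis.singleton Unit ℝ) (Basis.singleton Unit ℂ) bV b D.unit
  comul := descend bV b (bV.tensorProduct bV) (b.tensorProduct b) D.comul
  counit := descend bV b (Basis.singleton Unit ℝ) (Basis.singleton Unit ℂ) D.counit

variable {D bV b} (i₀ : ι)

/-- Nonnegative complex numbers are real, so passing to real parts loses nothing. For the
comultiplication, self-duality reduces to the product. -/
theorem isRestriction_realData (hb : IsRealForm V.subtype bV b)
    (hadj : ∀ i j k, (b.tensorProduct b).repr (D.comul (b k)) (i, j)
      = b.repr (D.mul (b i ⊗ₜ[ℂ] b j)) k)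
    (hmul : ∀ i j k, 0 ≤ b.repr (D.mul (b i ⊗ₜ[ℂ] b j)) k)
    (hunit : D.unit 1 = b i₀) (hcounit : ∀ i, D.counit (b i) = b.repr (b i) i₀) :
    IsRestriction V (realData D bV b) D := by
  classical
  have him : ∀ i j, (b.repr (b i) j).im = 0 := fun i j => by
    rw [b.repr_self, Finsupp.single_apply]
    split_ifs <;> simp
  refine ⟨fun x y => ?_, fun r => ?_, fun x => ?_, fun x => ?_⟩
  · refine (hb.tensor hb).apply_descend hb ?_ (x ⊗ₜ y)
    rintro ⟨i, j⟩ k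
    rw [Basis.tensorProduct_apply]
    exact (Complex.nonneg_iff.1 (hmul i j k)).2.symm
  · refine isRealForm_ofReal.apply_descend hb (fun i j => ?_) r
    rw [Basis.singleton_apply, hunit]
    exact him _ _
  · refine hb.apply_descend (hb.tensor hb) ?_ x
    rintro k ⟨i, j⟩
    rw [hadj]
    exact (Complex.nonneg_iff.1 (hmul i j k)).2.symm
  · refine hb.apply_descend isRealForm_ofReal (fun i j => ?_) x
    rw [Basis.singleton_repr, hcounit]
    exact him _ _

theorem repr_realData_mul (i j k : ι) :
    bV.repr ((realData D bV b).mul (bV i ⊗ₜ[ℝ] bV j)) k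
      = (b.repr (D.mul (b i ⊗ₜ[ℂ] b j)) k).re := by
  have h := repr_descend (bX := bV.tensorProduct bV) (bC := b.tensorProduct b) (bY := bV)
    (bE := b) (T := D.mul) (i, j) k
  rwa [Basis.tensorProduct_apply, Basis.tensorProduct_apply] at h

/-- A complex Hopf algebra with a self-dual homogeneous basis with nonnegative structure constants
has a real form that is a real PSH algebra. -/
theorem isPSH_realData (deg : ι → ℕ) {𝒱 : ℕ → Submodule ℝ V} (hb : IsRealForm V.subtype bV b)
    (hadj : ∀ i j k, (b.tensorProduct b).repr (D.comul (b k)) (i, j)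
      = b.repr (D.mul (b i ⊗ₜ[ℂ] b j)) k)
    (hmul : ∀ i j k, 0 ≤ b.repr (D.mul (b i ⊗ₜ[ℂ] b j)) k)
    (hunit : D.unit 1 = b i₀) (hcounit : ∀ i, D.counit (b i) = b.repr (b i) i₀)
    (hmem : ∀ n a, a ∈ 𝒱 n ↔ ∀ i, deg i ≠ n → bV.repr a i = 0)
    (hdeg : ∀ i j k, b.repr (D.mul (b i ⊗ₜ[ℂ] b j)) k ≠ 0 → deg k = deg i + deg j)
    (hi₀ : ∀ i, deg i = 0 ↔ i = i₀) (hD : D.IsBialgebra) {S : C →ₗ[ℂ] C} (hS : D.IsAntipode S)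
    (hSV : ∀ x ∈ V, S x ∈ V) : (realData D bV b).IsPSH 𝒱 (Set.range bV) := by
  classical
  have hres := isRestriction_realData i₀ hb hadj hmul hunit hcounit
  have hmul' : ∀ i j k, 0 ≤ bV.repr ((realData D bV b).mul (bV i ⊗ₜ[ℝ] bV j)) k :=
    fun i j k => by
      rw [repr_realData_mul]
      exact (Complex.nonneg_iff.1 (hmul i j k)).1
  have hadj' : ∀ i j k, (bV.tensorProduct bV).repr ((realData D bV b).comul (bV k)) (i, j)
      = bV.repr ((realData D bV b).mul (bV i ⊗ₜ[ℝ] bV j)) k := fun i j k => by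
    rw [repr_realData_mul, ← hadj]
    exact repr_descend k (i, j)
  have hdeg' : ∀ i j k, bV.repr ((realData D bV b).mul (bV i ⊗ₜ[ℝ] bV j)) k ≠ 0 →
      deg k = deg i + deg j := fun i j k h => by
    refine hdeg i j k fun h0 => h ?_
    rw [repr_realData_mul, h0, Complex.zero_re]
  have hunit' : (realData D bV b).unit 1 = bV i₀ := Subtype.ext <| by
    rw [hres.unit, Complex.ofReal_one, hunit]
    exact (hb i₀).symm
  have hcounit' : ∀ a, (realData D bV b).counit a = bV.repr a i₀ := fun a => by
    have e : (realData D bV b).counit = bV.coord i₀ := bV.ext fun i => Complex.ofReal_injective <| by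
      have e1 : ((bV i : V) : C) = b i := hb i
      rw [hres.counit, e1, hcounit]
      change _ = ((bV.repr (bV i) i₀ : ℝ) : ℂ)
      rw [← hb.repr_apply, hb]
    exact LinearMap.congr_fun e a
  refine
    { toIsConnectedGradedHopf := isConnectedGradedHopf_of_basis bV deg hmem
        (hres.isBialgebra hD bV b hb) (hres.exists_antipode hS hSV) hdeg'
        (fun i j k h => hdeg' i j k (by rwa [← hadj'])) i₀ hi₀ hunit' fun i hi => ?_
      isBasis := ?_
      homogeneous := ?_
      unit_pos := fun r hr => ?_
      counit_pos := fun a ha => ?_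
      mul_pos := fun t ht => ?_
      comul_pos := fun a ha => ?_
      self_adjoint := ?_ }
  · rw [hcounit', bV.repr_self, Finsupp.single_apply, if_neg hi]
  · exact ⟨bV.linearIndependent.linearIndepOn_id, bV.span_eq⟩
  · rintro _ ⟨i, rfl⟩
    exact ⟨deg i, basis_mem_grading bV deg hmem i⟩
  · have e : (realData D bV b).unit r = r • bV i₀ := by
      rw [← hunit', ← map_smul, smul_eq_mul, mul_one]
    rw [e, mem_hull_range_iff]
    intro i
    rw [map_smul, bV.repr_self, Finsupp.smul_apply, Finsupp.single_apply]
    split_ifs <;> simp [hr]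
  · rw [hcounit']
    exact (mem_hull_range_iff bV a).1 ha i₀
  · rw [tensorSet_range] at ht
    refine map_mem_hull _ (bV.tensorProduct bV) bV ?_ ht
    rintro ⟨i, j⟩ k
    rw [Basis.tensorProduct_apply]
    exact hmul' i j k
  · rw [tensorSet_range]
    refine map_mem_hull _ bV (bV.tensorProduct bV) ?_ ha
    rintro k ⟨i, j⟩
    rw [hadj']
    exact hmul' i j k
  -- Orthonormality is required of a set, so each of its elements is assigned, injectively, its
  -- index in the basis.
  · choose e he using fun ω : Set.range bV => ω.2
    have he' : Function.Injective e := fun ω ω' h => Subtype.ext (by rw [← he, ← he, h])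
    refine ⟨basisForm bV, basisForm (bV.tensorProduct bV),
      isOrthonormalFor_basisForm bV _ e he' fun ω => (he ω).symm,
      isOrthonormalFor_basisForm _ _ (Prod.map e e) (he'.prodMap he') fun p => ?_,
      fun t a => ?_, fun r a => ?_⟩
    · rw [Prod.map_apply, Basis.tensorProduct_apply, he, he]
    · refine basisForm_adjoint ?_ t a
      rintro ⟨i, j⟩ k
      rw [hadj', Basis.tensorProduct_apply]
    · have e2 : (realData D bV b).unit r = r • bV i₀ := by
        rw [← hunit', ← map_smul, smul_eq_mul, mul_one]
      rw [e2, map_smul, LinearMap.smul_apply, basisForm_apply, hcounit', smul_eq_mul]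

end RealPSH

end BialgData

namespace GLInv

open Module BialgData
open scoped BigOperators

variable {F : Type*} [Field F] [Fintype F] [DecidableEq F]

/-! ### The real form -/

theorem counit_eq_repr (a : C F) : (bialgC F).counit a = (orbBasis F).repr a (orbZero F) := by
  rw [← form_orbBasis, ← unit_one_eq, form_unit, one_mul]

/-- S acts on values with rational coefficients, so it preserves real-valued functions. -/
theorem conj_antipodeComp {n : ℕ} {f : InvFun F n} (hf : ∀ x, starRingEnd ℂ (f.1 x) = f.1 x)
    (x : Mat F n) :
    starRingEnd ℂ ((antipodeComp F n f).1 x) = (antipodeComp F n f).1 x := by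
  classical
  rw [antipodeComp, LinearMap.sum_apply, Submodule.coe_sum, Finset.sum_apply, map_sum]
  refine Finset.sum_congr rfl fun c _ => ?_
  rw [LinearMap.smul_apply, Submodule.coe_smul, Pi.smul_apply, smul_eq_mul, hcIndRes_apply]
  simp only [map_mul, map_pow, map_neg, map_one, map_inv₀, Complex.conj_natCast, map_sum,
    apply_ite (starRingEnd ℂ), hf, map_zero]

theorem repr_antipodeC_im (i j : OrbIx F) :
    ((orbBasis F).repr (antipodeC F (orbBasis F i)) j).im = 0 := by
  rw [orbBasis_repr, ev_toLin', orbBasis_apply, antipodeC_incl, ← Complex.ofReal_inv,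
    Complex.im_ofReal_mul]
  refine mul_eq_zero_of_right _ ?_
  by_cases h : i.1 = j.1
  · obtain ⟨n, o⟩ := i
    obtain ⟨m, o'⟩ := j
    obtain rfl : n = m := h
    rw [comp_incl]
    refine Complex.conj_eq_iff_im.1 (conj_antipodeComp (fun x => ?_) _)
    rw [Submodule.coe_smul, Pi.smul_apply, smul_eq_mul, map_mul, conj_orbInd, Complex.conj_ofReal]
  · rw [comp_incl_of_ne h]
    rfl

/-- The hypothesis says that s is a union of full degrees. S is homogeneous with a real matrix, so
it preserves the real span. -/
theorem antipodeC_mem_span_orbBasis {s : Set (OrbIx F)} (hs : ∀ i ∈ s, ∀ j, j.1 = i.1 → j ∈ s)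
    {a : C F} (ha : a ∈ Submodule.span ℝ (orbBasis F '' s)) :
    antipodeC F a ∈ Submodule.span ℝ (orbBasis F '' s) := by
  refine (Submodule.span_le (p := (Submodule.span ℝ (orbBasis F '' s)).comap
    ((antipodeC F).restrictScalars ℝ))).2 ?_ ha
  rintro _ ⟨i, hi, rfl⟩
  refine (mem_span_real_image_iff _ _ _).2 ⟨repr_antipodeC_im i, fun j hj => ?_⟩
  rw [orbBasis_apply]
  change (orbBasis F).repr (antipodeC F (incl F i.1 _)) j = 0
  rw [antipodeC_incl]
  exact (mem_gradC_iff _ _).1 ⟨_, rfl⟩ j fun h => hj (hs i hi j h)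

variable (F) in
/-- The basis of antipodes of normalised irreducible invariant characters. -/
noncomputable def twistBasis : Basis (OrbIx F) ℂ (C F) := (orbBasis F).map twistEquiv

theorem twistBasis_apply (i : OrbIx F) : twistBasis F i = twistEquiv (orbBasis F i) := rfl

theorem twistBasis_repr (a : C F) (i : OrbIx F) :
    (twistBasis F).repr (twistEquiv a) i = (orbBasis F).repr a i := by
  rw [twistBasis, Basis.map_repr, LinearEquiv.trans_apply, LinearEquiv.symm_apply_apply]

theorem twistBasis_tensorProduct_repr (t : C F ⊗[ℂ] C F) (i j : OrbIx F) :
    ((twistBasis F).tensorProduct (twistBasis F)).repr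
        (TensorProduct.map twistEquiv.toLinearMap twistEquiv.toLinearMap t) (i, j) =
      ((orbBasis F).tensorProduct (orbBasis F)).repr t (i, j) := by
  induction t using TensorProduct.induction_on with
  | zero => simp
  | add s t hs ht => simp only [map_add, Finsupp.add_apply, hs, ht]
  | tmul x y =>
    rw [TensorProduct.map_tmul, Basis.tensorProduct_repr_tmul_apply,
      Basis.tensorProduct_repr_tmul_apply, LinearEquiv.coe_coe, twistBasis_repr, twistBasis_repr]

theorem mul_twistBasis (i j : OrbIx F) :
    (bialgC F).mul (twistBasis F i ⊗ₜ[ℂ] twistBasis F j) =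
      twistEquiv ((bialgC F).mul (orbBasis F i ⊗ₜ[ℂ] orbBasis F j)) :=
  (isHom_twistEquiv.map_mul (orbBasis F i ⊗ₜ[ℂ] orbBasis F j)).symm

/-- S is an involution commuting with the Fourier transform and preserving the real span of the
orbit indicators in s. For s everything this gives 𝔠(q), for s a single degree its grading. -/
theorem span_fourierC_orbBasis {s : Set (OrbIx F)} (hs : ∀ i ∈ s, ∀ j, j.1 = i.1 → j ∈ s) :
    Submodule.span ℝ ((fun i => fourierC (orbBasis F i)) '' s) =
      Submodule.span ℝ (twistBasis F '' s) := by
  have h1 : Submodule.span ℝ ((fun i => fourierC (orbBasis F i)) '' s) =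
      (Submodule.span ℝ (orbBasis F '' s)).map (fourierC.restrictScalars ℝ) := by
    rw [Submodule.map_span, Set.image_image]
    rfl
  have h2 : Submodule.span ℝ (twistBasis F '' s) =
      (Submodule.span ℝ (orbBasis F '' s)).map (twistEquiv.toLinearMap.restrictScalars ℝ) := by
    rw [Submodule.map_span, Set.image_image]
    rfl
  rw [h1, h2]
  refine le_antisymm ?_ ?_
  · rintro _ ⟨a, ha, rfl⟩
    refine ⟨_, antipodeC_mem_span_orbBasis hs ha, ?_⟩
    change antipodeC F (fourierC (antipodeC F a)) = fourierC a
    rw [antipodeC_fourierC, antipodeC_antipodeC]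
  · rintro _ ⟨a, ha, rfl⟩
    exact ⟨_, antipodeC_mem_span_orbBasis hs ha, (antipodeC_fourierC a).symm⟩

theorem realC_eq_span : realC F = Submodule.span ℝ (twistBasis F '' Set.univ) := by
  rw [realC, omega_eq_range, ← Set.image_univ,
    span_fourierC_orbBasis fun _ _ _ _ => Set.mem_univ _]

theorem span_incl_omegaDeg (n : ℕ) : Submodule.span ℝ (incl F n '' omegaDeg F n) =
    Submodule.span ℝ (twistBasis F '' {i | i.1 = n}) := by
  rw [← span_fourierC_orbBasis (s := {i : OrbIx F | i.1 = n}) fun i hi j hj => Eq.trans hj hi,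
    incl_image_omegaDeg]
  congr 1
  ext a
  constructor
  · rintro ⟨o, rfl⟩
    exact ⟨⟨n, o⟩, rfl, rfl⟩
  · rintro ⟨⟨m, o⟩, h, rfl⟩
    obtain rfl : m = n := h
    exact ⟨o, rfl⟩

theorem antipodeC_image_omega : antipodeC F '' omega F = Set.range (twistBasis F) := by
  rw [omega_eq_range, ← Set.range_comp]
  rfl

theorem antipodeC_image_omega_subset : antipodeC F '' omega F ⊆ (realC F : Set (C F)) := by
  rw [antipodeC_image_omega, realC_eq_span, Set.image_univ]
  exact Submodule.subset_span

theorem antipodeC_mem_realC {a : C F} (ha : a ∈ realC F) : antipodeC F a ∈ realC F :=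
  (Submodule.span_le (p := (realC F).comap ((antipodeC F).restrictScalars ℝ))).2
    (fun _ hx => antipodeC_image_omega_subset ⟨_, hx, rfl⟩) ha

variable (F) in
/-- The twisted basis as a basis of the real form. -/
noncomputable def realBasis : Basis (OrbIx F) ℝ (realC F) :=
  (Basis.span ((twistBasis F).linearIndependent.restrict_scalars' ℝ)).map
    (LinearEquiv.ofEq _ _ (by rw [realC_eq_span, Set.image_univ]))

theorem isRealForm_realBasis : IsRealForm (realC F).subtype (realBasis F) (twistBasis F) :=
  fun i => by
    rw [realBasis, Basis.map_apply]
    exact Basis.coe_span_apply ((twistBasis F).linearIndependent.restrict_scalars' ℝ) i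

theorem setOf_mem_antipodeC_image_omega :
    {x : realC F | (x : C F) ∈ antipodeC F '' omega F} = Set.range (realBasis F) := by
  rw [antipodeC_image_omega]
  ext x
  constructor
  · rintro ⟨i, hi⟩
    exact ⟨i, Subtype.ext ((isRealForm_realBasis i).trans hi)⟩
  · rintro ⟨i, rfl⟩
    exact ⟨i, (isRealForm_realBasis i).symm⟩

theorem mem_gradReal_iff (n : ℕ) (a : realC F) :
    a ∈ gradReal F n ↔ ∀ i : OrbIx F, i.1 ≠ n → (realBasis F).repr a i = 0 := by
  have h1 : ∀ i, (twistBasis F).repr (a : C F) i = ((realBasis F).repr a i : ℝ) :=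
    isRealForm_realBasis.repr_apply a
  change (a : C F) ∈ Submodule.span ℝ (incl F n '' omegaDeg F n) ↔ _
  rw [span_incl_omegaDeg, mem_span_real_image_iff]
  simp only [h1, Complex.ofReal_im, implies_true, true_and, Complex.ofReal_eq_zero]
  rfl

variable (F) in
/-- The structure maps of the real form. -/
noncomputable abbrev bialgReal : BialgData ℝ (realC F) :=
  realData (bialgC F) (realBasis F) (twistBasis F)

/-- S ∘ Fourier is a bialgebra automorphism, so S(Ω(q)) inherits the structure constants, hence the
positivity, of the orbit indicators. -/
theorem repr_mul_twistBasis (i j k : OrbIx F) :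
    (twistBasis F).repr ((bialgC F).mul (twistBasis F i ⊗ₜ[ℂ] twistBasis F j)) k =
      (orbBasis F).repr ((bialgC F).mul (orbBasis F i ⊗ₜ[ℂ] orbBasis F j)) k := by
  rw [mul_twistBasis, twistBasis_repr]

theorem repr_comul_twistBasis (i j k : OrbIx F) :
    ((twistBasis F).tensorProduct (twistBasis F)).repr ((bialgC F).comul (twistBasis F k)) (i, j) =
      (twistBasis F).repr ((bialgC F).mul (twistBasis F i ⊗ₜ[ℂ] twistBasis F j)) k := by
  rw [repr_mul_twistBasis, ← repr_comul_basis, ← twistBasis_tensorProduct_repr,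
    isHom_twistEquiv.map_comul]
  rfl

theorem unit_one_eq_twistBasis : (bialgC F).unit 1 = twistBasis F (orbZero F) := by
  rw [twistBasis_apply, ← unit_one_eq]
  exact (isHom_twistEquiv.map_unit 1).symm

theorem counit_twistBasis (i : OrbIx F) :
    (bialgC F).counit (twistBasis F i) = (twistBasis F).repr (twistBasis F i) (orbZero F) := by
  rw [twistBasis_apply, twistBasis_repr, ← counit_eq_repr]
  exact (isHom_twistEquiv.map_counit _).symm

theorem isRestriction_bialgReal : IsRestriction (realC F) (bialgReal F) (bialgC F) :=
  isRestriction_realData (orbZero F) isRealForm_realBasis repr_comul_twistBasis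
    (fun i j k => by
      rw [repr_mul_twistBasis]
      exact repr_mul_nonneg i j k)
    unit_one_eq_twistBasis counit_twistBasis

theorem isPSH_bialgReal : (bialgReal F).IsPSH (gradReal F)
    {x : realC F | (x : C F) ∈ antipodeC F '' omega F} := by
  rw [setOf_mem_antipodeC_image_omega]
  exact isPSH_realData (orbZero F) Sigma.fst isRealForm_realBasis repr_comul_twistBasis
    (fun i j k => by
      rw [repr_mul_twistBasis]
      exact repr_mul_nonneg i j k)
    unit_one_eq_twistBasis counit_twistBasis mem_gradReal_iff
    (fun i j k h => repr_mul_degree i j k (by rwa [← repr_mul_twistBasis])) degree_eq_zero_iff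
    isBialgebra isAntipode fun _ hx => antipodeC_mem_realC hx

end GLInv

namespace BialgData

open Module

/-- The structure constants of a descending real PSH algebra are integers. -/
theorem IsDescending.exists_int {ι H : Type*} [AddCommGroup H] [Module ℝ H] {D : BialgData ℝ H}
    {ℋ : ℕ → Submodule ℝ H} (b : Basis ι ℝ H) (h : D.IsDescending ℋ (Set.range b)) (i j k : ι) :
    ∃ z : ℤ, b.repr (D.mul (b i ⊗ₜ[ℝ] b j)) k = z := by
  classical
  obtain ⟨A, _, E, 𝒜, Ψ, hE, φ, hφ, -, hΨ⟩ := h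
  have hmem : ∀ i, ∃ a : A, φ (1 ⊗ₜ[ℤ] a) = b i := fun i => by
    obtain ⟨a, -, ha⟩ := hΨ.ge ⟨i, rfl⟩
    exact ⟨a, ha⟩
  -- Ψ spans A over ℤ and φ carries it into the basis, so the lattice φ(1 ⊗ A), which is closed
  -- under the product, has integral coordinates.
  have hint : ∀ a : A, ∀ k, ∃ z : ℤ, b.repr (φ (1 ⊗ₜ[ℤ] a)) k = z := by
    intro a
    have ha : a ∈ Submodule.span ℤ Ψ := by
      rw [hE.isBasis.2]
      trivial
    induction ha using Submodule.span_induction with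
    | mem a ha =>
      intro k
      obtain ⟨i, hi⟩ := hΨ.le ⟨a, ha, rfl⟩
      refine ⟨if i = k then 1 else 0, ?_⟩
      change b i = φ (1 ⊗ₜ[ℤ] a) at hi
      rw [← hi, b.repr_self, Finsupp.single_apply]
      split_ifs <;> simp
    | zero => exact fun k => ⟨0, by simp⟩
    | add x y _ _ hx hy =>
      intro k
      obtain ⟨z, hz⟩ := hx k
      obtain ⟨w, hw⟩ := hy k
      exact ⟨z + w, by simp [TensorProduct.tmul_add, hz, hw]⟩
    | smul r x _ hx =>
      intro k
      obtain ⟨z, hz⟩ := hx k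
      refine ⟨r * z, ?_⟩
      have h1 : (1 : ℝ) ⊗ₜ[ℤ] (r • x) = (r : ℝ) • ((1 : ℝ) ⊗ₜ[ℤ] x) := by
        rw [TensorProduct.tmul_smul, TensorProduct.smul_tmul', TensorProduct.smul_tmul']
        simp
      rw [h1, map_smul, map_smul, Finsupp.smul_apply, hz, smul_eq_mul]
      push_cast
      rfl
  obtain ⟨x, hx⟩ := hmem i
  obtain ⟨y, hy⟩ := hmem j
  have h1 : D.mul (b i ⊗ₜ[ℝ] b j) = φ (1 ⊗ₜ[ℤ] E.mul (x ⊗ₜ[ℤ] y)) := by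
    rw [← hx, ← hy]
    have h2 := hφ.map_mul ((1 ⊗ₜ[ℤ] x) ⊗ₜ[ℝ] (1 ⊗ₜ[ℤ] y))
    rw [TensorProduct.map_tmul] at h2
    refine h2.symm.trans (congrArg φ ?_)
    simp [baseChange]
  rw [h1]
  exact hint _ k

end BialgData

namespace GLInv

open Module BialgData
open scoped BigOperators

variable {F : Type*} [Field F] [Fintype F] [DecidableEq F]

/-! ### The indicator functions of zero -/

theorem orbInd_zero_apply {n : ℕ} (x : Mat F n) :
    (orbInd (0 : Mat F n)).1 x = if x = 0 then 1 else 0 := by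
  change (if _ then (1 : ℂ) else 0) = _
  congr 1
  refine propext ⟨?_, ?_⟩
  · rintro ⟨g, rfl⟩
    simp [Ad]
  · rintro rfl
    exact ⟨1, (Ad_one 0).symm⟩

theorem out_mk_zero (n : ℕ) : (Quotient.mk (orbSetoid F n) 0).out = 0 := by
  have h := InvFun.apply_out (orbInd (0 : Mat F n)) 0
  rw [orbInd_zero_apply, orbInd_zero_apply, if_pos rfl] at h
  by_contra hne
  rw [if_neg hne] at h
  exact zero_ne_one h

theorem orbCard_zero (n : ℕ) : orbCard (0 : Mat F n) = 1 := by
  classical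
  unfold orbCard
  rw [Finset.card_eq_one]
  refine ⟨0, Finset.ext fun y => ?_⟩
  simp only [Finset.mem_filter, Finset.mem_univ, true_and, Finset.mem_singleton]
  constructor
  · rintro ⟨g, rfl⟩
    simp [Ad]
  · rintro rfl
    exact ⟨1, (Ad_one 0).symm⟩

variable (F) in
/-- The orbit of `0` in degree `n`. -/
def zeroIx (n : ℕ) : OrbIx F := ⟨n, Quotient.mk _ 0⟩

theorem orbScale_zeroIx_sq (n : ℕ) :
    orbScale (zeroIx F n).2 * orbScale (zeroIx F n).2 = Fintype.card (GL (Fin n) F) := by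
  rw [orbScale_sq, zeroIx, out_mk_zero, orbCard_zero, Nat.cast_one, div_one]

theorem orbBasis_zeroIx (n : ℕ) :
    orbBasis F (zeroIx F n) = (orbScale (zeroIx F n).2 : ℂ) • incl F n (orbInd 0) := by
  rw [orbBasis_apply, ← map_smul, zeroIx, out_mk_zero]

section Ev

variable {V W : Type*} [AddCommGroup V] [Module F V] [Finite V] [AddCommGroup W] [Module F W]
  [Finite W]

open Classical in
theorem ev_incl_orbInd_zero {n : ℕ} (hn : finrank F V = n) (x : End F V) :
    ev x (incl F n (orbInd 0)) = if x = 0 then 1 else 0 := by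
  subst hn
  rw [ev_incl (finBasis F V), orbInd_zero_apply]
  simp

theorem glue_eq_zero_iff (x : End F V) (y : End F W) (u : W →ₗ[F] V) :
    glue x y u = 0 ↔ x = 0 ∧ y = 0 ∧ u = 0 := by
  constructor
  · intro h
    have h1 : ∀ v w, (x v + u w, y w) = (0 : V × W) := fun v w => by
      rw [← glue_apply x y u (v, w), h]
      rfl
    refine ⟨LinearMap.ext fun v => ?_, LinearMap.ext fun w => ?_, LinearMap.ext fun w => ?_⟩
    · simpa using congrArg Prod.fst (h1 v 0)
    · exact congrArg Prod.snd (h1 0 w)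
    · simpa using congrArg Prod.fst (h1 0 w)
  · rintro ⟨rfl, rfl, rfl⟩
    refine LinearMap.ext fun p => ?_
    rw [glue_apply]
    simp

/-- A gluing vanishes only if both diagonal parts and the corner do, so one corner out of |Hom(W,
V)| contributes. -/
theorem ev₂_comul_incl_orbInd_zero {k l n : ℕ} (hV : finrank F V = k) (hW : finrank F W = l)
    (hn : k + l = n) (x : End F V) (y : End F W) :
    ev₂ x y ((bialgC F).comul (incl F n (orbInd 0))) = (Fintype.card (W →ₗ[F] V) : ℂ)⁻¹ *
      (ev x (incl F k (orbInd 0)) * ev y (incl F l (orbInd 0))) := by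
  classical
  have hn' : finrank F (V × W) = n := by rw [finrank_prod, hV, hW, hn]
  rw [ev₂_comul, Fintype.expect_eq_sum_div_card, div_eq_inv_mul]
  congr 1
  simp only [ev_incl_orbInd_zero hn', ev_incl_orbInd_zero hV, ev_incl_orbInd_zero hW, glue_eq_zero_iff]
  by_cases hx : x = 0 <;> by_cases hy : y = 0 <;> simp [hx, hy]

theorem card_linearMap : Fintype.card (W →ₗ[F] V) =
    Fintype.card F ^ (finrank F V * finrank F W) := by
  rw [← Nat.card_eq_fintype_card, ← Nat.card_eq_fintype_card (α := F),
    Module.natCard_eq_pow_finrank (K := F), finrank_linearMap, mul_comm]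

end Ev

/-! ### A structure constant that is not an integer -/

/-- By self-duality this is a comultiplication constant, determined by the value q^(−kl) of the
coproduct of the indicator of 0 at (0, 0). -/
theorem repr_mul_zeroIx (k l : ℕ) :
    (orbBasis F).repr ((bialgC F).mul (orbBasis F (zeroIx F k) ⊗ₜ[ℂ] orbBasis F (zeroIx F l)))
      (zeroIx F (k + l)) = ((orbScale (zeroIx F (k + l)).2 /
        (orbScale (zeroIx F k).2 * orbScale (zeroIx F l).2 * Fintype.card F ^ (k * l)) : ℝ) : ℂ) := by
  rw [← repr_comul_basis, orbBasis_tensor_repr, orbBasis_zeroIx, map_smul, map_smul]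
  change _ * ((orbScale (zeroIx F (k + l)).2 : ℂ) •
    ev₂ (Matrix.toLin' (Quotient.mk (orbSetoid F k) 0).out)
      (Matrix.toLin' (Quotient.mk (orbSetoid F l) 0).out) _) = _
  rw [out_mk_zero, out_mk_zero, map_zero, map_zero, ev₂_comul_incl_orbInd_zero (by simp) (by simp) rfl,
    ev_incl_orbInd_zero (by simp), ev_incl_orbInd_zero (by simp), if_pos rfl, if_pos rfl, card_linearMap]
  simp only [finrank_fintype_fun_eq_card, Fintype.card_fin, smul_eq_mul]
  push_cast
  field_simp

/-- |GL₁| = q − 1 and |GL₂| = (q² − 1)(q² − q), so c² = |GL₂| / (|GL₁|² q²) = (q + 1)/q. -/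
theorem structure_constant_sq {c : ℝ} (hc : c = orbScale (zeroIx F 2).2 /
    (orbScale (zeroIx F 1).2 * orbScale (zeroIx F 1).2 * Fintype.card F ^ (1 * 1))) :
    c * c * Fintype.card F = Fintype.card F + 1 := by
  have hq : 1 < Fintype.card F := Fintype.one_lt_card
  have h1 : orbScale (zeroIx F 1).2 * orbScale (zeroIx F 1).2 = (Fintype.card F : ℝ) - 1 := by
    rw [orbScale_zeroIx_sq, ← Nat.card_eq_fintype_card, Matrix.card_GL_field,
      Fin.prod_univ_one, Nat.cast_sub (by simpa using hq.le)]
    simp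
  have h2 : orbScale (zeroIx F 2).2 * orbScale (zeroIx F 2).2 =
      ((Fintype.card F : ℝ) ^ 2 - 1) * ((Fintype.card F : ℝ) ^ 2 - Fintype.card F) := by
    rw [orbScale_zeroIx_sq, ← Nat.card_eq_fintype_card, Matrix.card_GL_field,
      Fin.prod_univ_two, Nat.cast_mul, Nat.cast_sub, Nat.cast_sub]
    · simp
    · simpa using Nat.le_self_pow two_ne_zero _
    · simpa using Nat.one_le_pow _ _ (by omega)
  have hq' : (1 : ℝ) < Fintype.card F := by exact_mod_cast hq
  have h3 : (Fintype.card F : ℝ) - 1 ≠ 0 := by linarith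
  have h4 : (Fintype.card F : ℝ) ≠ 0 := by linarith
  rw [hc, h1, div_mul_div_comm, h2]
  field_simp
  ring

/-- An integral constant z would satisfy z² q = q + 1, making q a divisor of 1. -/
theorem not_isDescending_bialgReal : ¬ (bialgReal F).IsDescending (gradReal F)
    {x : realC F | (x : C F) ∈ antipodeC F '' omega F} := by
  rw [setOf_mem_antipodeC_image_omega]
  intro h
  obtain ⟨z, hz⟩ := h.exists_int (realBasis F) (zeroIx F 1) (zeroIx F 1) (zeroIx F 2)
  rw [repr_realData_mul, repr_mul_twistBasis] at hz
  have h1 := congrArg Complex.re (repr_mul_zeroIx (F := F) 1 1)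
  rw [Complex.ofReal_re] at h1
  have h2 := structure_constant_sq (hz.symm.trans h1)
  have h3 : z * z * Fintype.card F = Fintype.card F + 1 := by exact_mod_cast h2
  have h4 : (Fintype.card F : ℤ) ∣ 1 := (Int.dvd_add_right (dvd_refl _)).1 ⟨z * z, by rw [← h3]; ring⟩
  have h5 : 1 < Fintype.card F := Fintype.one_lt_card
  have := Int.le_of_dvd one_pos h4
  omega

end GLInv

namespace GLInv

open Module BialgData
open scoped BigOperators

variable {F : Type*} [Field F] [Fintype F] [DecidableEq F]

/-! ### The antipode of the indicator function of zero -/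

variable (F) in
/-- The indicator function of `0 ∈ 𝔤𝔩ₙ(F)`. -/
noncomputable abbrev zeroInd (n : ℕ) : C F := incl F n (orbInd 0)

theorem unit_one_eq_zeroInd : (bialgC F).unit 1 = zeroInd F 0 := by
  have h : (bialgC F).unit 1 = incl F 0 (oneFun F 0) := by simp [bialgC]
  rw [h]
  refine congrArg _ (Subtype.ext (funext fun x => ?_))
  rw [orbInd_zero_apply, if_pos (Subsingleton.elim _ _)]
  rfl

theorem comul_zeroInd (n : ℕ) : (bialgC F).comul (zeroInd F n) =
    ∑ p ∈ Finset.HasAntidiagonal.antidiagonal n,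
      ((Fintype.card F : ℂ) ^ (p.1 * p.2))⁻¹ • (zeroInd F p.1 ⊗ₜ[ℂ] zeroInd F p.2) := by
  refine C.ext_ev₂ fun k A l B => ?_
  rw [map_sum]
  by_cases h : k + l = n
  · rw [ev₂_comul_incl_orbInd_zero (by simp) (by simp) h, Finset.sum_eq_single (k, l), map_smul,
      ev₂_tmul, card_linearMap]
    · simp
    · rintro ⟨i, j⟩ - hij
      rw [map_smul, ev₂_tmul]
      by_cases hi : k = i
      · by_cases hj : l = j
        · exact absurd (Prod.ext hi.symm hj.symm) hij
        · rw [ev_incl_of_ne (n := j) _ (by simpa using hj), mul_zero, smul_zero]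
      · rw [ev_incl_of_ne (n := i) _ (by simpa using hi), zero_mul, smul_zero]
    · exact fun hn => absurd (Finset.HasAntidiagonal.mem_antidiagonal.2 h) hn
  · rw [ev₂_comul, Finset.expect_eq_zero, Finset.sum_eq_zero]
    · rintro ⟨i, j⟩ hij
      rw [map_smul, ev₂_tmul]
      by_cases hi : k = i
      · have hj : l ≠ j := by
          rintro rfl
          exact h (hi ▸ Finset.HasAntidiagonal.mem_antidiagonal.1 hij)
        rw [ev_incl_of_ne (n := j) _ (by simpa using hj), mul_zero, smul_zero]
      · rw [ev_incl_of_ne (n := i) _ (by simpa using hi), zero_mul, smul_zero]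
    · intro u _
      exact ev_incl_of_ne _ (by simpa using h) _

/-! ### Values of the antipode of the indicator of zero -/

section Kernel

variable {U V W : Type*} [AddCommGroup U] [Module F U] [Finite U] [AddCommGroup V] [Module F V]
  [Finite V] [AddCommGroup W] [Module F W] [Finite W]

theorem hallTerm_zeroInd_eq_zero {k : ℕ} (b : C F) (x : End F V) (N : Submodule F V)
    (h : ¬ (finrank F N = k ∧ N ≤ LinearMap.ker x)) : hallTerm (zeroInd F k) b x N = 0 := by
  by_cases hN : N ≤ N.comap x
  · rw [hallTerm_of_le _ _ hN]
    by_cases hk : finrank F N = k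
    · rw [ev_incl_orbInd_zero hk, if_neg, zero_mul]
      intro h0
      refine h ⟨hk, fun v hv => ?_⟩
      exact congrArg Subtype.val (LinearMap.congr_fun h0 ⟨v, hv⟩)
    · rw [ev_incl_of_ne _ hk, zero_mul]
  · exact hallTerm_of_not_le _ _ hN

theorem ker_glue_zero (y : End F W) (u : W →ₗ[F] U) : LinearMap.ker (glue 0 y u) =
    (LinearMap.ker u ⊓ LinearMap.ker y).comap (LinearMap.snd F U W) := by
  ext ⟨v, w⟩
  simp

theorem finrank_ker_snd : finrank F (LinearMap.ker (LinearMap.snd F U W)) = finrank F U := by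
  rw [LinearMap.ker_snd, LinearMap.finrank_range_of_inj LinearMap.inl_injective]

/-- By the kernel condition, the glued endomorphism has kernel exactly the line U × 0. In the
identity id * S = ηε evaluated there, only the zero subspace and this line contribute, and the
identity is solved for the term of the zero subspace. -/
theorem ev_glue_antipodeC_zeroInd {m : ℕ} (hU : finrank F U = 1) (hW : finrank F W = m)
    (y : End F W) (u : W →ₗ[F] U) (hu : LinearMap.ker u ⊓ LinearMap.ker y = ⊥) :
    ev (glue 0 y u) (antipodeC F (zeroInd F (m + 1))) =
      -(((Fintype.card F : ℂ) ^ m)⁻¹ * ev y (antipodeC F (zeroInd F m))) := by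
  have hK : LinearMap.ker (glue 0 y u) = LinearMap.ker (LinearMap.snd F U W) := by
    rw [ker_glue_zero, hu]
    rfl
  have hfin : finrank F (U × W) = m + 1 := by rw [finrank_prod, hU, hW, add_comm]
  have h0 := congrArg (ev (glue 0 y u)) (mul_lTensor_antipodeC (zeroInd F (m + 1)))
  rw [ev_unit, if_neg (by omega), comul_zeroInd, map_sum, map_sum, map_sum,
    Finset.Nat.sum_antidiagonal_eq_sum_range_succ_mk, Finset.sum_range_succ',
    Finset.sum_range_succ'] at h0
  -- The terms of first degree at least 2 would need a subspace of that dimension inside the kernel,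
  -- which is a line.
  have h1 : ∀ k ∈ Finset.range m, ev (glue 0 y u) ((bialgC F).mul ((antipodeC F).lTensor (C F)
      (((Fintype.card F : ℂ) ^ ((k + 1 + 1) * (m + 1 - (k + 1 + 1))))⁻¹ •
        (zeroInd F (k + 1 + 1) ⊗ₜ[ℂ] zeroInd F (m + 1 - (k + 1 + 1)))))) = 0 := by
    intro k _
    rw [map_smul, map_smul, map_smul, LinearMap.lTensor_tmul, ev_mul, Finset.sum_eq_zero, smul_zero]
    intro N _
    refine hallTerm_zeroInd_eq_zero _ _ _ ?_
    rintro ⟨hN, hle⟩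
    have := Submodule.finrank_mono (hle.trans hK.le)
    rw [finrank_ker_snd] at this
    omega
  have h2 : ev (glue 0 y u) ((bialgC F).mul (zeroInd F 1 ⊗ₜ[ℂ] antipodeC F (zeroInd F m))) =
      ev y (antipodeC F (zeroInd F m)) := by
    rw [ev_mul, Finset.sum_eq_single (LinearMap.ker (LinearMap.snd F U W)), hallTerm_ker_snd]
    · have e1 : LinearMap.fst F U W ∘ₗ glue 0 y u ∘ₗ LinearMap.inl F U W = 0 :=
        LinearMap.ext fun v => by simp
      have e2 : LinearMap.snd F U W ∘ₗ glue 0 y u ∘ₗ LinearMap.inr F U W = y :=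
        LinearMap.ext fun v => by simp
      rw [e1, e2, ev_incl_orbInd_zero hU, if_pos rfl, one_mul]
    · exact LinearMap.ext fun v => by simp
    · intro N _ hN
      refine hallTerm_zeroInd_eq_zero _ _ _ ?_
      rintro ⟨h1, hle⟩
      exact hN (Submodule.eq_of_le_of_finrank_eq (hle.trans hK.le) (by rw [finrank_ker_snd, h1, hU]))
    · exact fun h => absurd (Finset.mem_univ _) h
  rw [Finset.sum_eq_zero h1, zero_add, map_smul, map_smul, map_smul, map_smul, map_smul, map_smul,
    LinearMap.lTensor_tmul, LinearMap.lTensor_tmul, zero_add, Nat.add_sub_cancel, Nat.sub_zero, h2,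
    ← unit_one_eq_zeroInd, isBialgebra.one_mul, zero_mul, pow_zero, inv_one, one_smul, one_mul,
    smul_eq_mul] at h0
  exact eq_neg_of_add_eq_zero_right h0

theorem ev_zero_antipodeC_zeroInd_one (hU : finrank F U = 1) :
    ev (0 : End F U) (antipodeC F (zeroInd F 1)) = -1 := by
  have h := ev_glue_antipodeC_zeroInd (U := U) (W := Fin 0 → F) (m := 0) hU (by simp) 0 0
    (Subsingleton.elim _ _)
  rw [← unit_one_eq_zeroInd, antipodeC_unit, ev_unit, if_pos (by simp), pow_zero, inv_one,
    mul_one] at h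
  rw [← h]
  refine LinearMap.congr_fun (ev_congr (LinearEquiv.prodUnique (M₂ := Fin 0 → F)).symm
    fun v => ?_) _
  exact Prod.ext (by simp) (Subsingleton.elim _ _)

/-- The average is the coproduct of the antipode at (0, y). As S is comultiplicative, only bidegree
(1, m) matters, and S of the indicator in degree 1 takes the value −1 at 0. The result coincides
with the value at a corner injective on ker y. -/
theorem expect_ev_glue_antipodeC_zeroInd (m : ℕ) (hU : finrank F U = 1)
    (y : End F W) : 𝔼 u : W →ₗ[F] U, ev (glue 0 y u) (antipodeC F (zeroInd F (m + 1))) =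
      -(((Fintype.card F : ℂ) ^ m)⁻¹ * ev y (antipodeC F (zeroInd F m))) := by
  rw [← ev₂_comul, ← antipodeC_comul, comul_zeroInd, map_sum, map_sum, Finset.sum_eq_single (1, m)]
  · rw [map_smul, map_smul, TensorProduct.map_tmul, ev₂_tmul, ev_zero_antipodeC_zeroInd_one hU,
      one_mul, smul_eq_mul]
    ring
  · rintro ⟨i, j⟩ hij hne
    have h1 : i + j = m + 1 := Finset.HasAntidiagonal.mem_antidiagonal.1 hij
    have h2 : finrank F U ≠ i := by
      rintro rfl
      exact hne (Prod.ext hU (by change j = m; omega))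
    rw [map_smul, map_smul, TensorProduct.map_tmul, ev₂_tmul, antipodeC_incl, ev_incl_of_ne _ h2,
      zero_mul, smul_zero]
  · exact fun h => absurd (Finset.HasAntidiagonal.mem_antidiagonal.2 (add_comm 1 m)) h

/-- A space of dimension at most one embeds in the line U; extend such an embedding of ker y to W.
-/
theorem exists_ker_inf_eq_bot (hU : finrank F U = 1) (y : End F W)
    (hy : finrank F (LinearMap.ker y) ≤ 1) :
    ∃ u : W →ₗ[F] U, LinearMap.ker u ⊓ LinearMap.ker y = ⊥ := by
  obtain ⟨f, hf⟩ := (finrank_le_iff_exists_linearMap (R := F) (M := LinearMap.ker y) (M' := U)).1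
    (hU ▸ hy)
  obtain ⟨u, hu⟩ := LinearMap.exists_extend f
  refine ⟨u, (Submodule.eq_bot_iff _).2 ?_⟩
  rintro w ⟨h1, h2⟩
  have h3 : f ⟨w, h2⟩ = 0 := by
    rw [← hu]
    exact h1
  exact congrArg Subtype.val (hf (h3.trans (map_zero f).symm))

end Kernel

variable (F) in
-- Starting from the zero space, keep gluing a line by a corner injective on the kernel. The kernel
-- is then the new line, and the value is multiplied by the nonzero factor −q^(−n).
theorem exists_ev_antipodeC_zeroInd_ne_zero (n : ℕ) : ∃ y : End F (Fin n → F),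
    finrank F (LinearMap.ker y) = min n 1 ∧ ev y (antipodeC F (zeroInd F n)) ≠ 0 := by
  induction n with
  | zero =>
    refine ⟨0, finrank_zero_of_subsingleton, ?_⟩
    rw [← unit_one_eq_zeroInd, antipodeC_unit, ev_unit, if_pos (by simp)]
    exact one_ne_zero
  | succ n ih =>
    obtain ⟨y, hy, hne⟩ := ih
    have hU : finrank F F = 1 := finrank_self F
    obtain ⟨u, hu⟩ := exists_ker_inf_eq_bot hU y (by omega)
    let e : (F × (Fin n → F)) ≃ₗ[F] (Fin (n + 1) → F) :=
      LinearEquiv.ofFinrankEq _ _ (by simp [add_comm])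
    refine ⟨e.conj (glue 0 y u), ?_, ?_⟩
    · have h1 : LinearMap.ker (e.conj (glue 0 y u)) =
          (LinearMap.ker (glue 0 y u)).map e.toLinearMap := by
        ext w
        rw [Submodule.map_equiv_eq_comap_symm]
        simp [LinearEquiv.conj_apply]
      rw [h1, LinearEquiv.finrank_map_eq, ker_glue_zero, hu, Submodule.comap_bot, finrank_ker_snd, hU]
      omega
    · rw [← ev_congr e (x := glue 0 y u) fun v => by simp [LinearEquiv.conj_apply],
        ev_glue_antipodeC_zeroInd hU (by simp) y u hu]
      refine neg_ne_zero.2 (mul_ne_zero (inv_ne_zero (pow_ne_zero _ ?_)) hne)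
      exact Nat.cast_ne_zero.2 Fintype.card_ne_zero

end GLInv

namespace GLInv

open Module BialgData
open scoped BigOperators

variable {F : Type*} [Field F] [Fintype F] [DecidableEq F]

/-! ### The Steinberg function -/

theorem rank_Ad {n : ℕ} (g : GL (Fin n) F) (x : Mat F n) : (Ad g x).rank = x.rank := by
  rw [Ad, Matrix.rank_mul_eq_left_of_isUnit_det _ _ (Matrix.isUnits_det_units _),
    Matrix.rank_mul_eq_right_of_isUnit_det _ _ (Matrix.isUnits_det_units _)]

theorem ev_incl_orbInd_eq_zero_or {V : Type*} [AddCommGroup V] [Module F V] [Finite V] {n : ℕ}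
    (x : Mat F n) (z : End F V) : ev z (incl F n (orbInd x)) = 0 ∨
      (ev z (incl F n (orbInd x)) = 1 ∧ finrank F (LinearMap.range z) = x.rank) := by
  by_cases hn : finrank F V = n
  · subst hn
    rw [ev_incl (finBasis F V)]
    rcases orbInd_eq_zero_or x (LinearMap.toMatrix (finBasis F V) (finBasis F V) z) with h | ⟨h, g, hg⟩
    · exact Or.inl h
    · refine Or.inr ⟨h, ?_⟩
      rw [← rank_Ad g x, ← hg,
        Matrix.rank_eq_finrank_range_toLin _ (finBasis F V) (finBasis F V), Matrix.toLin_toMatrix]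
  · exact Or.inl (ev_incl_of_ne z hn _)

/-- The antipode of the indicator function of `0` is not proportional to that of an orbit. -/
theorem smul_antipodeC_zeroInd_ne {n : ℕ} (hn : 2 ≤ n) (c : ℂ) (x : Mat F n) :
    c • antipodeC F (zeroInd F n) ≠ incl F n (orbInd x) := by
  obtain ⟨m, rfl⟩ := Nat.exists_eq_add_of_le' (show 1 ≤ n by omega)
  intro h
  have hc : c ≠ 0 := by
    rintro rfl
    have h1 := congrArg (fun a => (comp F (m + 1) a).1 x) h
    simp only [zero_smul, map_zero, comp_incl, orbInd_apply_self] at h1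
    exact zero_ne_one h1
  have hU : finrank F F = 1 := finrank_self F
  obtain ⟨y, hy, hne⟩ := exists_ev_antipodeC_zeroInd_ne_zero F m
  -- Here n ≥ 2 enters, as m ≥ 1: for m = 0 the kernel of y would be zero and the final comparison
  -- of ranks would give no contradiction.
  rw [min_eq_right (by omega)] at hy
  obtain ⟨u, hu⟩ := exists_ker_inf_eq_bot hU y hy.le
  let z : ((Fin m → F) →ₗ[F] F) → End F (F × (Fin m → F)) := fun v => glue 0 y v
  have hv : ev (z u) (incl F (m + 1) (orbInd x)) ≠ 0 := by
    rw [← h, map_smul, ev_glue_antipodeC_zeroInd hU (by simp) y u hu, smul_eq_mul]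
    refine mul_ne_zero hc (neg_ne_zero.2 (mul_ne_zero (inv_ne_zero (pow_ne_zero _ ?_)) hne))
    exact Nat.cast_ne_zero.2 Fintype.card_ne_zero
  have hu1 := (ev_incl_orbInd_eq_zero_or x (z u)).resolve_left hv
  -- The average over all corners equals the value at the corner u, which is 1.
  have havg : 𝔼 v, ev (z v) (incl F (m + 1) (orbInd x)) = 1 := by
    rw [← hu1.1, ← h, map_smul, ev_glue_antipodeC_zeroInd hU (by simp) y u hu,
      ← expect_ev_glue_antipodeC_zeroInd m hU y, Finset.smul_expect]
    simp only [map_smul, z]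
  -- Values in {0, 1} with average 1 are all 1, so every corner gives an endomorphism in the orbit
  -- of x.
  have hall : ∀ v, ev (z v) (incl F (m + 1) (orbInd x)) = 1 := by
    have h1 : ∀ v ∈ Finset.univ, (0 : ℝ) ≤ 1 - (ev (z v) (incl F (m + 1) (orbInd x))).re := by
      intro v _
      rcases ev_incl_orbInd_eq_zero_or x (z v) with h0 | ⟨h0, -⟩ <;> rw [h0] <;> simp
    have h2 : ∑ v, (1 - (ev (z v) (incl F (m + 1) (orbInd x))).re) = 0 := by
      rw [Fintype.expect_eq_sum_div_card, div_eq_one_iff_eq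
        (Nat.cast_ne_zero.2 Fintype.card_ne_zero)] at havg
      rw [Finset.sum_sub_distrib, ← Complex.re_sum, havg]
      simp
    intro v
    have h3 := (Finset.sum_eq_zero_iff_of_nonneg h1).1 h2 v (Finset.mem_univ v)
    rcases ev_incl_orbInd_eq_zero_or x (z v) with h0 | ⟨h0, -⟩
    · rw [h0] at h3
      norm_num at h3
    · exact h0
  -- The contradiction is in the ranks: the zero corner gives rank y = m − 1, whereas u gives m.
  have h01 := (ev_incl_orbInd_eq_zero_or x (z 0)).resolve_left (by rw [hall]; exact one_ne_zero)
  have e1 : finrank F (LinearMap.range (z 0)) = finrank F (LinearMap.range y) := by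
    have h3 : z 0 = LinearMap.inr F F (Fin m → F) ∘ₗ y ∘ₗ LinearMap.snd F F (Fin m → F) :=
      LinearMap.ext fun v => by simp [z]
    rw [h3, LinearMap.range_comp, LinearMap.range_comp, LinearMap.range_eq_top.2 LinearMap.snd_surjective,
      Submodule.map_top]
    exact (Submodule.equivMapOfInjective _ LinearMap.inr_injective _).finrank_eq.symm
  have e2 := LinearMap.finrank_range_add_finrank_ker (z u)
  have e3 := LinearMap.finrank_range_add_finrank_ker y
  have k2 : finrank F (LinearMap.ker (z u)) = 1 := by
    rw [ker_glue_zero, hu, Submodule.comap_bot, finrank_ker_snd, hU]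
  rw [finrank_prod, hU] at e2
  omega

/-- Since S commutes with the Fourier transform, this reduces the Steinberg function to S of the
indicator of 0. -/
theorem incl_oneFun (n : ℕ) :
    incl F n (oneFun F n) = (sqrtCard F n : ℂ) • fourierC (zeroInd F n) := by
  rw [fourierC_incl, map_smul, smul_smul, mul_inv_cancel₀ (sqrtCard_ne n), one_smul]
  refine congrArg _ (Subtype.ext (funext fun x => ?_))
  simp only [fhat_apply, orbInd_zero_apply]
  rw [Finset.sum_eq_single 0]
  · simp [oneFun]
  · intro y _ hy
    rw [if_neg hy, zero_mul]
  · simp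

/-- No multiple of the Steinberg function is an irreducible invariant character. -/
theorem not_isIrrInvChar_smul_steinberg {n : ℕ} (hn : 2 ≤ n) (c : ℂ) :
    ¬ IsIrrInvChar (c • steinberg F n) := by
  intro h
  obtain ⟨x, hx⟩ := (isIrrInvChar_iff _).1 h
  -- The sign (−1)ⁿ converts 𝒟ₙ into the antipode, and injectivity of the Fourier transform brings
  -- the comparison back to orbit indicators.
  refine smul_antipodeC_zeroInd_ne hn (c * (-1) ^ n) x (fourierC_bijective.1 ?_)
  have h1 : (-1 : ℂ) ^ n • incl F n (steinberg F n) =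
      (sqrtCard F n : ℂ) • fourierC (antipodeC F (zeroInd F n)) := by
    rw [← antipodeC_fourierC, ← map_smul, ← map_smul, ← incl_oneFun, antipodeC_incl, ← smul_dual]
    rfl
  have h2 := congrArg (fun f => (sqrtCard F n : ℂ)⁻¹ • incl F n f) hx
  have h3 : (-1 : ℂ) ^ n * (-1) ^ n = 1 := by rw [← mul_pow]; simp
  have h4 : incl F n (steinberg F n) =
      ((-1 : ℂ) ^ n * sqrtCard F n) • fourierC (antipodeC F (zeroInd F n)) := by
    rw [mul_smul, ← h1, smul_smul, h3, one_smul]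
  rw [fourierC_incl, map_smul (incl F n) _ (fhat F n (orbInd x)), ← h2, map_smul, map_smul, h4,
    smul_smul, smul_smul]
  congr 1
  have := sqrtCard_ne (F := F) n
  field_simp

/-- Equality would make S of the normalised indicator of 0 in degree 2 a normalised orbit indicator,
after removing the Fourier transform. -/
theorem antipodeC_image_omega_ne : antipodeC F '' omega F ≠ omega F := by
  intro h
  have h1 : antipodeC F (fourierC (orbBasis F (zeroIx F 2))) ∈ omega F := by
    rw [← h, omega_eq_range]
    exact ⟨_, ⟨zeroIx F 2, rfl⟩, rfl⟩
  rw [omega_eq_range, antipodeC_fourierC] at h1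
  obtain ⟨j, hj⟩ := h1
  have h2 := fourierC_bijective.1 hj
  have h3 : j.1 = 2 := by
    by_contra hne
    have h4 : orbBasis F j ∈ gradC F 2 := by
      rw [h2, orbBasis_zeroIx, map_smul, antipodeC_incl, ← map_smul]
      exact ⟨_, rfl⟩
    have h5 := (mem_gradC_iff _ _).1 h4 j hne
    rw [Basis.repr_self, Finsupp.single_eq_same] at h5
    exact one_ne_zero h5
  obtain ⟨n, o⟩ := j
  obtain rfl : n = 2 := h3
  refine smul_antipodeC_zeroInd_ne le_rfl ((orbScale o : ℂ)⁻¹ * orbScale (zeroIx F 2).2) o.out ?_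
  rw [mul_smul, ← map_smul, ← orbBasis_zeroIx, ← h2, orbBasis_apply, map_smul, smul_smul,
    inv_mul_cancel₀ (orbScale_ne o), one_smul]

end GLInv

theorem mainTheorem8 (F : Type*) [Field F] [Fintype F] [DecidableEq F] :
    -- `C(q)` is a connected graded Hopf algebra, and `S = ⨁ (-1)ⁿ 𝒟ₙ` is its antipode
    (GLInv.bialgC F).IsConnectedGradedHopf (GLInv.gradC F) ∧
    (GLInv.bialgC F).IsAntipode (GLInv.antipodeC F) ∧
    -- `S(Ω(q)) ⊆ 𝔠(q)`, the structure maps restrict to `𝔠(q)`, and `(𝔠(q), S(Ω(q)))` is a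
    -- non-descending real PSH algebra
    GLInv.antipodeC F '' GLInv.omega F ⊆ (GLInv.realC F : Set (GLInv.C F)) ∧
    (∃ D₀ : BialgData ℝ (GLInv.realC F),
      BialgData.IsRestriction (GLInv.realC F) D₀ (GLInv.bialgC F) ∧
      D₀.IsPSH (GLInv.gradReal F)
        {x : GLInv.realC F | (x : GLInv.C F) ∈ GLInv.antipodeC F '' GLInv.omega F} ∧
      ¬ D₀.IsDescending (GLInv.gradReal F)
        {x : GLInv.realC F | (x : GLInv.C F) ∈ GLInv.antipodeC F '' GLInv.omega F}) ∧
    -- it differs from `(𝔠(q), Ω(q))`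
    GLInv.antipodeC F '' GLInv.omega F ≠ GLInv.omega F ∧
    -- for `n ≥ 2` no multiple of `Stₙ` is an irreducible invariant character
    (∀ n : ℕ, 2 ≤ n → ∀ c : ℂ, ¬ GLInv.IsIrrInvChar (c • GLInv.steinberg F n)) :=
  ⟨GLInv.isConnectedGradedHopf, GLInv.isAntipode, GLInv.antipodeC_image_omega_subset,
    ⟨GLInv.bialgReal F, GLInv.isRestriction_bialgReal, GLInv.isPSH_bialgReal,
      GLInv.not_isDescending_bialgReal⟩,
    GLInv.antipodeC_image_omega_ne, fun _ hn c => GLInv.not_isIrrInvChar_smul_steinberg hn c⟩
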